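/- **Setting.** Let $X$ be a proper geodesic CAT$(-1)$ metric space, with boundary at infinity $\partial_\infty X$ (asymptotic classes of geodesic rays); for a closed convex subset $C$ let $\partial_\infty C$ be its set of points at infinity. For $\xi_0\in X\cup\partial_\infty X$, let $T^1_{\xi_0}X$ be the space, with the compact-open topology, of the geodesic lines $\gamma:\mathbb R\to X$ with $\gamma(-\infty)=\xi_0$ if $\xi_0\in\partial_\infty X$, and of the geodesic rays $\gamma:[\iota,+\infty[\,\to X$ ($\iota\in\mathbb R$) with $\gamma(\iota)=\xi_0$ if $\xi_0\in X$ (extended by the constant $\xi_0$ on $]-\infty,\iota]$ to define the topology). Its elements are called the geodesic rays or lines starting from $\xi_0$. Such a $\gamma$ *enters* a closed subset $C$ at time $t$ if $t$ is the least time at which $\gamma$ is in $C$; it *meets first $C$ and then $C'$* if it enters both, and $C$ at a strictly smaller time than $C'$. Let $\ell_C(\gamma)\in[0,+\infty]$ be the length of $\gamma\cap C$. For $\epsilon\in\,]0,+\infty[$, a subset is $\epsilon$-convex if it is the closed $\epsilon$-neighbourhood of a convex subset; the $\infty$-convex subsets are the (closed) horoballs. For $\kappa\ge 0$, a $\kappa$-penetration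 map in $C$ (where $\xi_0\notin C\cup\partial_\infty C$) is a map $f:T^1_{\xi_0}X\to[0,+\infty]$ with $\|f-\ell_C\|_\infty\le\kappa$, that is, $f\le \ell_C+\kappa$ and $\ell_C\le f+\kappa$, and such that $f(\gamma)$ is unchanged when $\gamma$ is replaced by $t\mapsto\gamma(t+s)$, $s\in\mathbb R$. If $H=\{y:\beta_\xi(x_0,y)\ge 0\}$ is a horoball with point at infinity $\xi$ and $x_0$ on its boundary horosphere, where $\beta_\xi(x,y)=\lim_{t\to+\infty}\big(d(x,\rho(t))-d(y,\rho(t))\big)$ for any geodesic ray $\rho$ ending at $\xi$, its penetration height map is $\mathfrak{ph}_H(\gamma)=2\sup_t\max\{\beta_\xi(x_0,\gamma(t)),0\}$. **Constants.** For $0<\epsilon<\infty$ and $\eta>0$ let $$c_0(\epsilon)=2\log\frac{2(1+e^{\epsilon/2})\sinh\epsilon}{\epsilon},\quad c_1'(\epsilon)=2\operatorname{arsinh}(\coth\epsilon),\quad c''(\epsilon)=\tfrac2\epsilon\operatorname{arcosh}(2\cosh\tfrac\epsilon2),\quad c_3'(\epsilon)=3+\frac{2c_1'(\epsilon)}{\epsilon},$$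 $$c_2'(\epsilon)=\max\Big\{c''(\epsilon)+1,\ \frac{2c_1'(\epsilon)}{\epsilon},\ \sqrt{\frac{\cosh\epsilon}{\cosh\epsilon-1}}\ \frac{\sinh c_1'(\epsilon)}{c_1'(\epsilon)}\Big\},$$ $$h'(\epsilon,\eta)=\max\Big\{2\eta+\max\{0,-2\log\tfrac\epsilon2\},\ \eta+c_1'(\epsilon)+c_0(\epsilon)\Big\},$$ and let $$c_0(\infty)=4.056,\quad c_1'(\infty)=2\log(1+\sqrt2),\quad c_2'(\infty)=c_3'(\infty)=\tfrac52,\quad h'(\infty,\eta)=3\eta+c_0(\infty)+c_1'(\infty).$$ Given $\epsilon_0\in\,]0,+\infty]$, $\delta_0,\kappa_0\ge0$, a subset $C_0$ and a map $f_0$ on $T^1_{\xi_0}X$, let $c_1=\frac1{19}$ if $\epsilon_0=\infty$, $\delta_0=0$ and $f_0=\mathfrak{ph}_{C_0}$, and $c_1=c_1'(\epsilon_0)$ otherwise; let $c_5=2\max\{c_2'(\epsilon_0),c_3'(\epsilon_0)\}\sinh(c_1+\delta_0)$, $$h_0=\max\{\delta_0+\kappa_0,\ c_0(\epsilon_0)+\kappa_0,\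 h'(\epsilon_0,\sinh(\delta_0+c_1))\},\qquad h_1'=h_0'+2c_5\quad\text{for } h'_0\geq 0 .$$ **Proposition 4.10.** Let $X$ be a proper geodesic CAT$(-1)$ metric space, $\epsilon_0\in\,]0,+\infty]$, $\delta_0,\kappa_0\ge 0$ and $\xi_0\in X\cup\partial_\infty X$. Let $(C_n)_{n\in\mathbb N}$ be a collection of $\epsilon_0$-convex subsets of $X$ with $\xi_0\notin C_0\cup\partial_\infty C_0$, and let $f_0:T^1_{\xi_0}X\to[0,+\infty]$ be a continuous $\kappa_0$-penetration map in $C_0$. Let $h_0'\ge h_0$ and $h\ge h_1'$ be real numbers. Assume that: * (almost disjointness) for all $m\ne n$ in $\mathbb N$, the diameter of $C_n\cap C_m$ is at most $\delta_0$; * (local prescription) for every $n\in\mathbb N-\{0\}$ such that $\xi_0\notin C_n\cup\partial_\infty C_n$, if there exists a geodesic ray or line $\alpha$ starting from $\xi_0$ which meets first $C_0$ and then $C_n$ with $f_0(\alpha)=h$ and $\ell_{C_n}(\alpha)\ge h_0'$, then there exists a geodesic ray or line $\alpha'$ starting from $\xi_0$ which meets first $C_0$ and then $C_n$ with $f_0(\alpha')=h$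 and $\ell_{C_n}(\alpha')=h_0'$; * there exists a geodesic ray or line $\gamma_0$ starting from $\xi_0$ with $f_0(\gamma_0)=h$. Then there exists a geodesic ray or line $\gamma_\infty$ starting from $\xi_0$, entering $C_0$ at time $t=0$, with $f_0(\gamma_\infty)=h$, such that for every $n\in\mathbb N-\{0\}$ such that $\gamma_\infty(\,]\delta_0,+\infty[\,)$ meets $C_n$, one has $\xi_0\notin C_n\cup\partial_\infty C_n$ and $\ell_{C_n}(\gamma_\infty)\le h_1'$. -/

import Mathlib

open Set Filter Topology MeasureTheory
open scoped NNReal ENNReal UpperHalfPlane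

noncomputable section

/-! ### Geodesic spaces, curvature at most `-1`, the boundary at infinity -/

/-- Any two points are joined by a geodesic segment. -/
def IsGeodesicSpace (X : Type*) [MetricSpace X] : Prop :=
  ∀ x y : X, ∃ γ : ℝ → X, γ 0 = x ∧ γ (dist x y) = y ∧
    ∀ s ∈ Icc 0 (dist x y), ∀ t ∈ Icc 0 (dist x y), dist (γ s) (γ t) = |s - t|

/-- The point `z` lies on a geodesic segment from `x` to `y`
(the two conditions are equivalent in a geodesic space). -/
def OnSegment {Y : Type*} [MetricSpace Y] (x y z : Y) : Prop :=
  dist x z + dist z y = dist x y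

/-- The `CAT(-1)` inequality: for every geodesic triangle with vertices `p, q, r`, every
comparison triangle `p', q', r'` in the real hyperbolic plane, and all points `x, y` on two sides
(here the sides `[p, q]` and `[p, r]`; the vertices may be permuted) with comparison points
`x', y'`, one has `d(x, y) ≤ d(x', y')`. -/
def IsCATNegOne (X : Type*) [MetricSpace X] : Prop :=
  ∀ (p q r x y : X) (p' q' r' x' y' : ℍ),
    dist p' q' = dist p q → dist q' r' = dist q r → dist p' r' = dist p r →
    OnSegment p q x → dist p' x' = dist p x → dist x' q' = dist x q →
    OnSegment p r y → dist p' y' = dist p y → dist y' r' = dist y r →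
    dist x y ≤ dist x' y'

section Space

variable {X : Type*} [MetricSpace X]

/-- A subset is convex if it contains the geodesic segments between any two of its points. -/
def IsGeodConvex (C : Set X) : Prop :=
  ∀ x ∈ C, ∀ y ∈ C, ∀ z, OnSegment x y z → z ∈ C

variable (X) in
/-- Geodesic rays, parametrized by `[0, +∞[`. -/
abbrev GeodesicRay : Type _ := {ρ : ℝ≥0 → X // Isometry ρ}

variable (X) in
/-- Two geodesic rays are asymptotic if they stay at bounded distance. -/
instance asymptoticSetoid : Setoid (GeodesicRay X) where
  r ρ σ := ∃ K : ℝ, ∀ t, dist (ρ.1 t) (σ.1 t) ≤ K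
  iseqv :=
    { refl := fun ρ => ⟨0, fun t => by simp⟩
      symm := fun ⟨K, hK⟩ => ⟨K, fun t => by rw [dist_comm]; exact hK t⟩
      trans := fun ⟨K, hK⟩ ⟨L, hL⟩ =>
        ⟨K + L, fun t => (dist_triangle _ _ _).trans (add_le_add (hK t) (hL t))⟩ }

variable (X) in
/-- The boundary at infinity `∂_∞ X`: asymptotic classes of geodesic rays. The compactification
`X ∪ ∂_∞ X` is then the type `X ⊕ BoundaryAtInfinity X`. -/
abbrev BoundaryAtInfinity : Type _ := Quotient (asymptoticSetoid X)

/-- The set `∂_∞ C` of points at infinity of a closed convex subset `C`: the endpoints of the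
geodesic rays contained in `C`. -/
def pointsAtInfinity (C : Set X) : Set (BoundaryAtInfinity X) :=
  {ζ | ∃ ρ : GeodesicRay X, (⟦ρ⟧ : BoundaryAtInfinity X) = ζ ∧ ∀ t, ρ.1 t ∈ C}

/-- The subset `C ∪ ∂_∞ C` of `X ∪ ∂_∞ X`. -/
def withBoundary (C : Set X) : Set (X ⊕ BoundaryAtInfinity X) :=
  Sum.inl '' C ∪ Sum.inr '' pointsAtInfinity C

/-! ### Horoballs and `ε`-convex subsets -/

/-- The Busemann function `β_ξ(x, y) = lim_{t → +∞} (d(x, ρ(t)) - d(y, ρ(t)))`, where `ξ` is the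
endpoint of the geodesic ray `ρ`. -/
def busemann (ρ : GeodesicRay X) (x y : X) : ℝ :=
  limUnder atTop (fun t : ℝ≥0 => dist x (ρ.1 t) - dist y (ρ.1 t))

/-- Closed horoballs, `{y | β_ξ(x, y) ≥ s}`. -/
def IsHoroball (H : Set X) : Prop :=
  ∃ (ρ : GeodesicRay X) (x : X) (s : ℝ), H = {y | s ≤ busemann ρ x y}

/-- `ε`-convex subsets, for `ε ∈ ]0, +∞]`: for finite `ε`, the closed `ε`-neighborhoods of convex
subsets; for `ε = ∞`, the horoballs. -/
def IsEpsConvex (ε : ℝ≥0∞) (C : Set X) : Prop :=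
  (ε ≠ ⊤ ∧ ∃ C' : Set X, IsGeodConvex C' ∧ C = Metric.cthickening ε.toReal C') ∨
    (ε = ⊤ ∧ IsHoroball C)

/-! ### Geodesic rays or lines starting from a point of `X ∪ ∂_∞ X` -/

/-- `γ` is a geodesic ray `[ι, +∞[ → X` with `γ(ι) = x`, extended to `ℝ` by the constant `x` on
`]-∞, ι]`. -/
def IsRayFrom (x : X) (ι : ℝ) (γ : ℝ → X) : Prop :=
  (∀ t ≤ ι, γ t = x) ∧ ∀ s ∈ Ici ι, ∀ t ∈ Ici ι, dist (γ s) (γ t) = |s - t|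

/-- `γ` is a geodesic line with `γ(-∞) = ζ`. -/
def IsLineFrom (ζ : BoundaryAtInfinity X) (γ : ℝ → X) : Prop :=
  Isometry γ ∧ ∃ ρ : GeodesicRay X, (⟦ρ⟧ : BoundaryAtInfinity X) = ζ ∧
    ∀ t : ℝ≥0, ρ.1 t = γ (-(t : ℝ))

/-- `γ` is a geodesic ray (if `ξ ∈ X`) or a geodesic line (if `ξ ∈ ∂_∞ X`) starting from `ξ`. -/
def StartsFrom (ξ : X ⊕ BoundaryAtInfinity X) (γ : ℝ → X) : Prop :=
  match ξ with
  | Sum.inl x => ∃ ι : ℝ, IsRayFrom x ι γ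
  | Sum.inr ζ => IsLineFrom ζ γ

/-- The space `T^1_ξ X` of geodesic rays or lines starting from `ξ`, with the compact-open
topology (induced from `C(ℝ, X)`). -/
abbrev GeodesicsFrom (ξ : X ⊕ BoundaryAtInfinity X) : Type _ :=
  {γ : C(ℝ, X) // StartsFrom ξ γ}

/-- The interval of definition of a geodesic ray (`[ι, +∞[`) or line (`ℝ`) starting from `ξ`. -/
def timeDomain {ξ : X ⊕ BoundaryAtInfinity X} (γ : GeodesicsFrom ξ) : Set ℝ :=
  match ξ with
  | Sum.inl x => {t | ∃ ι ≤ t, IsRayFrom x ι γ.1}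
  | Sum.inr _ => univ

/-- The set of times at which `γ` is in `C`. -/
def timesIn {ξ : X ⊕ BoundaryAtInfinity X} (γ : GeodesicsFrom ξ) (C : Set X) : Set ℝ :=
  {t | t ∈ timeDomain γ ∧ γ.1 t ∈ C}

/-- `γ` enters `C` at time `t`. -/
def EntersAt {ξ : X ⊕ BoundaryAtInfinity X} (γ : GeodesicsFrom ξ) (C : Set X) (t : ℝ) : Prop :=
  IsLeast (timesIn γ C) t

/-- `γ` meets first `C` and then `C'`. -/
def MeetsFirstThen {ξ : X ⊕ BoundaryAtInfinity X} (γ : GeodesicsFrom ξ) (C C' : Set X) : Prop :=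
  ∃ s t : ℝ, EntersAt γ C s ∧ EntersAt γ C' t ∧ s < t

/-! ### Penetration maps -/

/-- The penetration length `ℓ_C(γ)`: the length of `γ ∩ C`. -/
def penetrationLength (C : Set X) {ξ : X ⊕ BoundaryAtInfinity X} (γ : GeodesicsFrom ξ) : ℝ≥0∞ :=
  volume (timesIn γ C)

/-- `f` is a `κ`-penetration map in `C`: `‖f - ℓ_C‖_∞ ≤ κ`. -/
def IsPenetrationMap {ξ : X ⊕ BoundaryAtInfinity X} (κ : ℝ) (C : Set X)
    (f : GeodesicsFrom ξ → ℝ≥0∞) : Prop :=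
  ∀ γ, f γ ≤ penetrationLength C γ + ENNReal.ofReal κ ∧
    penetrationLength C γ ≤ f γ + ENNReal.ofReal κ

/-- `f` does not depend on the choice of the origin of time on the geodesics. -/
def IsShiftInvariant {ξ : X ⊕ BoundaryAtInfinity X} (f : GeodesicsFrom ξ → ℝ≥0∞) : Prop :=
  ∀ (γ γ' : GeodesicsFrom ξ) (s : ℝ), (∀ t, γ'.1 t = γ.1 (t + s)) → f γ' = f γ

/-- `C` is a horoball and `f` is its penetration height map
`γ ↦ 2 sup_t max (β_ξ(x₀, γ(t))) 0`, where `ξ` is the point at infinity of `C` and `x₀` is a point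
of its boundary horosphere. -/
def IsPenetrationHeight {ξ : X ⊕ BoundaryAtInfinity X} (C : Set X)
    (f : GeodesicsFrom ξ → ℝ≥0∞) : Prop :=
  ∃ (ρ : GeodesicRay X) (x₀ : X), C = {y | 0 ≤ busemann ρ x₀ y} ∧
    ∀ γ, f γ = 2 * ⨆ t ∈ timeDomain γ, ENNReal.ofReal (busemann ρ x₀ (γ.1 t))

end Space

/-! ### The constants -/

/-- `c_0(ε)`. -/
def pconst0 (ε : ℝ≥0∞) : ℝ :=
  if ε = ⊤ then 4.056
  else 2 * Real.log
    (2 * (1 + Real.exp (ε.toReal / 2)) * Real.sinh ε.toReal / ε.toReal)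

/-- `c'_1(ε)`. -/
def pconst1' (ε : ℝ≥0∞) : ℝ :=
  if ε = ⊤ then 2 * Real.log (1 + √2)
  else 2 * Real.arsinh (Real.cosh ε.toReal / Real.sinh ε.toReal)

/-- `c''(ε)`, for finite `ε`. -/
def pconst'' (ε : ℝ) : ℝ := 2 / ε * Real.arcosh (2 * Real.cosh (ε / 2))

/-- `c'_2(ε)`. -/
def pconst2' (ε : ℝ≥0∞) : ℝ :=
  if ε = ⊤ then 5 / 2
  else max (pconst'' ε.toReal + 1)
    (max (2 * pconst1' ε / ε.toReal)
      (√(Real.cosh ε.toReal / (Real.cosh ε.toReal - 1)) *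
        (Real.sinh (pconst1' ε) / pconst1' ε)))

/-- `c'_3(ε)`. -/
def pconst3' (ε : ℝ≥0∞) : ℝ :=
  if ε = ⊤ then 5 / 2 else 3 + 2 * pconst1' ε / ε.toReal

/-- `h'(ε, η)`. -/
def hprime (ε : ℝ≥0∞) (η : ℝ) : ℝ :=
  if ε = ⊤ then 3 * η + pconst0 ε + pconst1' ε
  else max (2 * η + max 0 (-2 * Real.log (ε.toReal / 2))) (η + pconst1' ε + pconst0 ε)

open Classical in
/-- `c_1`, which is `c'_1(ε₀)` except if `ε₀ = ∞`, `δ₀ = 0` and `f₀` is the penetration height map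
of `C₀`. -/
def pconst1 {X : Type*} [MetricSpace X] {ξ : X ⊕ BoundaryAtInfinity X} (ε₀ : ℝ≥0∞) (δ₀ : ℝ)
    (C₀ : Set X) (f₀ : GeodesicsFrom ξ → ℝ≥0∞) : ℝ :=
  if ε₀ = ⊤ ∧ δ₀ = 0 ∧ IsPenetrationHeight C₀ f₀ then 1 / 19 else pconst1' ε₀

/-- `c_5(ε₀, δ₀)`, with `c₁` as a parameter. -/
def pconst5 (ε₀ : ℝ≥0∞) (δ₀ c₁ : ℝ) : ℝ :=
  2 * max (pconst2' ε₀) (pconst3' ε₀) * Real.sinh (c₁ + δ₀)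

/-- `h_0(ε₀, δ₀, κ₀)`, with `c₁` as a parameter. -/
def hconst0 (ε₀ : ℝ≥0∞) (δ₀ κ₀ c₁ : ℝ) : ℝ :=
  max (δ₀ + κ₀) (max (pconst0 ε₀ + κ₀) (hprime ε₀ (Real.sinh (δ₀ + c₁))))

/-- `h'_1(ε₀, δ₀, h'₀)`, with `c₁` as a parameter. -/
def hconst1' (ε₀ : ℝ≥0∞) (δ₀ h₀' c₁ : ℝ) : ℝ := h₀' + 2 * pconst5 ε₀ δ₀ c₁

/-! ### Assumptions on the family of subsets -/

section Family

variable {X : Type*} [MetricSpace X]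

/-- Almost disjointness: the diameter of `C_m ∩ C_n` is at most `δ₀` for `m ≠ n`. -/
def AlmostDisjoint (C : ℕ → Set X) (δ₀ : ℝ) : Prop :=
  ∀ m n, m ≠ n → Metric.ediam (C n ∩ C m) ≤ ENNReal.ofReal δ₀

/-- Local prescription: for every `n ≠ 0` with `ξ₀ ∉ C_n ∪ ∂_∞ C_n`, if there is a geodesic
starting from `ξ₀`, meeting first `C_0` and then `C_n`, with `f₀ = h` and `ℓ_{C_n} ≥ h'₀`, then
there is one with `f₀ = h` and `ℓ_{C_n} = h'₀`. -/
def LocalPrescription {ξ₀ : X ⊕ BoundaryAtInfinity X} (C : ℕ → Set X)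
    (f₀ : GeodesicsFrom ξ₀ → ℝ≥0∞) (h h₀' : ℝ) : Prop :=
  ∀ n, n ≠ 0 → ξ₀ ∉ withBoundary (C n) →
    (∃ α : GeodesicsFrom ξ₀, MeetsFirstThen α (C 0) (C n) ∧ f₀ α = ENNReal.ofReal h ∧
      ENNReal.ofReal h₀' ≤ penetrationLength (C n) α) →
    ∃ α' : GeodesicsFrom ξ₀, MeetsFirstThen α' (C 0) (C n) ∧ f₀ α' = ENNReal.ofReal h ∧
      penetrationLength (C n) α' = ENNReal.ofReal h₀'

end Family

end

/-! ### The analytic form of the `CAT(-1)` inequality -/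

/-! The geodesic is obtained as a limit of successive corrections. Start from a geodesic with `f₀ =
h`, which stays in `C 0` for a time at least `Λ`. As long as the current geodesic, after its
entrance time `t k` into the set treated last, penetrates some set for longer than `h₀'`, take the
first such set and let the local prescription replace the geodesic by one with the same value of
`f₀` whose penetration in this set is exactly `h₀'`.

Two geodesics from `ξ` that both spend a time `h₀'` in the same set are close near their entrance
times, and by negative curvature exponentially closer at earlier times: they are `CloseUpTo` a time
`T k`. Almost disjointness keeps long penetrations apart, so `T k` increases by at least a gap `g`
at each step. The successive errors are dominated by a geometric series, the corrections converge
(or stop), and `f₀ = h` survives by continuity.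

The upper bound for the limit is `PrescriptionSetup.sub_le_of_mem`. If the limit stayed in some `C
m` for longer than `h₀' + K`, so would the approximating geodesics, up to a small loss. Whenever `t
k` lies before the start of this stay, so does `t (k + 1)`, as otherwise `C m` should have been
corrected earlier. So the correction never passes `C m`, although its times tend to infinity: a
contradiction.

The geometry enters only through `IsPenetrationStable` (a geodesic close to one that stays in `C`
also stays in `C`, up to margins `a` and `b`) and `HasCloseEntries`. They are proved for
`IsThickConvex` sets, which cover both `ε`-neighbourhoods of convex sets and horoballs, and again
for horoballs with the sharper margins that the constant `c₁ = 1/19` requires. The curvature is used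
through the Stewart inequality `IsCATNegOne.stewart`; applied three times, it gives the exponential
divergence `IsCATNegOne.fan_of_close`, and in the limit at infinity the convexity of horofunctions.
-/

theorem cosh_triangle_gram {x y z : ℝ} (hx : 0 ≤ x) (hy : 0 ≤ y) (hz : 0 ≤ z)
    (h1 : z ≤ x + y) (h2 : x ≤ y + z) (h3 : y ≤ x + z) :
    Real.cosh x ^ 2 + Real.cosh y ^ 2 + Real.cosh z ^ 2 ≤
      1 + 2 * Real.cosh x * Real.cosh y * Real.cosh z := by
  have e1 : Real.cosh z ≤ Real.cosh (x + y) :=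
    Real.cosh_le_cosh.2 (by rw [abs_of_nonneg hz, abs_of_nonneg (by linarith)]; exact h1)
  have e2 : Real.cosh (x - y) ≤ Real.cosh z :=
    Real.cosh_le_cosh.2 (by rw [abs_of_nonneg hz, abs_le]; constructor <;> linarith)
  rw [Real.cosh_add] at e1
  rw [Real.cosh_sub] at e2
  have a1 := Real.cosh_sq x
  have a2 := Real.cosh_sq y
  -- This product expands to the Gram determinant `1 + 2abc - a² - b² - c²` of three points of the
  -- hyperboloid, with `a`, `b`, `c` the three hyperbolic cosines.
  have := mul_nonneg (sub_nonneg.2 e1) (sub_nonneg.2 e2)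
  nlinarith [this]

/-- A point of the hyperbolic plane on the imaginary axis. -/
noncomputable def imAxis (t : ℝ) : ℍ := ⟨⟨0, Real.exp t⟩, Real.exp_pos t⟩

theorem dist_imAxis (s t : ℝ) : dist (imAxis s) (imAxis t) = |s - t| := by
  rw [UpperHalfPlane.dist_of_re_eq (by rfl)]
  have : ∀ t, (imAxis t).im = Real.exp t := fun _ => rfl
  rw [this, this, Real.log_exp, Real.log_exp, Real.dist_eq]

/-- For a point `u + iv`, the hyperbolic cosine of the distance to `i e^t` is `P e^{-t} + Q e^t`
with `Q = 1/(2v)` and `P = (u² + v²)/(2v)`. The values at `t = 0` and `t = L` determine `P` and `Q`;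
solving for `u` and `v` needs `Q > 0` and `4PQ ≥ 1`, and the latter is `cosh_triangle_gram`. -/
theorem exists_comparison_point {L d₁ d₂ : ℝ} (hL : 0 < L) (h1 : 0 ≤ d₁) (h2 : 0 ≤ d₂)
    (hab : L ≤ d₁ + d₂) (ha : d₁ ≤ d₂ + L) (hb : d₂ ≤ d₁ + L) :
    ∃ r : ℍ, ∀ t, Real.sinh L * Real.cosh (dist (imAxis t) r) =
      Real.sinh (L - t) * Real.cosh d₁ + Real.sinh t * Real.cosh d₂ := by
  have hs : 0 < Real.sinh L := Real.sinh_pos_iff.2 hL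
  set c₁ := Real.cosh d₁ with hc₁
  set c₂ := Real.cosh d₂ with hc₂
  set P := (Real.exp L * c₁ - c₂) / (2 * Real.sinh L) with hP
  set Q := (c₂ - Real.exp (-L) * c₁) / (2 * Real.sinh L) with hQ
  have hQpos : 0 < Q := by
    apply div_pos _ (by positivity)
    have e1 : c₁ ≤ Real.cosh (d₂ + L) :=
      Real.cosh_le_cosh.2 (by rw [abs_of_nonneg h1, abs_of_nonneg (by linarith)]; exact ha)
    have e2 : Real.exp (-L) * Real.cosh (d₂ + L) < c₂ := by
      rw [hc₂, Real.cosh_eq, Real.cosh_eq]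
      have : Real.exp (-L) * ((Real.exp (d₂ + L) + Real.exp (-(d₂ + L))) / 2)
          = (Real.exp d₂ + Real.exp (-d₂ - 2 * L)) / 2 := by
        rw [mul_div_assoc', mul_add, ← Real.exp_add, ← Real.exp_add]; ring_nf
      rw [this]
      have : Real.exp (-d₂ - 2 * L) < Real.exp (-d₂) := Real.exp_lt_exp.2 (by linarith)
      linarith
    have := mul_le_mul_of_nonneg_left e1 (Real.exp_pos (-L)).le
    linarith
  have hee : Real.exp L * Real.exp (-L) = 1 := by rw [← Real.exp_add]; simp
  have hPQ : 1 ≤ 4 * (P * Q) := by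
    have g := cosh_triangle_gram h1 h2 hL.le hab (by linarith) (by linarith)
    have hsq := Real.cosh_sq L
    have hC : Real.cosh L = (Real.exp L + Real.exp (-L)) / 2 := Real.cosh_eq L
    have : 4 * (P * Q) = (Real.exp L * c₁ - c₂) * (c₂ - Real.exp (-L) * c₁) / Real.sinh L ^ 2 := by
      rw [hP, hQ]; field_simp; ring
    rw [this, le_div_iff₀ (by positivity)]
    have : (Real.exp L * c₁ - c₂) * (c₂ - Real.exp (-L) * c₁)
        = 2 * c₁ * c₂ * Real.cosh L - c₂ ^ 2 - c₁ ^ 2 * (Real.exp L * Real.exp (-L)) := by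
      rw [hC]; ring
    rw [this, hee]
    linarith
  have hv : (0:ℝ) < 1 / (2 * Q) := by positivity
  refine ⟨⟨⟨√((4 * (P * Q) - 1) / (4 * Q ^ 2)), 1 / (2 * Q)⟩, hv⟩, fun t => ?_⟩
  rw [UpperHalfPlane.cosh_dist']
  have r1 : (imAxis t).re = 0 := rfl
  have r2 : (imAxis t).im = Real.exp t := rfl
  rw [r1, r2]
  change Real.sinh L * (((0 - √((4 * (P * Q) - 1) / (4 * Q ^ 2))) ^ 2 + Real.exp t ^ 2
    + (1 / (2 * Q)) ^ 2) / (2 * Real.exp t * (1 / (2 * Q)))) = _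
  have hsq : (0 - √((4 * (P * Q) - 1) / (4 * Q ^ 2))) ^ 2 = (4 * (P * Q) - 1) / (4 * Q ^ 2) := by
    rw [zero_sub, neg_sq, Real.sq_sqrt]
    apply div_nonneg (by linarith) (by positivity)
  rw [hsq]
  have het : Real.exp t * Real.exp (-t) = 1 := by rw [← Real.exp_add]; simp
  have hkey : ((4 * (P * Q) - 1) / (4 * Q ^ 2) + Real.exp t ^ 2 + (1 / (2 * Q)) ^ 2)
      / (2 * Real.exp t * (1 / (2 * Q))) = P * Real.exp (-t) + Q * Real.exp t := by
    rw [Real.exp_neg]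
    field_simp
    ring
  rw [hkey, hP, hQ]
  have : Real.sinh L * ((Real.exp L * c₁ - c₂) / (2 * Real.sinh L) * Real.exp (-t) +
      (c₂ - Real.exp (-L) * c₁) / (2 * Real.sinh L) * Real.exp t) =
      ((Real.exp L * c₁ - c₂) * Real.exp (-t) + (c₂ - Real.exp (-L) * c₁) * Real.exp t) / 2 := by
    field_simp
  rw [this, Real.sinh_eq, Real.sinh_eq, neg_sub, Real.exp_sub, Real.exp_sub, Real.exp_neg,
    Real.exp_neg]
  field_simp
  ring

section
variable {X : Type*} [MetricSpace X]

/-- The Stewart-type form of the `CAT(-1)` inequality. -/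
theorem IsCATNegOne.stewart (hcat : IsCATNegOne X) (p x y z : X) (hz : OnSegment x y z) :
    Real.sinh (dist x y) * Real.cosh (dist p z) ≤
      Real.sinh (dist z y) * Real.cosh (dist p x) + Real.sinh (dist x z) * Real.cosh (dist p y) := by
  unfold OnSegment at hz
  rcases eq_or_lt_of_le (dist_nonneg (x := x) (y := y)) with h0 | hL
  · have h1 := dist_nonneg (x := x) (y := z)
    have h2 := dist_nonneg (x := z) (y := y)
    have e1 : dist x z = 0 := by linarith
    have e2 : dist z y = 0 := by linarith
    rw [← h0, e1, e2]; simp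
  · obtain ⟨r, hr⟩ := exists_comparison_point hL (dist_nonneg (x := p) (y := x))
      (dist_nonneg (x := p) (y := y))
      (by rw [dist_comm p x]; exact dist_triangle x p y) (by
        rw [dist_comm x y]; exact dist_triangle p y x) (dist_triangle p x y)
    have hs : 0 < Real.sinh (dist x y) := Real.sinh_pos_iff.2 hL
    have inj : ∀ {u v : ℝ}, 0 ≤ u → 0 ≤ v → Real.cosh u = Real.cosh v → u = v :=
      fun hu hv h => Real.cosh_strictMonoOn.injOn hu hv h
    have d1 : dist (imAxis 0) r = dist x p := by
      rw [dist_comm x p]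
      refine inj dist_nonneg dist_nonneg ?_
      have := hr 0
      simp only [sub_zero, Real.sinh_zero, zero_mul, add_zero] at this
      exact mul_left_cancel₀ hs.ne' this
    have d2 : dist (imAxis (dist x y)) r = dist y p := by
      rw [dist_comm y p]
      refine inj dist_nonneg dist_nonneg ?_
      have := hr (dist x y)
      simp only [sub_self, Real.sinh_zero, zero_mul, zero_add] at this
      exact mul_left_cancel₀ hs.ne' this
    -- The second point of the comparison is the vertex `p` itself, so the inequality compares the
    -- distance from `p` to a point of the opposite side.
    have key := hcat x y p z p (imAxis 0) (imAxis (dist x y)) r (imAxis (dist x z)) r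
      (by rw [dist_imAxis, zero_sub, abs_neg, abs_of_nonneg dist_nonneg]) d2 d1 hz
      (by rw [dist_imAxis, zero_sub, abs_neg, abs_of_nonneg dist_nonneg])
      (by rw [dist_imAxis, ← hz, abs_sub_comm, abs_of_nonneg (by linarith [dist_nonneg (x := z) (y := y)])]; ring)
      (by simp [OnSegment]) d1 (by simp)
    have := hr (dist x z)
    have e : dist x y - dist x z = dist z y := by linarith
    rw [e] at this
    rw [← this]
    refine mul_le_mul_of_nonneg_left (Real.cosh_le_cosh.2 ?_) hs.le
    rw [abs_of_nonneg dist_nonneg, abs_of_nonneg dist_nonneg, dist_comm p z]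
    exact key
end

section
variable {X : Type*} [MetricSpace X]

/-! ### Elementary estimates on hyperbolic functions -/

theorem Real.cosh_sub_one (x : ℝ) : Real.cosh x - 1 = 2 * Real.sinh (x / 2) ^ 2 := by
  have h := Real.cosh_two_mul (x / 2)
  have h2 := Real.cosh_sq (x / 2)
  rw [mul_div_cancel₀ x two_ne_zero] at h
  linarith

theorem Real.sq_le_two_mul_cosh_sub_one (x : ℝ) : x ^ 2 ≤ 2 * (Real.cosh x - 1) := by
  wlog hx : 0 ≤ x generalizing x
  · have := this (-x) (by linarith)
    rwa [Real.cosh_neg, neg_sq] at this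
  rw [Real.cosh_sub_one]
  have : x / 2 ≤ Real.sinh (x / 2) := Real.self_le_sinh_iff.2 (by linarith)
  nlinarith [mul_self_le_mul_self (by linarith : 0 ≤ x / 2) this]

theorem Real.cosh_add_le_exp_mul {x δ : ℝ} (hδ : 0 ≤ δ) :
    Real.cosh (x + δ) ≤ Real.exp δ * Real.cosh x := by
  have e : Real.exp (-(x + δ)) ≤ Real.exp δ * Real.exp (-x) := by
    rw [← Real.exp_add]; exact Real.exp_le_exp.2 (by linarith)
  rw [Real.cosh_eq, Real.cosh_eq, Real.exp_add]
  nlinarith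

theorem Real.sinh_le_exp_mul_sinh {w x : ℝ} (hwx : w ≤ x) :
    Real.sinh w ≤ Real.exp (w - x) * Real.sinh x := by
  have e1 : Real.exp (w - x) * Real.exp x = Real.exp w := by rw [← Real.exp_add]; ring_nf
  have e2 : Real.exp (w - x) * Real.exp (-x) ≤ Real.exp (-w) := by
    rw [← Real.exp_add]; exact Real.exp_le_exp.2 (by linarith)
  rw [Real.sinh_eq, Real.sinh_eq]
  nlinarith

theorem Real.cosh_le_cosh_of_le {x y : ℝ} (hx : 0 ≤ x) (h : x ≤ y) :
    Real.cosh x ≤ Real.cosh y :=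
  Real.cosh_le_cosh.2 (by rwa [abs_of_nonneg hx, abs_of_nonneg (hx.trans h)])

theorem le_of_cosh_le_cosh {x y : ℝ} (hy : 0 ≤ y) (h : Real.cosh x ≤ Real.cosh y) :
    x ≤ y := by
  have := Real.cosh_le_cosh.1 h
  rw [abs_of_nonneg hy] at this
  exact (le_abs_self x).trans this

/-! ### Geodesic segments -/

/-- The restriction of `f` to `[s, t]` is a geodesic segment. -/
def GeodOn (f : ℝ → X) (s t : ℝ) : Prop :=
  ∀ u ∈ Icc s t, ∀ v ∈ Icc s t, dist (f u) (f v) = |u - v|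

theorem GeodOn.mono {f : ℝ → X} {s t s' t' : ℝ} (hf : GeodOn f s t) (hs : s ≤ s') (ht : t' ≤ t) :
    GeodOn f s' t' := fun u hu v hv =>
  hf u ⟨hs.trans hu.1, hu.2.trans ht⟩ v ⟨hs.trans hv.1, hv.2.trans ht⟩

theorem GeodOn.dist_eq {f : ℝ → X} {s t u v : ℝ} (hf : GeodOn f s t) (hs : s ≤ u) (huv : u ≤ v)
    (hv : v ≤ t) : dist (f u) (f v) = v - u := by
  rw [hf u ⟨hs, huv.trans hv⟩ v ⟨hs.trans huv, hv⟩, abs_sub_comm, abs_of_nonneg (by linarith)]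

theorem GeodOn.onSegment {f : ℝ → X} {s t u : ℝ} (hf : GeodOn f s t) (hu : u ∈ Icc s t) :
    OnSegment (f s) (f t) (f u) := by
  unfold OnSegment
  rw [hf.dist_eq le_rfl hu.1 hu.2, hf.dist_eq hu.1 hu.2 le_rfl,
    hf.dist_eq le_rfl (hu.1.trans hu.2) le_rfl]
  ring

theorem GeodOn.reverse {f : ℝ → X} {s t : ℝ} (hf : GeodOn f s t) (c : ℝ) :
    GeodOn (fun u => f (c - u)) (c - t) (c - s) := fun u hu v hv => by
  rw [hf (c - u) ⟨by linarith [hu.2], by linarith [hu.1]⟩ (c - v)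
    ⟨by linarith [hv.2], by linarith [hv.1]⟩, abs_sub_comm]
  ring_nf

theorem GeodOn.continuousOn {f : ℝ → X} {s t : ℝ} (hf : GeodOn f s t) :
    ContinuousOn f (Icc s t) := by
  rw [Metric.continuousOn_iff]
  intro b hb ε hε
  refine ⟨ε, hε, fun a ha hab => ?_⟩
  rw [hf a ha b hb]
  rwa [Real.dist_eq] at hab

theorem IsGeodesicSpace.exists_segment (hgeod : IsGeodesicSpace X) (x y : X) :
    ∃ f : ℝ → X, f 0 = x ∧ f (dist x y) = y ∧ GeodOn f 0 (dist x y) := hgeod x y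

theorem OnSegment.symm {x y z : X} (h : OnSegment x y z) : OnSegment y x z := by
  unfold OnSegment at *
  rw [dist_comm y z, dist_comm z x, dist_comm y x]; linarith

/-- A point of a geodesic segment is determined by its distance to an endpoint. -/
theorem IsCATNegOne.eq_of_onSegment (hcat : IsCATNegOne X) {f : ℝ → X} {N : ℝ}
    (hN : 0 ≤ N) (hf : GeodOn f 0 N) {z : X} (hz : OnSegment (f 0) (f N) z) :
    f (dist (f 0) z) = z := by
  have hd : dist (f 0) (f N) = N := by rw [hf.dist_eq le_rfl hN le_rfl]; ring
  have hz' := hz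
  unfold OnSegment at hz
  rw [hd] at hz
  have ha := dist_nonneg (x := f 0) (y := z)
  have hb := dist_nonneg (x := z) (y := f N)
  set a := dist (f 0) z with hadef
  have hw := hf.onSegment (u := a) ⟨ha, by linarith⟩
  -- With `z` itself as apex, the right-hand side collapses to `sinh N` by the addition formula,
  -- whence `cosh d(z, f a) ≤ 1`.
  have h := hcat.stewart z _ _ _ hw
  rw [hd, hf.dist_eq ha (by linarith : a ≤ N) le_rfl, hf.dist_eq le_rfl ha (by linarith : a ≤ N),
    dist_comm z (f 0), ← hadef, sub_zero] at h
  have e : dist z (f N) = N - a := by linarith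
  have es : Real.sinh (N - a) * Real.cosh a + Real.sinh a * Real.cosh (N - a) = Real.sinh N := by
    have := Real.sinh_add (N - a) a
    rw [sub_add_cancel] at this
    linarith
  rw [e, es] at h
  rcases eq_or_lt_of_le hN with h0 | hpos
  · have : a = 0 := by linarith
    rw [this]
    exact dist_eq_zero.1 (hadef ▸ this)
  · have hs : 0 < Real.sinh N := Real.sinh_pos_iff.2 hpos
    have h1 : Real.cosh (dist z (f a)) ≤ Real.cosh 0 := by
      rw [Real.cosh_zero]
      by_contra hc
      push Not at hc
      nlinarith
    have := le_of_cosh_le_cosh le_rfl h1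
    exact (dist_le_zero.1 this).symm

theorem exists_geodOn_through (hgeod : IsGeodesicSpace X) (hcat : IsCATNegOne X) {x y z : X}
    (hz : OnSegment x y z) : ∃ f : ℝ → X, f 0 = x ∧ f (dist x y) = y ∧ f (dist x z) = z ∧
      GeodOn f 0 (dist x y) := by
  obtain ⟨f, h0, h1, hf⟩ := hgeod.exists_segment x y
  refine ⟨f, h0, h1, ?_, hf⟩
  have := hcat.eq_of_onSegment dist_nonneg hf (z := z) (by rwa [h0, h1])
  rwa [h0] at this

/-! ### Divergence of geodesics -/

/-- Two geodesic segments starting at distance at most `δ` from each other diverge exponentially. -/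
theorem IsCATNegOne.fan_of_close (hcat : IsCATNegOne X) {f g : ℝ → X} {t₀ S T t δ : ℝ}
    (hf : GeodOn f t₀ S) (hg : GeodOn g t₀ T) (h0 : dist (f t₀) (g t₀) ≤ δ)
    (hST : |S - T| ≤ dist (f S) (g T)) (ht₀ : t₀ ≤ t) (htS : t ≤ S) (htT : t ≤ T) :
    Real.cosh (dist (f t) (g t)) ≤ Real.exp δ *
      (1 + Real.exp (2 * t - S - T) * (Real.cosh (dist (f S) (g T)) - Real.cosh (S - T))) := by
  have hδ : 0 ≤ δ := dist_nonneg.trans h0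
  have hD : 0 ≤ Real.cosh (dist (f S) (g T)) - Real.cosh (S - T) := by
    rw [← Real.cosh_abs (S - T)]
    exact sub_nonneg.2 (Real.cosh_le_cosh_of_le (abs_nonneg _) hST)
  have hc0 : Real.cosh (dist (f t₀) (g t₀)) ≤ Real.exp δ := by
    have h1 := Real.cosh_le_cosh_of_le dist_nonneg h0
    have h2 := Real.cosh_add_le_exp_mul (x := 0) hδ
    rw [zero_add, Real.cosh_zero, mul_one] at h2
    exact h1.trans h2
  have hE : 0 < Real.exp δ := Real.exp_pos δ
  rcases eq_or_lt_of_le ht₀ with rfl | hlt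
  · refine hc0.trans ?_
    have : 0 ≤ Real.exp (2 * t₀ - S - T) * (Real.cosh (dist (f S) (g T)) - Real.cosh (S - T)) :=
      by positivity
    nlinarith
  have hx : t₀ < S := hlt.trans_le htS
  have hy : t₀ < T := hlt.trans_le htT
  -- These three inequalities bound `cosh d(f t, g t)` by a combination of the four hyperbolic
  -- cosines of the distances between the endpoints of the two segments.
  have k1 := hcat.stewart (g t) _ _ _ (hf.onSegment ⟨ht₀, htS⟩)
  have k2 := hcat.stewart (f t₀) _ _ _ (hg.onSegment ⟨ht₀, htT⟩)
  have k3 := hcat.stewart (f S) _ _ _ (hg.onSegment ⟨ht₀, htT⟩)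
  rw [hf.dist_eq le_rfl hx.le le_rfl, hf.dist_eq ht₀ htS le_rfl, hf.dist_eq le_rfl ht₀ htS,
    dist_comm (g t), dist_comm (g t), dist_comm (g t)] at k1
  rw [hg.dist_eq le_rfl hy.le le_rfl, hg.dist_eq ht₀ htT le_rfl, hg.dist_eq le_rfl ht₀ htT] at k2 k3
  have b1 : Real.cosh (dist (f t₀) (g T)) ≤ Real.exp δ * Real.cosh (T - t₀) := by
    refine (Real.cosh_le_cosh_of_le dist_nonneg ?_).trans (Real.cosh_add_le_exp_mul hδ)
    have := dist_triangle (f t₀) (g t₀) (g T)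
    rw [hg.dist_eq le_rfl hy.le le_rfl] at this
    linarith
  have b2 : Real.cosh (dist (f S) (g t₀)) ≤ Real.exp δ * Real.cosh (S - t₀) := by
    refine (Real.cosh_le_cosh_of_le dist_nonneg ?_).trans (Real.cosh_add_le_exp_mul hδ)
    have := dist_triangle (f S) (f t₀) (g t₀)
    rw [dist_comm (f S) (f t₀), hf.dist_eq le_rfl hx.le le_rfl] at this
    linarith
  have sx : 0 < Real.sinh (S - t₀) := Real.sinh_pos_iff.2 (by linarith)
  have sy : 0 < Real.sinh (T - t₀) := Real.sinh_pos_iff.2 (by linarith)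
  have sw : 0 < Real.sinh (t - t₀) := Real.sinh_pos_iff.2 (by linarith)
  have sxw : 0 ≤ Real.sinh (S - t) := Real.sinh_nonneg_iff.2 (by linarith)
  have syw : 0 ≤ Real.sinh (T - t) := Real.sinh_nonneg_iff.2 (by linarith)
  set F := Real.cosh (dist (f t) (g t))
  set D := Real.cosh (dist (f S) (g T))
  set E := Real.exp δ
  set sX := Real.sinh (S - t₀)
  set sY := Real.sinh (T - t₀)
  set sW := Real.sinh (t - t₀)
  -- The same combination in the degenerate model, where both segments run along one geodesic from a
  -- common origin. Subtracting it leaves only the excess `cosh d(f S, g T) - cosh (S - T)`, with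
  -- coefficient `sW²`.
  have ident : Real.sinh (S - t) * Real.sinh (T - t) + Real.sinh (S - t) * sW * Real.cosh (T - t₀)
      + sW * Real.sinh (T - t) * Real.cosh (S - t₀) + sW ^ 2 * Real.cosh (S - T) = sX * sY := by
    have e1 : S - t = (S - t₀) - (t - t₀) := by ring
    have e2 : T - t = (T - t₀) - (t - t₀) := by ring
    have e3 : S - T = (S - t₀) - (T - t₀) := by ring
    rw [e1, e2, e3, Real.sinh_sub (S - t₀), Real.sinh_sub (T - t₀), Real.cosh_sub (S - t₀)]
    have := Real.cosh_sq (t - t₀)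
    have h2 := Real.cosh_sq (S - t₀)
    have h3 := Real.cosh_sq (T - t₀)
    linear_combination (sX * sY) * this
  have m1 : sX * sY * F ≤ E * (sX * sY - sW ^ 2 * Real.cosh (S - T)) + sW ^ 2 * D := by
    have j1 := mul_le_mul_of_nonneg_left k1 sy.le
    have j2 := mul_le_mul_of_nonneg_left (k2.trans (add_le_add
      (mul_le_mul_of_nonneg_left hc0 syw) (mul_le_mul_of_nonneg_left b1 sw.le))) sxw
    have j3 := mul_le_mul_of_nonneg_left (k3.trans (add_le_add_left
      (mul_le_mul_of_nonneg_left b2 syw) _)) sw.le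
    have hb : sX * sY - sW ^ 2 * Real.cosh (S - T) = Real.sinh (S - t) * Real.sinh (T - t) +
        Real.sinh (S - t) * sW * Real.cosh (T - t₀) +
        sW * Real.sinh (T - t) * Real.cosh (S - t₀) := by linarith
    rw [hb]
    linarith
  have m2 : sW ^ 2 ≤ Real.exp (2 * t - S - T) * (sX * sY) := by
    have i1 : sW ≤ Real.exp ((t - t₀) - (S - t₀)) * sX := Real.sinh_le_exp_mul_sinh (by linarith)
    have i2 : sW ≤ Real.exp ((t - t₀) - (T - t₀)) * sY := Real.sinh_le_exp_mul_sinh (by linarith)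
    have := mul_le_mul i1 i2 sw.le (by positivity)
    have e : Real.exp (2 * t - S - T) = Real.exp ((t - t₀) - (S - t₀)) *
      Real.exp ((t - t₀) - (T - t₀)) := by rw [← Real.exp_add]; ring_nf
    rw [e]; linarith
  have m3 : sW ^ 2 * D ≤ E * (sW ^ 2 * D) := by
    have : 1 ≤ E := Real.one_le_exp hδ
    have hDpos : 0 ≤ D := (Real.cosh_pos _).le
    nlinarith [mul_nonneg (sq_nonneg sW) hDpos]
  have m4 := mul_le_mul_of_nonneg_right m2 hD
  have m5 : sX * sY * F ≤ sX * sY * (E * (1 + Real.exp (2 * t - S - T) *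
      (D - Real.cosh (S - T)))) := by
    have := mul_le_mul_of_nonneg_left m4 hE.le
    nlinarith
  exact le_of_mul_le_mul_left m5 (by positivity)

/-- Geodesic segments with the same origin diverge exponentially. -/
theorem IsCATNegOne.fan (hcat : IsCATNegOne X) {f g : ℝ → X} {S T t : ℝ}
    (hf : GeodOn f 0 S) (hg : GeodOn g 0 T) (h0 : f 0 = g 0) (ht₀ : 0 ≤ t) (htS : t ≤ S)
    (htT : t ≤ T) :
    Real.cosh (dist (f t) (g t)) - 1 ≤
      Real.exp (2 * t - S - T) * (Real.cosh (dist (f S) (g T)) - 1) := by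
  have hST : |S - T| ≤ dist (f S) (g T) := by
    have e1 := hf.dist_eq le_rfl (ht₀.trans htS) le_rfl
    have e2 := hg.dist_eq le_rfl (ht₀.trans htT) le_rfl
    have := abs_dist_sub_le (f S) (g T) (f 0)
    rw [dist_comm (f S), dist_comm (g T), e1] at this
    rw [h0, e2] at this
    simpa using this
  have h := hcat.fan_of_close hf hg (le_of_eq (by rw [h0, dist_self])) hST ht₀ htS htT
  rw [Real.exp_zero, one_mul] at h
  have := Real.one_le_cosh (S - T)
  have h2 := (Real.exp_pos (2 * t - S - T)).le
  nlinarith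

theorem IsCATNegOne.fan_dist_le (hcat : IsCATNegOne X) {f g : ℝ → X} {S T t : ℝ}
    (hf : GeodOn f 0 S) (hg : GeodOn g 0 T) (h0 : f 0 = g 0) (ht₀ : 0 ≤ t) (htS : t ≤ S)
    (htT : t ≤ T) :
    dist (f t) (g t) ≤ 2 * Real.exp (t - (S + T) / 2) * Real.sinh (dist (f S) (g T) / 2) := by
  have h := hcat.fan hf hg h0 ht₀ htS htT
  have h1 := Real.sq_le_two_mul_cosh_sub_one (dist (f t) (g t))
  rw [Real.cosh_sub_one (dist (f S) (g T))] at h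
  have hs : 0 ≤ Real.sinh (dist (f S) (g T) / 2) :=
    Real.sinh_nonneg_iff.2 (by positivity)
  refine le_of_sq_le_sq ?_ (by positivity)
  have e : Real.exp (2 * t - S - T) = Real.exp (t - (S + T) / 2) ^ 2 := by
    rw [← Real.exp_nat_mul]; congr 1; push_cast; ring
  rw [e] at h
  nlinarith

/-! ### Midpoints -/

theorem IsCATNegOne.stewart_midpoint (hcat : IsCATNegOne X) (p : X) {x y m : X}
    (hm : OnSegment x y m) (he : dist x m = dist m y) :
    2 * Real.cosh (dist x m) * Real.cosh (dist p m) ≤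
      Real.cosh (dist p x) + Real.cosh (dist p y) := by
  have h := hcat.stewart p x y m hm
  unfold OnSegment at hm
  rw [← hm, ← he, ← two_mul, Real.sinh_two_mul] at h
  rcases eq_or_lt_of_le (dist_nonneg (x := x) (y := m)) with h0 | hpos
  · have e1 : x = m := dist_eq_zero.1 h0.symm
    have e2 : m = y := dist_eq_zero.1 (by rw [← he, ← h0])
    subst e1; subst e2
    simp; linarith
  · have hs : 0 < Real.sinh (dist x m) := Real.sinh_pos_iff.2 hpos
    refine le_of_mul_le_mul_left ?_ hs
    linarith

/-- With `A`, `B`, `G` the hyperbolic cosines of the half-sides, two uses of the midpoint inequality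
give `4AB cosh d(m, m') ≤ 2(A² + B² + G² - 1)`, and the Gram inequality for the three half-sides
bounds this by `4ABG`. -/
theorem IsCATNegOne.dist_midpoint_le (hcat : IsCATNegOne X) {o p q m m' : X}
    (hm : OnSegment o p m) (he : dist o m = dist m p) (hm' : OnSegment o q m')
    (he' : dist o m' = dist m' q) : dist m m' ≤ dist p q / 2 := by
  have k1 := hcat.stewart_midpoint m' hm he
  have k2 := hcat.stewart_midpoint p hm' he'
  have hop : dist o p = 2 * dist o m := by unfold OnSegment at hm; linarith
  have hoq : dist o q = 2 * dist o m' := by unfold OnSegment at hm'; linarith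
  set A := Real.cosh (dist o m) with hA
  set B := Real.cosh (dist o m') with hB
  set G := Real.cosh (dist p q / 2) with hG
  have c1 : Real.cosh (dist p o) = 2 * A ^ 2 - 1 := by
    rw [dist_comm, hop, Real.cosh_two_mul]; have := Real.cosh_sq (dist o m); linarith
  have c2 : Real.cosh (dist p q) = 2 * G ^ 2 - 1 := by
    have : dist p q = 2 * (dist p q / 2) := by ring
    rw [this, Real.cosh_two_mul]; have := Real.cosh_sq (dist p q / 2); linarith
  have g := cosh_triangle_gram (x := dist o m) (y := dist o m') (z := dist p q / 2) dist_nonneg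
    dist_nonneg (by positivity)
    (by have := dist_triangle p o q; rw [dist_comm p o] at this; linarith)
    (by have := dist_triangle o q p; rw [dist_comm q p] at this; linarith)
    (by have := dist_triangle o p q; linarith)
  have hA0 : 0 < A := Real.cosh_pos _
  have hB0 : 0 < B := Real.cosh_pos _
  rw [dist_comm m' o, dist_comm m' m, dist_comm m' p] at k1
  rw [c1, c2] at k2
  refine le_of_cosh_le_cosh (by positivity) ?_
  refine le_of_mul_le_mul_left ?_ (by positivity : 0 < 4 * (A * B))
  have := mul_le_mul_of_nonneg_left k1 (by positivity : 0 ≤ 2 * B)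
  nlinarith

theorem exists_midpoint_onSegment (hgeod : IsGeodesicSpace X) (x y : X) :
    ∃ m, OnSegment x y m ∧ dist x m = dist m y := by
  obtain ⟨f, h0, h1, hf⟩ := hgeod.exists_segment x y
  have hN := dist_nonneg (x := x) (y := y)
  refine ⟨f (dist x y / 2), ?_, ?_⟩
  · have := hf.onSegment (u := dist x y / 2) ⟨by linarith, by linarith⟩
    rwa [h0, h1] at this
  · have e1 := hf.dist_eq (u := 0) (v := dist x y / 2) le_rfl (by linarith) (by linarith)
    have e2 := hf.dist_eq (u := dist x y / 2) (v := dist x y) (by linarith) (by linarith) le_rfl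
    rw [h0] at e1; rw [h1] at e2
    linarith

/-- The midpoint of the diagonal from `x` to `y'` reduces the quadrilateral to two triangles. -/
theorem dist_midpoints_le (hgeod : IsGeodesicSpace X) (hcat : IsCATNegOne X) {x y x' y' m m' : X}
    (hm : OnSegment x y m) (he : dist x m = dist m y) (hm' : OnSegment x' y' m')
    (he' : dist x' m' = dist m' y') : dist m m' ≤ (dist x x' + dist y y') / 2 := by
  obtain ⟨w, hw, hew⟩ := exists_midpoint_onSegment hgeod x y'
  have h1 := hcat.dist_midpoint_le hm he hw hew
  have h2 := hcat.dist_midpoint_le (o := y') (p := x) (q := x') (m := w) (m' := m') hw.symm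
    (by rw [dist_comm y' w, dist_comm w x, hew]) hm'.symm
    (by rw [dist_comm y' m', dist_comm m' x', he'])
  have := dist_triangle m w m'
  linarith

/-! ### Convexity of the distance to a convex subset -/

/-- Were the maximum larger than both end values, the least maximizer would be interior, and
midpoint convexity at two points symmetric about it would produce a smaller maximizer. -/
theorem le_max_of_midpoint_convexOn {g : ℝ → ℝ} {N : ℝ} (hg : ContinuousOn g (Icc 0 N))
    (hmid : ∀ u ∈ Icc 0 N, ∀ v ∈ Icc 0 N, g ((u + v) / 2) ≤ (g u + g v) / 2) {t : ℝ}
    (ht : t ∈ Icc 0 N) : g t ≤ max (g 0) (g N) := by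
  by_contra hc
  push Not at hc
  obtain ⟨c, hcI, hcmax⟩ := isCompact_Icc.exists_isMaxOn ⟨t, ht⟩ hg
  have hcmax' : ∀ u ∈ Icc 0 N, g u ≤ g c := fun u hu => hcmax hu
  have hS : IsCompact (Icc 0 N ∩ g ⁻¹' {g c}) :=
    isCompact_Icc.of_isClosed_subset (hg.preimage_isClosed_of_isClosed isClosed_Icc
      isClosed_singleton) inter_subset_left
  obtain ⟨d, ⟨hdI, hd⟩, hdmin⟩ := hS.exists_isLeast ⟨c, hcI, rfl⟩
  have hd' : g d = g c := hd
  have hgt : max (g 0) (g N) < g c := hc.trans_le (hcmax' t ht)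
  have hd0 : 0 < d := by
    rcases eq_or_lt_of_le hdI.1 with h | h
    · rw [← h] at hd'; linarith [le_max_left (g 0) (g N)]
    · exact h
  have hdN : d < N := by
    rcases eq_or_lt_of_le hdI.2 with h | h
    · rw [h] at hd'; linarith [le_max_right (g 0) (g N)]
    · exact h
  set r := min d (N - d) with hr
  have hrpos : 0 < r := lt_min hd0 (by linarith)
  have r1 : r ≤ d := min_le_left _ _
  have r2 : r ≤ N - d := min_le_right _ _
  have i1 : d - r ∈ Icc 0 N := ⟨by linarith, by linarith⟩
  have i2 : d + r ∈ Icc 0 N := ⟨by linarith, by linarith⟩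
  have hm := hmid _ i1 _ i2
  have e : (d - r + (d + r)) / 2 = d := by ring
  rw [e, hd'] at hm
  have h2 := hcmax' _ i2
  have h1 : g (d - r) ≠ g c := fun h => by
    have := hdmin ⟨i1, h⟩
    linarith
  have h1' := lt_of_le_of_ne (hcmax' _ i1) h1
  linarith

theorem infDist_midpoint_le (hgeod : IsGeodesicSpace X) (hcat : IsCATNegOne X) {K : Set X}
    (hK : IsGeodConvex K) (hne : K.Nonempty) {x y m : X} (hm : OnSegment x y m)
    (he : dist x m = dist m y) :
    Metric.infDist m K ≤ (Metric.infDist x K + Metric.infDist y K) / 2 := by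
  refine le_of_forall_pos_le_add fun ε hε => ?_
  obtain ⟨x', hx', hxx⟩ := (Metric.infDist_lt_iff hne (r := Metric.infDist x K + ε)
    (x := x)).1 (by linarith)
  obtain ⟨y', hy', hyy⟩ := (Metric.infDist_lt_iff hne (r := Metric.infDist y K + ε)
    (x := y)).1 (by linarith)
  obtain ⟨m', hm', he'⟩ := exists_midpoint_onSegment hgeod x' y'
  have h1 := dist_midpoints_le hgeod hcat hm he hm' he'
  have h2 := Metric.infDist_le_dist_of_mem (x := m) (hK x' hx' y' hy' m' hm')
  linarith

theorem infDist_le_max_of_onSegment (hgeod : IsGeodesicSpace X) (hcat : IsCATNegOne X) {K : Set X}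
    (hK : IsGeodConvex K) (hne : K.Nonempty) {x y z : X} (hz : OnSegment x y z) :
    Metric.infDist z K ≤ max (Metric.infDist x K) (Metric.infDist y K) := by
  obtain ⟨f, h0, h1, h2, hf⟩ := exists_geodOn_through hgeod hcat hz
  have hz' : dist x z ∈ Icc 0 (dist x y) :=
    ⟨dist_nonneg, by unfold OnSegment at hz; linarith [dist_nonneg (x := z) (y := y)]⟩
  have := le_max_of_midpoint_convexOn (g := fun t => Metric.infDist (f t) K) (N := dist x y)
    ((Metric.continuous_infDist_pt K).comp_continuousOn hf.continuousOn) (fun u hu v hv => by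
      wlog huv : u ≤ v generalizing u v
      · have := this v hv u hu (by linarith)
        rw [add_comm u v, add_comm (Metric.infDist (f u) K)]
        exact this
      have hI : (u + v) / 2 ∈ Icc u v := ⟨by linarith, by linarith⟩
      have hfuv := hf.mono hu.1 hv.2
      refine infDist_midpoint_le hgeod hcat hK hne (hfuv.onSegment hI) ?_
      rw [hfuv.dist_eq le_rfl hI.1 hI.2, hfuv.dist_eq hI.1 hI.2 le_rfl]
      ring) hz'
  simpa only [h0, h1, h2] using this

end

section
variable {X : Type*} [MetricSpace X]

/-! ### Thick convex subsets -/

/-- Sublevel sets `{Φ ≤ r}` of `1`-Lipschitz quasiconvex functions which decrease exponentially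
along the geodesic segments with endpoints in the sublevel set. -/
def IsThickConvex (r : ℝ) (C : Set X) : Prop :=
  ∃ Φ : X → ℝ, (∀ x y, Φ x ≤ Φ y + dist x y) ∧ C = {x | Φ x ≤ r} ∧
    (∀ x y z, OnSegment x y z → Φ z ≤ max (Φ x) (Φ y)) ∧
    ∀ x y z, OnSegment x y z → Φ x ≤ r → Φ y ≤ r → r ≤ dist x z → r ≤ dist z y →
      Φ z ≤ 2 * r * (Real.exp (-dist x z) + Real.exp (-dist z y))

/-- Abstract properties of Busemann functions (negative inside the horoballs). -/
def IsHoroFunction (b : X → ℝ) : Prop :=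
  (∀ x y, b x ≤ b y + dist x y) ∧ ∀ x y z, OnSegment x y z →
    Real.sinh (dist x y) * Real.exp (b z) ≤
      Real.sinh (dist z y) * Real.exp (b x) + Real.sinh (dist x z) * Real.exp (b y)

theorem continuous_of_le_add_dist {Φ : X → ℝ} (h : ∀ x y, Φ x ≤ Φ y + dist x y) :
    Continuous Φ := by
  have : LipschitzWith 1 Φ := LipschitzWith.of_le_add h
  exact this.continuous

theorem IsThickConvex.isClosed {r : ℝ} {C : Set X} (h : IsThickConvex r C) : IsClosed C := by
  obtain ⟨Φ, h1, rfl, -⟩ := h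
  exact isClosed_le (continuous_of_le_add_dist h1) continuous_const

theorem IsThickConvex.isGeodConvex {r : ℝ} {C : Set X} (h : IsThickConvex r C) :
    IsGeodConvex C := by
  obtain ⟨Φ, -, rfl, h2, -⟩ := h
  intro x hx y hy z hz
  exact (h2 x y z hz).trans (max_le hx hy)

/-- A quadrilateral with two short opposite sides is exponentially thin. -/
theorem exists_onSegment_dist_le (hgeod : IsGeodesicSpace X) (hcat : IsCATNegOne X)
    {x y x' y' z : X} {r : ℝ} (hr : 0 ≤ r) (hr1 : r ≤ 1) (hz : OnSegment x y z)
    (hx : dist x x' ≤ r) (hy : dist y y' ≤ r) (ha : r ≤ dist x z) (hb : r ≤ dist z y) :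
    ∃ v, OnSegment x' y' v ∧
      dist z v ≤ 2 * r * (Real.exp (-dist x z) + Real.exp (-dist z y)) := by
  -- The diagonal `g` from `x` to `y'` cuts the quadrilateral into a fan issued from `x` (sides `f`
  -- and `g`) and a fan issued from `y'` (sides `g` reversed and `k`). The point `z` is pushed to
  -- `g` and then to `k`, each fan contributing one exponential term.
  obtain ⟨f, f0, f1, fz, hf⟩ := exists_geodOn_through hgeod hcat hz
  obtain ⟨g, g0, g1, hg⟩ := hgeod.exists_segment x y'
  obtain ⟨k, k0, k1, hk⟩ := hgeod.exists_segment y' x'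
  have t1 := dist_triangle x y' y
  have t2 := dist_triangle y' x' x
  rw [dist_comm y' y] at t1
  rw [dist_comm y' x, dist_comm x' x] at t2
  unfold OnSegment at hz
  set a := dist x z with hadef
  set b := dist z y with hbdef
  set q := dist x y' with hq
  set q' := dist y' x' with hq'
  have hexp : Real.exp r - 1 ≤ 2 * r := by
    have := Real.abs_exp_sub_one_le (x := r) (by rwa [abs_of_nonneg hr])
    rw [abs_of_nonneg hr] at this
    exact (le_abs_self _).trans this
  have hsinh : ∀ d c : ℝ, d ≤ r → 2 * Real.exp (-c + r / 2) * Real.sinh (d / 2) ≤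
      2 * r * Real.exp (-c) := fun d c hd => by
    have e1 : Real.sinh (d / 2) ≤ Real.sinh (r / 2) := Real.sinh_le_sinh.2 (by linarith)
    have e2 : 2 * Real.exp (-c + r / 2) * Real.sinh (r / 2) = Real.exp (-c) * (Real.exp r - 1) := by
      have e3 : Real.exp (r / 2) * Real.exp (r / 2) = Real.exp r := by
        rw [← Real.exp_add]; ring_nf
      have e4 : Real.exp (r / 2) * Real.exp (-(r / 2)) = 1 := by rw [← Real.exp_add]; simp
      rw [Real.exp_add, Real.sinh_eq]
      linear_combination Real.exp (-c) * e3 - Real.exp (-c) * e4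
    have e5 := mul_le_mul_of_nonneg_left e1 (by positivity : 0 ≤ 2 * Real.exp (-c + r / 2))
    have e6 := mul_le_mul_of_nonneg_left hexp (Real.exp_pos (-c)).le
    linarith
  have ha0 : 0 ≤ a := dist_nonneg
  have s1 : dist z (g a) ≤ 2 * r * Real.exp (-b) := by
    have h := hcat.fan_dist_le hf hg (f0.trans g0.symm) ha0 (by linarith) (by linarith)
    rw [fz, f1, g1] at h
    refine h.trans (le_trans ?_ (hsinh _ b hy))
    refine mul_le_mul_of_nonneg_right ?_ (Real.sinh_nonneg_iff.2 (by positivity))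
    have := Real.exp_le_exp.2 (by linarith : a - (dist x y + q) / 2 ≤ -b + r / 2)
    linarith
  have hg' := hg.reverse q
  rw [sub_self, sub_zero] at hg'
  have hqa : 0 ≤ q - a := by linarith
  have s2 : dist (g a) (k (q - a)) ≤ 2 * r * Real.exp (-a) := by
    have h := hcat.fan_dist_le hg' hk (by simp only [sub_zero]; rw [g1, k0]) hqa (by linarith)
      (by linarith)
    simp only [sub_self, sub_sub_cancel] at h
    rw [g0, k1] at h
    refine h.trans (le_trans ?_ (hsinh _ a hx))
    refine mul_le_mul_of_nonneg_right ?_ (Real.sinh_nonneg_iff.2 (by positivity))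
    have := Real.exp_le_exp.2 (by linarith : q - a - (q + q') / 2 ≤ -a + r / 2)
    linarith
  refine ⟨k (q - a), ?_, ?_⟩
  · have := hk.onSegment (u := q - a) ⟨hqa, by linarith⟩
    rw [k0, k1] at this
    exact this.symm
  · have := dist_triangle z (g a) (k (q - a))
    linarith

/-- Take for `Φ` the distance to `K` minus `ε - r`. Points of the `ε`-neighbourhood are within `r`
of the `(ε - r)`-neighbourhood, which is convex; thinness of quadrilaterals then brings a point far
from the ends of a segment exponentially close to that inner neighbourhood. -/
theorem isThickConvex_cthickening [ProperSpace X] (hgeod : IsGeodesicSpace X)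
    (hcat : IsCATNegOne X) {K : Set X} (hK : IsGeodConvex K) {ε r : ℝ} (hr : 0 < r) (hr1 : r ≤ 1)
    (hrε : r ≤ ε) : IsThickConvex r (Metric.cthickening ε K) := by
  rcases K.eq_empty_or_nonempty with rfl | hne
  · refine ⟨fun _ => r + 1, fun x y => by linarith [dist_nonneg (x := x) (y := y)], ?_,
      fun x y z _ => by simp, fun x y z _ hx => by linarith⟩
    rw [Metric.cthickening_empty]
    ext x
    simp
  · refine ⟨fun x => Metric.infDist x K - (ε - r), fun x y => ?_, ?_, fun x y z hz => ?_,
      fun x y z hz hx hy ha hb => ?_⟩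
    · have := Metric.infDist_le_infDist_add_dist (s := K) (x := x) (y := y)
      linarith
    · ext x
      rw [Metric.mem_cthickening_iff, mem_ofPred_eq,
        ENNReal.le_ofReal_iff_toReal_le (Metric.infEDist_ne_top hne) (by linarith)]
      change Metric.infDist x K ≤ ε ↔ _
      constructor <;> intro h <;> linarith
    · have := infDist_le_max_of_onSegment hgeod hcat hK hne hz
      rcases le_max_iff.1 this with h | h
      · exact le_max_of_le_left (by linarith)
      · exact le_max_of_le_right (by linarith)
    · have hproj : ∀ x, Metric.infDist x K - (ε - r) ≤ r →
          ∃ x', dist x x' ≤ r ∧ Metric.infDist x' K ≤ ε - r := fun x hx => by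
        obtain ⟨p, hp, hpd⟩ := isClosed_closure.exists_infDist_eq_dist hne.closure x
        rw [Metric.infDist_closure] at hpd
        obtain ⟨f, f0, f1, hf⟩ := hgeod.exists_segment x p
        have hN := dist_nonneg (x := x) (y := p)
        have m1 : min r (dist x p) ∈ Icc 0 (dist x p) := ⟨le_min hr.le hN, min_le_right _ _⟩
        refine ⟨f (min r (dist x p)), ?_, ?_⟩
        · have := hf.dist_eq (u := 0) le_rfl m1.1 m1.2
          rw [f0, sub_zero] at this
          rw [this]; exact min_le_left _ _
        · have h := hf.dist_eq m1.1 m1.2 le_rfl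
          rw [f1] at h
          have h2 := Metric.infDist_le_dist_of_mem (x := f (min r (dist x p))) hp
          rw [Metric.infDist_closure] at h2
          rcases min_choice r (dist x p) with h3 | h3 <;> rw [h3] at h h2 ⊢ <;> linarith
      obtain ⟨x', hx1, hx2⟩ := hproj x hx
      obtain ⟨y', hy1, hy2⟩ := hproj y hy
      obtain ⟨v, hv, hzv⟩ := exists_onSegment_dist_le hgeod hcat hr.le hr1 hz hx1 hy1 ha hb
      have h1 := infDist_le_max_of_onSegment hgeod hcat hK hne hv
      have h2 := Metric.infDist_le_infDist_add_dist (s := K) (x := z) (y := v)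
      have h3 := h1.trans (max_le hx2 hy2)
      linarith

/-! ### Horoballs -/

theorem IsHoroFunction.le_max {b : X → ℝ} (hb : IsHoroFunction b) {x y z : X}
    (hz : OnSegment x y z) : b z ≤ max (b x) (b y) := by
  have h := hb.2 x y z hz
  unfold OnSegment at hz
  have d1 := dist_nonneg (x := x) (y := z)
  have d2 := dist_nonneg (x := z) (y := y)
  rcases eq_or_lt_of_le (dist_nonneg (x := x) (y := y)) with h0 | hpos
  · have : x = z := dist_eq_zero.1 (by linarith)
    rw [this]; exact le_max_left _ _
  · have hs := Real.sinh_pos_iff.2 hpos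
    have s1 := Real.sinh_nonneg_iff.2 d1
    have s2 := Real.sinh_nonneg_iff.2 d2
    have e1 := Real.exp_le_exp.2 (le_max_left (b x) (b y))
    have e2 := Real.exp_le_exp.2 (le_max_right (b x) (b y))
    have hsum : Real.sinh (dist z y) + Real.sinh (dist x z) ≤ Real.sinh (dist x y) := by
      rw [← hz, Real.sinh_add]
      nlinarith [Real.one_le_cosh (dist x z), Real.one_le_cosh (dist z y)]
    have hM := Real.exp_pos (max (b x) (b y))
    have : Real.sinh (dist x y) * Real.exp (b z) ≤
        Real.sinh (dist x y) * Real.exp (max (b x) (b y)) := by nlinarith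
    exact Real.exp_le_exp.1 (le_of_mul_le_mul_left this hs)

theorem IsHoroFunction.exp_le {b : X → ℝ} (hb : IsHoroFunction b) {x y z : X}
    (hz : OnSegment x y z) (hx : b x ≤ 0) (hy : b y ≤ 0) (hpos : 0 < dist x y) :
    Real.exp (b z) ≤ Real.exp (-dist x z) + Real.exp (-dist z y) := by
  have h := hb.2 x y z hz
  unfold OnSegment at hz
  have d1 := dist_nonneg (x := x) (y := z)
  have d2 := dist_nonneg (x := z) (y := y)
  have hs := Real.sinh_pos_iff.2 hpos
  have s1 := Real.sinh_nonneg_iff.2 d1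
  have s2 := Real.sinh_nonneg_iff.2 d2
  have e1 := Real.exp_le_one_iff.2 hx
  have e2 := Real.exp_le_one_iff.2 hy
  have i1 := Real.sinh_le_exp_mul_sinh (w := dist z y) (x := dist x y) (by linarith)
  have i2 := Real.sinh_le_exp_mul_sinh (w := dist x z) (x := dist x y) (by linarith)
  have j1 : dist z y - dist x y = -dist x z := by linarith
  have j2 : dist x z - dist x y = -dist z y := by linarith
  rw [j1] at i1; rw [j2] at i2
  refine le_of_mul_le_mul_left ?_ hs
  nlinarith

/-- The function `b + 1` works with `r = 1`, because `b + 1 ≤ e^b` and `e^b` decays exponentially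
along segments by `IsHoroFunction.exp_le`. -/
theorem IsHoroFunction.isThickConvex {b : X → ℝ} (hb : IsHoroFunction b) :
    IsThickConvex 1 {x | b x ≤ 0} := by
  refine ⟨fun x => b x + 1, fun x y => by linarith [hb.1 x y], ?_, fun x y z hz => ?_,
    fun x y z hz hx hy ha hbd => ?_⟩
  · ext x; simp
  · have := hb.le_max hz
    rw [max_add_add_right]; linarith
  · have h0 : 0 < dist x y := by unfold OnSegment at hz; linarith
    have h1 := hb.exp_le hz (by linarith) (by linarith) h0
    have h2 := Real.add_one_le_exp (b z)
    have p1 := Real.exp_pos (-dist x z)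
    have p2 := Real.exp_pos (-dist z y)
    simp only
    linarith

theorem antitone_dist_sub {f : ℝ → X} (hf : ∀ N, GeodOn f 0 N) (x : X) :
    AntitoneOn (fun t => dist x (f t) - t) (Ici 0) := fun s hs t ht hst => by
  have h := (hf t).dist_eq hs hst le_rfl
  have := dist_triangle x (f s) (f t)
  simp only
  linarith

theorem exists_tendsto_dist_sub {f : ℝ → X} (hf : ∀ N, GeodOn f 0 N) (x : X) :
    ∃ c, Tendsto (fun t => dist x (f t) - t) atTop (𝓝 c) := by
  have hanti : Antitone (fun t : ℝ => dist x (f (max t 0)) - max t 0) := fun s t hst =>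
    antitone_dist_sub hf x (le_max_right s 0 : (0:ℝ) ≤ max s 0) (le_max_right t 0 : (0:ℝ) ≤ max t 0)
      (max_le_max_right 0 hst)
  have hbdd : BddBelow (range fun t : ℝ => dist x (f (max t 0)) - max t 0) := by
    refine ⟨-dist x (f 0), ?_⟩
    rintro _ ⟨t, rfl⟩
    have h := (hf (max t 0)).dist_eq le_rfl (le_max_right t 0) le_rfl
    have := dist_triangle (f 0) x (f (max t 0))
    rw [dist_comm (f 0) x] at this
    simp only
    linarith
  refine ⟨_, (tendsto_atTop_ciInf hanti hbdd).congr' ?_⟩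
  filter_upwards [eventually_ge_atTop 0] with t ht
  rw [max_eq_left ht]

theorem GeodesicRay.geodOn (ρ : GeodesicRay X) (N : ℝ) :
    GeodOn (fun t => ρ.1 t.toNNReal) 0 N := fun u hu v hv => by
  rw [ρ.2.dist_eq, NNReal.dist_eq, Real.coe_toNNReal _ hu.1, Real.coe_toNNReal _ hv.1]

/-- Every Busemann function based at a geodesic ray is, up to sign and constants, a horofunction. -/
theorem exists_isHoroFunction (hcat : IsCATNegOne X) (ρ : GeodesicRay X) :
    ∃ b : X → ℝ, IsHoroFunction b ∧ ∀ x y, busemann ρ x y = b x - b y := by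
  -- The function `e^b` is the limit of `2 e^{-t} cosh d(ρ(t), ·)`, so the Stewart inequality with
  -- apex `ρ(t)` passes to the limit and becomes the convexity of the horofunction.
  choose b hb using fun x => exists_tendsto_dist_sub ρ.geodOn x
  have hlim : ∀ x, Tendsto (fun t => Real.exp (-t) * (2 * Real.cosh (dist (ρ.1 t.toNNReal) x)))
      atTop (𝓝 (Real.exp (b x))) := fun x => by
    have h1 : Tendsto (fun t : ℝ => Real.exp (dist x (ρ.1 t.toNNReal) - t)
        + Real.exp (-(dist x (ρ.1 t.toNNReal) - t) + -(2 * t))) atTop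
        (𝓝 (Real.exp (b x) + 0)) := by
      refine ((Real.continuous_exp.tendsto _).comp (hb x)).add ?_
      refine Real.tendsto_exp_atBot.comp ?_
      refine (hb x).neg.add_atBot ?_
      exact tendsto_neg_atTop_atBot.comp (tendsto_id.const_mul_atTop (by norm_num))
    rw [add_zero] at h1
    refine h1.congr fun t => ?_
    rw [Real.cosh_eq, dist_comm, mul_div_cancel₀ _ two_ne_zero, mul_add, ← Real.exp_add,
      ← Real.exp_add]
    ring_nf
  refine ⟨b, ⟨fun x y => ?_, fun x y z hz => ?_⟩, fun x y => ?_⟩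
  · refine le_of_tendsto_of_tendsto' (hb x) ((hb y).add_const (dist x y)) fun t => ?_
    have := dist_triangle x y (ρ.1 t.toNNReal)
    linarith
  · refine le_of_tendsto_of_tendsto' ((hlim z).const_mul _)
      (((hlim x).const_mul _).add ((hlim y).const_mul _)) fun t => ?_
    have := hcat.stewart (ρ.1 t.toNNReal) x y z hz
    have e := Real.exp_pos (-t)
    have := mul_le_mul_of_nonneg_left this (by positivity : 0 ≤ 2 * Real.exp (-t))
    linarith
  · unfold busemann
    apply Tendsto.limUnder_eq
    have := ((hb x).sub (hb y)).comp (NNReal.tendsto_coe_atTop.2 tendsto_id)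
    refine this.congr fun t => ?_
    simp

theorem IsHoroball.exists_isHoroFunction (hcat : IsCATNegOne X) {H : Set X} (hH : IsHoroball H) :
    ∃ b : X → ℝ, IsHoroFunction b ∧ H = {x | b x ≤ 0} := by
  obtain ⟨ρ, x, s, rfl⟩ := hH
  obtain ⟨b, hb, hbus⟩ := _root_.exists_isHoroFunction hcat ρ
  refine ⟨fun y => b y + (s - b x), ⟨fun y z => by linarith [hb.1 y z], fun y z w hw => ?_⟩, ?_⟩
  · have := mul_le_mul_of_nonneg_right (hb.2 y z w hw) (Real.exp_pos (s - b x)).le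
    simp only [Real.exp_add]
    linarith
  · ext y
    simp only [mem_ofPred_eq, hbus]
    constructor <;> intro h <;> linarith

end

section
variable {X : Type*} [MetricSpace X]

/-! ### Synchronized geodesics -/

/-- Two geodesics, parametrized by the upper set `D`, which are close to each other at times near
the infimum of `D`, and equal outside `D`. -/
structure Synced (D : Set ℝ) (f g : ℝ → X) : Prop where
  geod_left : ∀ s ∈ D, ∀ t, GeodOn f s t
  geod_right : ∀ s ∈ D, ∀ t, GeodOn g s t
  approx : ∀ t ∈ D, ∀ δ > 0, ∃ s ∈ D, s ≤ t ∧ dist (f s) (g s) ≤ δ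
  eq_off : ∀ t ∉ D, f t = g t

/-- `f` and `g` are exponentially close to each other up to time `T`. -/
def CloseUpTo (B : ℝ) (f g : ℝ → X) (T : ℝ) : Prop :=
  ∀ t ≤ T, dist (f t) (g t) ≤ B * Real.exp (t - T)

theorem CloseUpTo.symm {B : ℝ} {f g : ℝ → X} {T : ℝ} (h : CloseUpTo B f g T) :
    CloseUpTo B g f T := fun t ht => by rw [dist_comm]; exact h t ht

theorem CloseUpTo.of_le {B : ℝ} {f g : ℝ → X} {T T' : ℝ} (h : CloseUpTo B f g T) (hB : 0 ≤ B)
    (hT : T' ≤ T) : CloseUpTo B f g T' := fun t ht =>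
  (h t (ht.trans hT)).trans (mul_le_mul_of_nonneg_left (Real.exp_le_exp.2 (by linarith)) hB)

theorem CloseUpTo.mono {B B' : ℝ} {f g : ℝ → X} {T : ℝ} (h : CloseUpTo B f g T) (hB : B ≤ B') :
    CloseUpTo B' f g T := fun t ht =>
  (h t ht).trans (mul_le_mul_of_nonneg_right hB (Real.exp_pos _).le)

theorem Synced.abs_sub_le_dist {D : Set ℝ} {f g : ℝ → X} (h : Synced D f g) {t S T : ℝ}
    (ht : t ∈ D) (htS : t ≤ S) (htT : t ≤ T) : |S - T| ≤ dist (f S) (g T) := by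
  refine le_of_forall_pos_le_add fun δ hδ => ?_
  obtain ⟨s, hs, hst, hd⟩ := h.approx t ht δ hδ
  have e1 := (h.geod_left s hs S).dist_eq le_rfl (hst.trans htS) le_rfl
  have e2 := (h.geod_right s hs T).dist_eq le_rfl (hst.trans htT) le_rfl
  have t1 := dist_triangle (f s) (f S) (g T)
  have t2 := dist_triangle (g s) (f s) (g T)
  have t3 := dist_triangle (f s) (g T) (f S)
  have t4 := dist_triangle (f s) (g s) (g T)
  rw [dist_comm (g s) (f s)] at t2
  rw [dist_comm (g T) (f S)] at t3
  rw [abs_le]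
  constructor <;> linarith

/-- Apply `IsCATNegOne.fan_of_close` from times `s` at which the geodesics are `δ`-close and let `δ`
tend to `0`; the bound does not involve `s`, so geodesics issued from infinity behave like geodesics
issued from a common point. -/
theorem Synced.cosh_le (hcat : IsCATNegOne X) {D : Set ℝ} {f g : ℝ → X} (h : Synced D f g)
    {t S T : ℝ} (ht : t ∈ D) (htS : t ≤ S) (htT : t ≤ T) :
    Real.cosh (dist (f t) (g t)) ≤
      1 + Real.exp (2 * t - S - T) * (Real.cosh (dist (f S) (g T)) - Real.cosh (S - T)) := by
  have hST := h.abs_sub_le_dist ht htS htT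
  have hlim : Tendsto (fun δ : ℝ => Real.exp δ * (1 + Real.exp (2 * t - S - T) *
      (Real.cosh (dist (f S) (g T)) - Real.cosh (S - T)))) (𝓝[>] 0) (𝓝 (Real.exp 0 *
      (1 + Real.exp (2 * t - S - T) * (Real.cosh (dist (f S) (g T)) - Real.cosh (S - T))))) :=
    ((Real.continuous_exp.mul continuous_const).tendsto 0).mono_left nhdsWithin_le_nhds
  rw [Real.exp_zero, one_mul] at hlim
  refine ge_of_tendsto hlim ?_
  filter_upwards [self_mem_nhdsWithin] with δ hδ
  obtain ⟨s, hs, hst, hd⟩ := h.approx t ht δ hδ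
  exact hcat.fan_of_close (h.geod_left s hs S) (h.geod_right s hs T) hd hST hst htS htT

/-- A bound at the single time `T` controls the whole past, as the distance decays exponentially
backwards. -/
theorem Synced.closeUpTo (hcat : IsCATNegOne X) {D : Set ℝ} {f g : ℝ → X} (h : Synced D f g)
    {T B : ℝ} (hB : 0 ≤ B) (hT : 2 * (Real.cosh (dist (f T) (g T)) - 1) ≤ B ^ 2) :
    CloseUpTo B f g T := fun t ht => by
  by_cases htD : t ∈ D
  · have h1 := h.cosh_le hcat htD ht ht
    rw [sub_self, Real.cosh_zero] at h1
    have h2 := Real.sq_le_two_mul_cosh_sub_one (dist (f t) (g t))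
    refine le_of_sq_le_sq ?_ (by positivity)
    have e : Real.exp (2 * t - T - T) = Real.exp (t - T) ^ 2 := by
      rw [← Real.exp_nat_mul]; congr 1; push_cast; ring
    rw [e] at h1
    nlinarith [mul_le_mul_of_nonneg_left hT (sq_nonneg (Real.exp (t - T)))]
  · rw [h.eq_off t htD, dist_self]
    positivity

/-! ### Synchronization of asymptotic lines -/

/-- The right time shift is given by the Busemann value `c` of `g 0` along the reversed line `f`. In
the quadrilateral with vertices `f (-2s)`, `f 0`, `g 0`, `g (-2s)`, two sides have length at most
`K` and the others length `2s`; passing through the diagonal, of length `l` with `l - 2s → c`, the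
points halfway are exponentially close. -/
theorem exists_tendsto_dist_shift (hgeod : IsGeodesicSpace X) (hcat : IsCATNegOne X) {f g : ℝ → X}
    (hf : Isometry f) (hg : Isometry g) {K : ℝ} (hK : ∀ t ≤ 0, dist (f t) (g t) ≤ K) :
    ∃ r, Tendsto (fun t => dist (f t) (g (t + r))) atBot (𝓝 0) := by
  have hK0 : 0 ≤ K := dist_nonneg.trans (hK 0 le_rfl)
  have df : ∀ u v, dist (f u) (f v) = |u - v| := fun u v => by rw [hf.dist_eq, Real.dist_eq]
  have dg : ∀ u v, dist (g u) (g v) = |u - v| := fun u v => by rw [hg.dist_eq, Real.dist_eq]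
  have hneg : ∀ N, GeodOn (fun t => f (-t)) 0 N := fun N u _ v _ => by
    rw [df, abs_sub_comm]; ring_nf
  obtain ⟨c, hc⟩ := exists_tendsto_dist_sub hneg (g 0)
  refine ⟨-c, ?_⟩
  have hbound : ∀ s, K < s → dist (f (-s)) (g (-s + -c)) ≤
      4 * Real.sinh (K / 2) * Real.exp (K / 2 - s) + |dist (g 0) (f (-(2 * s))) - 2 * s - c| := by
    intro s hs
    obtain ⟨k, k0, k1, hk⟩ := hgeod.exists_segment (f (-(2 * s))) (g 0)
    set l := dist (f (-(2 * s))) (g 0) with hl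
    have t1 := dist_triangle (f (-(2 * s))) (f 0) (g 0)
    have t2 := dist_triangle (f (-(2 * s))) (g 0) (f 0)
    rw [dist_comm (g 0) (f 0)] at t2
    have e0 : dist (f (-(2 * s))) (f 0) = 2 * s := by
      rw [df, sub_zero, abs_neg, abs_of_nonneg (by linarith)]
    have hk0 := hK 0 le_rfl
    have hl1 : l ≤ 2 * s + K := by linarith
    have hl2 : 2 * s - K ≤ l := by linarith
    have a1 : GeodOn (fun u => f (u - 2 * s)) 0 (2 * s) := fun u _ v _ => by
      rw [df]; ring_nf
    have a2 : GeodOn (fun u => g (-u)) 0 (2 * s) := fun u _ v _ => by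
      rw [dg, abs_sub_comm]; ring_nf
    have a3 := hk.reverse l
    rw [sub_self, sub_zero] at a3
    have hexp : ∀ e d, e ≤ K / 2 - s → d ≤ K → 2 * Real.exp e * Real.sinh (d / 2) ≤
        2 * Real.sinh (K / 2) * Real.exp (K / 2 - s) := fun e d he hd => by
      have i1 := Real.exp_le_exp.2 he
      have i2 : Real.sinh (d / 2) ≤ Real.sinh (K / 2) := Real.sinh_le_sinh.2 (by linarith)
      have i3 : 0 ≤ Real.sinh (K / 2) := Real.sinh_nonneg_iff.2 (by linarith)
      nlinarith [Real.exp_pos e, mul_le_mul_of_nonneg_left i2 (Real.exp_pos e).le,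
        mul_le_mul_of_nonneg_right i1 i3]
    have b1 : dist (f (-s)) (k s) ≤ 2 * Real.sinh (K / 2) * Real.exp (K / 2 - s) := by
      have h := hcat.fan_dist_le a1 hk (t := s) (by simp only [zero_sub]; rw [k0]) (by linarith)
        (by linarith) (by linarith)
      simp only [sub_self] at h
      rw [k1, show s - 2 * s = -s by ring] at h
      exact h.trans (hexp _ _ (by linarith) hk0)
    have b2 : dist (k s) (g (s - l)) ≤ 2 * Real.sinh (K / 2) * Real.exp (K / 2 - s) := by
      have h := hcat.fan_dist_le a3 a2 (t := l - s) (by simp only [sub_zero, neg_zero]; rw [k1])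
        (by linarith) (by linarith) (by linarith)
      simp only [sub_self, sub_sub_cancel, neg_sub] at h
      rw [k0] at h
      exact h.trans (hexp _ _ (by linarith) (hK _ (by linarith)))
    have b3 : dist (g (s - l)) (g (-s + -c)) = |l - 2 * s - c| := by
      rw [dg, abs_sub_comm]; ring_nf
    have c1 := dist_triangle (f (-s)) (k s) (g (-s + -c))
    have c2 := dist_triangle (k s) (g (s - l)) (g (-s + -c))
    rw [dist_comm (g 0), ← hl]
    linarith
  have hzero : Tendsto (fun s => 4 * Real.sinh (K / 2) * Real.exp (K / 2 - s) +
      |dist (g 0) (f (-(2 * s))) - 2 * s - c|) atTop (𝓝 0) := by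
    have h1 : Tendsto (fun s : ℝ => Real.exp (K / 2 - s)) atTop (𝓝 0) :=
      Real.tendsto_exp_atBot.comp (tendsto_atBot_add_const_left _ _ tendsto_neg_atTop_atBot)
    have h2 : Tendsto (fun s : ℝ => dist (g 0) (f (-(2 * s))) - 2 * s - c) atTop (𝓝 (c - c)) :=
      (hc.comp (tendsto_id.const_mul_atTop (by norm_num : (0:ℝ) < 2))).sub_const c
    have := (h1.const_mul (4 * Real.sinh (K / 2))).add h2.abs
    simpa using this
  have hpos : Tendsto (fun s => dist (f (-s)) (g (-s + -c))) atTop (𝓝 0) := by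
    refine squeeze_zero' (Eventually.of_forall fun _ => dist_nonneg) ?_ hzero
    filter_upwards [eventually_gt_atTop K] with s hs using hbound s hs
  have := hpos.comp tendsto_neg_atBot_atTop
  refine this.congr fun t => ?_
  simp

/-! ### Normalized geodesics starting from a point of the compactification -/

/-- The domain of definition of normalized geodesics starting from `ξ`. -/
def startDomain (ξ : X ⊕ BoundaryAtInfinity X) : Set ℝ :=
  match ξ with
  | Sum.inl _ => Ici 0
  | Sum.inr _ => univ

/-- Geodesics starting from `ξ` whose time origin is the one of `base`. -/
def IsNormalized {ξ : X ⊕ BoundaryAtInfinity X} (base : ℝ → X) (γ : GeodesicsFrom ξ) : Prop :=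
  match ξ with
  | Sum.inl x => IsRayFrom x 0 γ.1
  | Sum.inr _ => Tendsto (fun t => dist (γ.1 t) (base t)) atBot (𝓝 0)

theorem startDomain_upper {ξ : X ⊕ BoundaryAtInfinity X} {s t : ℝ} (hs : s ∈ startDomain ξ)
    (hst : s ≤ t) : t ∈ startDomain ξ := by
  cases ξ with
  | inl x => exact le_trans (show (0:ℝ) ≤ s from hs) hst
  | inr ζ => trivial

variable {ξ : X ⊕ BoundaryAtInfinity X} {base : ℝ → X}

theorem IsNormalized.timeDomain_eq {γ : GeodesicsFrom ξ} (h : IsNormalized base γ) :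
    timeDomain γ = startDomain ξ := by
  cases ξ with
  | inl x =>
    ext t
    constructor
    · rintro ⟨ι, hι, hray⟩
      by_contra ht
      have ht' : t < 0 := not_le.1 ht
      have h' : IsRayFrom x 0 γ.1 := h
      -- The ray would be isometric on `[ι, +∞[` with `ι < 0`, yet it takes the value `x` both at
      -- `ι` and at `0`.
      have h0 := hray.2 ι self_mem_Ici 0 (show ι ≤ 0 by linarith)
      rw [h'.1 ι (by linarith), h'.1 0 le_rfl, dist_self, sub_zero] at h0
      have : ι = 0 := abs_eq_zero.1 h0.symm
      linarith
    · intro ht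
      exact ⟨0, ht, h⟩
  | inr ζ => rfl

theorem IsNormalized.synced {γ γ' : GeodesicsFrom ξ} (h : IsNormalized base γ)
    (h' : IsNormalized base γ') : Synced (startDomain ξ) γ.1 γ'.1 := by
  cases ξ with
  | inl x =>
    have h1 : IsRayFrom x 0 γ.1 := h
    have h2 : IsRayFrom x 0 γ'.1 := h'
    have hg : ∀ f : ℝ → X, IsRayFrom x 0 f → ∀ s ∈ Ici (0:ℝ), ∀ t, GeodOn f s t :=
      fun f hf s hs t u hu v hv => hf.2 u (le_trans hs hu.1) v (le_trans hs hv.1)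
    refine ⟨hg _ h1, hg _ h2, fun t ht δ hδ => ⟨0, self_mem_Ici, ht, ?_⟩, fun t ht => ?_⟩
    · rw [h1.1 0 le_rfl, h2.1 0 le_rfl, dist_self]; exact hδ.le
    · have ht' : t ≤ 0 := (not_le.1 ht).le
      rw [h1.1 t ht', h2.1 t ht']
  | inr ζ =>
    have hg : ∀ f : ℝ → X, Isometry f → ∀ s ∈ (univ : Set ℝ), ∀ t, GeodOn f s t :=
      fun f hf s _ t u _ v _ => by rw [hf.dist_eq, Real.dist_eq]
    refine ⟨hg _ γ.2.1, hg _ γ'.2.1, fun t _ δ hδ => ?_, fun t ht => (ht trivial).elim⟩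
    have h1 : Tendsto (fun t => dist (γ.1 t) (base t)) atBot (𝓝 0) := h
    have h2 : Tendsto (fun t => dist (γ'.1 t) (base t)) atBot (𝓝 0) := h'
    have h3 := h1.add h2
    rw [add_zero] at h3
    obtain ⟨s, hs1, hs2⟩ := ((h3.eventually (gt_mem_nhds hδ)).and (eventually_le_atBot t)).exists
    refine ⟨s, trivial, hs2, ?_⟩
    have := dist_triangle (γ.1 s) (base s) (γ'.1 s)
    rw [dist_comm (base s)] at this
    linarith

/-- The geodesic `t ↦ γ (t + s)`. -/
theorem exists_shift (γ : GeodesicsFrom ξ) (s : ℝ) :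
    ∃ γ' : GeodesicsFrom ξ, ∀ t, γ'.1 t = γ.1 (t + s) := by
  refine ⟨⟨⟨fun t => γ.1 (t + s), γ.1.continuous.comp (continuous_add_const s)⟩, ?_⟩, fun t => rfl⟩
  cases ξ with
  | inl x =>
    obtain ⟨ι, h1, h2⟩ := γ.2
    refine ⟨ι - s, fun t ht => h1 _ (by linarith), fun u hu v hv => ?_⟩
    have := h2 (u + s) (show ι ≤ u + s by linarith [show ι - s ≤ u from hu]) (v + s)
      (show ι ≤ v + s by linarith [show ι - s ≤ v from hv])
    rw [add_sub_add_right_eq_sub] at this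
    exact this
  | inr ζ =>
    obtain ⟨h1, ρ, hρ, h2⟩ := γ.2
    refine ⟨h1.comp (isometry_add_right s), ?_⟩
    have hi : Isometry fun t : ℝ≥0 => γ.1 (-(t : ℝ) + s) := by
      refine Isometry.of_dist_eq fun u v => ?_
      rw [h1.dist_eq, Real.dist_eq, NNReal.dist_eq, abs_sub_comm]
      ring_nf
    refine ⟨⟨_, hi⟩, ?_, fun t => rfl⟩
    refine Eq.trans (Quotient.sound ⟨|s|, fun t => ?_⟩) hρ
    rw [h2]
    change dist (γ.1 (-(t : ℝ) + s)) _ ≤ _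
    rw [h1.dist_eq, Real.dist_eq]
    simp

theorem exists_bound_of_lineFrom {ζ : BoundaryAtInfinity X} {f g : ℝ → X} (hf : IsLineFrom ζ f)
    (hg : IsLineFrom ζ g) : ∃ K, ∀ t ≤ 0, dist (f t) (g t) ≤ K := by
  obtain ⟨-, ρ, hρ, h1⟩ := hf
  obtain ⟨-, σ, hσ, h2⟩ := hg
  obtain ⟨K, hK⟩ := Quotient.exact (hρ.trans hσ.symm)
  refine ⟨K, fun t ht => ?_⟩
  have := hK (-t).toNNReal
  rw [h1, h2, Real.coe_toNNReal _ (by linarith), neg_neg] at this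
  exact this

theorem exists_normalized_shift (hgeod : IsGeodesicSpace X) (hcat : IsCATNegOne X)
    (γ₀ γ : GeodesicsFrom ξ) : ∃ γ' : GeodesicsFrom ξ, ∃ s, IsNormalized γ₀.1 γ' ∧
      ∀ t, γ'.1 t = γ.1 (t + s) := by
  cases ξ with
  | inl x =>
    obtain ⟨ι, h1, h2⟩ := γ.2
    obtain ⟨γ', hγ'⟩ := exists_shift γ ι
    refine ⟨γ', ι, ⟨fun t ht => ?_, fun u hu v hv => ?_⟩, hγ'⟩
    · rw [hγ']; exact h1 _ (by linarith)
    · rw [hγ', hγ', h2 _ (show ι ≤ u + ι by linarith [show (0:ℝ) ≤ u from hu]) _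
        (show ι ≤ v + ι by linarith [show (0:ℝ) ≤ v from hv])]
      ring_nf
  | inr ζ =>
    obtain ⟨K, hK⟩ := exists_bound_of_lineFrom γ₀.2 γ.2
    obtain ⟨r, hr⟩ := exists_tendsto_dist_shift hgeod hcat γ₀.2.1 γ.2.1 hK
    obtain ⟨γ', hγ'⟩ := exists_shift γ r
    refine ⟨γ', r, ?_, hγ'⟩
    change Tendsto (fun t => dist (γ'.1 t) (γ₀.1 t)) atBot (𝓝 0)
    refine hr.congr fun t => ?_
    rw [hγ', dist_comm]

end

/-! ### Lengths of closed intervals -/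

theorem exists_mem_gt_of_lt_volume {J : Set ℝ} {s ℓ : ℝ} (hs : IsLeast J s)
    (hℓ : ENNReal.ofReal ℓ < volume J) : ∃ e ∈ J, s + ℓ < e := by
  by_contra! hc
  have hsub : J ⊆ Icc s (s + ℓ) := fun t ht => ⟨hs.2 ht, hc t ht⟩
  have := measure_mono (μ := volume) hsub
  rw [Real.volume_Icc, add_sub_cancel_left] at this
  exact absurd hℓ (not_lt.2 this)

theorem Icc_subset_of_le_volume {J : Set ℝ} {s ℓ : ℝ} (hJ : OrdConnected J) (hcl : IsClosed J)
    (hs : IsLeast J s) (hℓ : ENNReal.ofReal ℓ ≤ volume J) : Icc s (s + ℓ) ⊆ J := by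
  have hIco : Ico s (s + ℓ) ⊆ J := fun t ht => by
    have hlt : ENNReal.ofReal (t - s) < volume J := by
      refine lt_of_lt_of_le ?_ hℓ
      rw [ENNReal.ofReal_lt_ofReal_iff (by linarith [ht.1, ht.2])]
      linarith [ht.2]
    obtain ⟨e, he, hte⟩ := exists_mem_gt_of_lt_volume hs hlt
    exact hJ.out hs.1 he ⟨ht.1, by linarith⟩
  intro t ht
  rcases eq_or_lt_of_le (ht.1.trans ht.2) with h0 | h0
  · have : t = s := by linarith [ht.1, ht.2]
    rw [this]; exact hs.1
  · have := closure_minimal hIco hcl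
    rw [closure_Ico h0.ne] at this
    exact this ht

theorem ofReal_sub_le_volume {J : Set ℝ} {s e : ℝ} (hJ : OrdConnected J) (hs : s ∈ J)
    (he : e ∈ J) : ENNReal.ofReal (e - s) ≤ volume J := by
  rw [← Real.volume_Icc]
  exact measure_mono (hJ.out hs he)

section
variable {X : Type*} [MetricSpace X] {ξ : X ⊕ BoundaryAtInfinity X} {base : ℝ → X}

/-! ### Times at which a geodesic is in a convex subset -/

theorem timesIn_shift {γ γ' : GeodesicsFrom ξ} {s : ℝ} (h : ∀ t, γ'.1 t = γ.1 (t + s))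
    (C : Set X) : timesIn γ' C = (fun t => t + s) ⁻¹' timesIn γ C := by
  have hd : ∀ t, t ∈ timeDomain γ' ↔ t + s ∈ timeDomain γ := by
    cases ξ with
    | inl x =>
      intro t
      constructor
      · rintro ⟨ι, hι, h1, h2⟩
        refine ⟨ι + s, by linarith, fun u hu => ?_, fun u hu v hv => ?_⟩
        · have := h1 (u - s) (by linarith)
          rwa [h, sub_add_cancel] at this
        · have := h2 (u - s) (show ι ≤ u - s by linarith [show ι + s ≤ u from hu]) (v - s)
            (show ι ≤ v - s by linarith [show ι + s ≤ v from hv])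
          rwa [h, h, sub_add_cancel, sub_add_cancel, sub_sub_sub_cancel_right] at this
      · rintro ⟨ι, hι, h1, h2⟩
        refine ⟨ι - s, by linarith, fun u hu => ?_, fun u hu v hv => ?_⟩
        · rw [h]; exact h1 _ (by linarith)
        · rw [h, h, h2 (u + s) (show ι ≤ u + s by linarith [show ι - s ≤ u from hu]) (v + s)
            (show ι ≤ v + s by linarith [show ι - s ≤ v from hv]), add_sub_add_right_eq_sub]
    | inr ζ => intro t; exact Iff.rfl
  ext t
  simp only [timesIn, mem_ofPred_eq, mem_preimage, hd, h]

theorem entersAt_shift {γ γ' : GeodesicsFrom ξ} {s : ℝ} (h : ∀ t, γ'.1 t = γ.1 (t + s))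
    {C : Set X} {t : ℝ} (ht : EntersAt γ C t) : EntersAt γ' C (t - s) := by
  unfold EntersAt at *
  rw [timesIn_shift h]
  refine ⟨?_, fun u hu => ?_⟩
  · rw [mem_preimage, sub_add_cancel]; exact ht.1
  · have := ht.2 hu
    linarith

theorem penetrationLength_shift {γ γ' : GeodesicsFrom ξ} {s : ℝ}
    (h : ∀ t, γ'.1 t = γ.1 (t + s)) (C : Set X) :
    penetrationLength C γ' = penetrationLength C γ := by
  unfold penetrationLength
  rw [timesIn_shift h, measure_preimage_add_right]

theorem IsNormalized.mem_timesIn {γ : GeodesicsFrom ξ} (h : IsNormalized base γ) {C : Set X}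
    {t : ℝ} : t ∈ timesIn γ C ↔ t ∈ startDomain ξ ∧ γ.1 t ∈ C := by
  simp only [timesIn, mem_ofPred_eq, h.timeDomain_eq]

theorem IsNormalized.geodOn {γ : GeodesicsFrom ξ} (h : IsNormalized base γ) {s : ℝ}
    (hs : s ∈ startDomain ξ) (t : ℝ) : GeodOn γ.1 s t := (h.synced h).geod_left s hs t

theorem IsNormalized.ordConnected {γ : GeodesicsFrom ξ} (h : IsNormalized base γ) {C : Set X}
    (hC : IsGeodConvex C) : OrdConnected (timesIn γ C) := by
  refine ⟨fun s hs t ht u hu => ?_⟩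
  rw [h.mem_timesIn] at *
  exact ⟨startDomain_upper hs.1 hu.1,
    hC _ hs.2 _ ht.2 _ ((h.geodOn hs.1 t).onSegment hu)⟩

theorem isClosed_startDomain (ξ : X ⊕ BoundaryAtInfinity X) : IsClosed (startDomain ξ) := by
  cases ξ with
  | inl x => exact isClosed_Ici
  | inr ζ => exact isClosed_univ

theorem IsNormalized.isClosed_timesIn {γ : GeodesicsFrom ξ} (h : IsNormalized base γ) {C : Set X}
    (hC : IsClosed C) : IsClosed (timesIn γ C) := by
  have : timesIn γ C = startDomain ξ ∩ γ.1 ⁻¹' C := by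
    ext t; rw [h.mem_timesIn]; rfl
  rw [this]
  exact (isClosed_startDomain ξ).inter (hC.preimage γ.1.continuous)

/-- A geodesic starting from a point in `C ∪ ∂_∞ C` remains in `C` until it leaves `C`. -/
theorem IsNormalized.mem_of_withBoundary (hgeod : IsGeodesicSpace X) (hcat : IsCATNegOne X)
    {γ : GeodesicsFrom ξ} (h : IsNormalized base γ) {C : Set X} (hcl : IsClosed C)
    (hC : IsGeodConvex C) (hξ : ξ ∈ withBoundary C) {u t : ℝ} (ht : t ∈ timesIn γ C)
    (hut : u ≤ t) (hu : u ∈ startDomain ξ) : u ∈ timesIn γ C := by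
  cases ξ with
  | inl x =>
    have hx : x ∈ C := by
      rcases hξ with ⟨y, hy, hyx⟩ | ⟨y, hy, hyx⟩
      · rwa [← Sum.inl_injective hyx]
      · exact (Sum.inr_ne_inl hyx).elim
    have h' : IsRayFrom x 0 γ.1 := h
    have h0 : (0 : ℝ) ∈ timesIn γ C := by
      rw [h.mem_timesIn]
      exact ⟨self_mem_Ici, by rw [h'.1 0 le_rfl]; exact hx⟩
    exact (h.ordConnected hC).out h0 ht ⟨hu, hut⟩
  | inr ζ =>
    have hζ : ζ ∈ pointsAtInfinity C := by
      rcases hξ with ⟨y, hy, hyx⟩ | ⟨y, hy, hyx⟩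
      · exact (Sum.inl_ne_inr hyx).elim
      · rwa [← Sum.inr_injective hyx]
    obtain ⟨ρ, hρ, hρC⟩ := hζ
    obtain ⟨hiso, σ, hσ, hσγ⟩ := γ.2
    obtain ⟨K, hK⟩ := Quotient.exact (hσ.trans hρ.symm)
    have hK0 : 0 ≤ K := dist_nonneg.trans (hK 0)
    rw [h.mem_timesIn] at ht ⊢
    refine ⟨trivial, ?_⟩
    have dγ : ∀ u v, dist (γ.1 u) (γ.1 v) = |u - v| := fun u v => by
      rw [hiso.dist_eq, Real.dist_eq]
    rw [← hcl.closure_eq, Metric.mem_closure_iff]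
    intro η hη
    -- The segments from `γ t` to `ρ m` lie in `C` by convexity, and as `m` grows they converge to
    -- `γ` before time `t`, since `γ (-m)` and `ρ m` remain at distance at most `K`. So `γ u` lies
    -- in the closure of `C`.
    have hlim : Tendsto (fun m : ℝ => 2 * Real.exp (t - u - (t + m + (t + m - K)) / 2) *
        Real.sinh (K / 2)) atTop (𝓝 (2 * 0 * Real.sinh (K / 2))) := by
      refine ((Real.tendsto_exp_atBot.comp ?_).const_mul 2).mul_const _
      have : (fun m : ℝ => t - u - (t + m + (t + m - K)) / 2) = fun m => (-u + K / 2) + -m := by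
        ext m; ring
      rw [this]
      exact tendsto_atBot_add_const_left _ _ tendsto_neg_atTop_atBot
    rw [mul_zero, zero_mul] at hlim
    obtain ⟨m, hm1, hm2, hm3⟩ := ((hlim.eventually (gt_mem_nhds hη)).and
      ((eventually_ge_atTop 0).and (eventually_ge_atTop (K - u + |t|)))).exists
    have hm0 : (m.toNNReal : ℝ) = m := Real.coe_toNNReal _ hm2
    have hend : dist (γ.1 (-m)) (ρ.1 m.toNNReal) ≤ K := by
      have := hK m.toNNReal
      rwa [hσγ, hm0] at this
    obtain ⟨g, g0, g1, hg⟩ := hgeod.exists_segment (γ.1 t) (ρ.1 m.toNNReal)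
    have hf : GeodOn (fun v => γ.1 (t - v)) 0 (t + m) := fun v _ w _ => by
      rw [dγ, abs_sub_comm]; ring_nf
    have habs := abs_nonneg t
    have hq : t + m - K ≤ dist (γ.1 t) (ρ.1 m.toNNReal) := by
      have h1 := dist_triangle (γ.1 t) (ρ.1 m.toNNReal) (γ.1 (-m))
      rw [dγ, dist_comm (ρ.1 m.toNNReal)] at h1
      have := le_abs_self (t - -m)
      linarith
    have key := hcat.fan_dist_le hf hg (t := t - u) (by simp only [sub_zero]; rw [g0])
      (by linarith) (by linarith) (by linarith)
    simp only [sub_sub_cancel] at key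
    rw [g1, show t - (t + m) = -m by ring] at key
    refine ⟨g (t - u), hC _ ht.2 _ (hρC m.toNNReal) _ ?_, ?_⟩
    · have := hg.onSegment (u := t - u) ⟨by linarith, by linarith⟩
      rwa [g0, g1] at this
    · refine lt_of_le_of_lt (key.trans ?_) hm1
      have s1 : Real.sinh (dist (γ.1 (-m)) (ρ.1 m.toNNReal) / 2) ≤ Real.sinh (K / 2) :=
        Real.sinh_le_sinh.2 (by linarith)
      have s2 : 0 ≤ Real.sinh (dist (γ.1 (-m)) (ρ.1 m.toNNReal) / 2) :=
        Real.sinh_nonneg_iff.2 (by positivity)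
      refine mul_le_mul ?_ s1 s2 (by positivity)
      have := Real.exp_le_exp.2 (by linarith : t - u - (t + m + dist (γ.1 t) (ρ.1 m.toNNReal)) / 2
        ≤ t - u - (t + m + (t + m - K)) / 2)
      linarith

/-- A geodesic starting from a point outside `C ∪ ∂_∞ C` and meeting `C` enters `C`. -/
theorem IsNormalized.exists_entersAt {γ : GeodesicsFrom ξ} (h : IsNormalized base γ) {C : Set X}
    (hcl : IsClosed C) (hC : IsGeodConvex C) (hξ : ξ ∉ withBoundary C)
    (hne : (timesIn γ C).Nonempty) : ∃ s, EntersAt γ C s := by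
  suffices hb : BddBelow (timesIn γ C) from
    ⟨_, (h.isClosed_timesIn hcl).isLeast_csInf hne hb⟩
  cases ξ with
  | inl x =>
    refine ⟨0, fun t ht => ?_⟩
    rw [h.mem_timesIn] at ht
    exact ht.1
  | inr ζ =>
    by_contra hb
    refine hξ (Or.inr ⟨ζ, ?_, rfl⟩)
    obtain ⟨t, ht⟩ := hne
    -- If the times in `C` were unbounded below, a whole backward ray would lie in `C` and `ξ` would
    -- be a point at infinity of `C`.
    have hall : ∀ u ≤ t, γ.1 u ∈ C := fun u hu => by
      rw [not_bddBelow_iff] at hb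
      obtain ⟨v, hv, hvu⟩ := hb u
      exact ((h.ordConnected hC).out hv ht ⟨hvu.le, hu⟩).2
    obtain ⟨γ', hγ'⟩ := exists_shift γ t
    obtain ⟨-, ρ, hρ, hργ⟩ := γ'.2
    refine ⟨ρ, hρ, fun u => ?_⟩
    rw [hργ, hγ']
    exact hall _ (by linarith [u.2])

end

section
variable {X : Type*} [MetricSpace X] {ξ : X ⊕ BoundaryAtInfinity X} {base : ℝ → X}

/-! ### Stability of penetration and closeness of entrance points -/

/-- Geodesics close to a geodesic which remains in `C` between times `s` and `e` remain in `C`,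
except close to the extremities. -/
def IsPenetrationStable (ξ : X ⊕ BoundaryAtInfinity X) (base : ℝ → X) (Λ a b B : ℝ)
    (C : Set X) : Prop :=
  ∀ γ γ' : GeodesicsFrom ξ, IsNormalized base γ → IsNormalized base γ' →
    ∀ s ∈ timesIn γ C, ∀ e ∈ timesIn γ C, Λ ≤ e - s → ∀ T, CloseUpTo B γ.1 γ'.1 T →
      ∀ t, s + a ≤ t → t + b ≤ e → t + b ≤ T → t ∈ timesIn γ' C

/-- Geodesics penetrating in `C` for a time at least `H` are close to each other at a time close to
their entrance times. -/
def HasCloseEntries (ξ : X ⊕ BoundaryAtInfinity X) (base : ℝ → X) (H a u B : ℝ)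
    (C : Set X) : Prop :=
  ∀ γ γ' : GeodesicsFrom ξ, IsNormalized base γ → IsNormalized base γ' → ∀ s s',
    EntersAt γ C s → EntersAt γ' C s' → Icc s (s + H) ⊆ timesIn γ C →
    Icc s' (s' + H) ⊆ timesIn γ' C → ξ ∉ withBoundary C →
    ∃ T, T ≤ s + a ∧ T ≤ s' + a ∧ s ≤ T + u ∧ s' ≤ T + u ∧ CloseUpTo B γ.1 γ'.1 T

theorem HasCloseEntries.of_le {H a u B : ℝ} {C : Set X}
    (h : ∀ γ γ' : GeodesicsFrom ξ, IsNormalized base γ → IsNormalized base γ' → ∀ s s', s ≤ s' →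
      EntersAt γ C s → EntersAt γ' C s' → Icc s (s + H) ⊆ timesIn γ C →
      Icc s' (s' + H) ⊆ timesIn γ' C → ξ ∉ withBoundary C →
      ∃ T, T ≤ s + a ∧ s' ≤ T + u ∧ CloseUpTo B γ.1 γ'.1 T) :
    HasCloseEntries ξ base H a u B C := by
  intro γ γ' hγ hγ' s s' hs hs' hI hI' hξ
  rcases le_total s s' with hss | hss
  · obtain ⟨T, h1, h2, h3⟩ := h γ γ' hγ hγ' s s' hss hs hs' hI hI' hξ
    exact ⟨T, h1, by linarith, by linarith, h2, h3⟩
  · obtain ⟨T, h1, h2, h3⟩ := h γ' γ hγ' hγ s' s hss hs' hs hI' hI hξ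
    exact ⟨T, by linarith, h1, h2, by linarith, h3.symm⟩

theorem log_eight_ge_one : (1 : ℝ) ≤ Real.log 8 := by
  rw [Real.le_log_iff_exp_le (by norm_num)]
  linarith [Real.exp_one_lt_d9]

theorem log_div_ge_log {r c : ℝ} (hr : 0 < r) (hr1 : r ≤ 1) (hc : 0 < c) :
    Real.log c ≤ Real.log (c / r) :=
  Real.log_le_log hc (by rw [le_div_iff₀ hr]; nlinarith)

theorem exp_neg_le_of_log_le {c x : ℝ} (hc : 0 < c) (h : Real.log c ≤ x) :
    Real.exp (-x) ≤ c⁻¹ := by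
  rw [Real.exp_neg]
  exact inv_anti₀ hc ((Real.log_le_iff_le_exp hc).1 h)

/-- The margins share the thickness `r` equally: distance `log 8` to both ends gives `Φ (γ t) ≤
2r(1/8 + 1/8) = r/2`, and distance `log (8/r)` to `T` gives `d(γ t, γ' t) ≤ 4 · r/8 = r/2`. -/
theorem IsThickConvex.isPenetrationStable {r : ℝ} (hr : 0 < r) (hr1 : r ≤ 1) {C : Set X}
    (hC : IsThickConvex r C) (Λ : ℝ) :
    IsPenetrationStable ξ base Λ (Real.log 8) (Real.log (8 / r)) 4 C := by
  intro γ γ' hγ hγ' s hs e he _ T hclose t hst hte htT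
  obtain ⟨Φ, h1, rfl, h2, h3⟩ := hC
  rw [hγ.mem_timesIn] at hs he
  have l8 := log_eight_ge_one
  have l8r := log_div_ge_log hr hr1 (by norm_num : (0:ℝ) < 8)
  have htD := startDomain_upper hs.1 (by linarith : s ≤ t)
  rw [hγ'.mem_timesIn]
  refine ⟨htD, ?_⟩
  have g := hγ.geodOn hs.1 e
  have d1 := g.dist_eq le_rfl (by linarith : s ≤ t) (by linarith)
  have d2 := g.dist_eq (by linarith : s ≤ t) (by linarith : t ≤ e) le_rfl
  have k := h3 _ _ _ (g.onSegment (u := t) ⟨by linarith, by linarith⟩) hs.2 he.2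
    (by rw [d1]; linarith) (by rw [d2]; linarith)
  rw [d1, d2] at k
  have e1 := exp_neg_le_of_log_le (by norm_num : (0:ℝ) < 8) (by linarith : Real.log 8 ≤ t - s)
  have e2 := exp_neg_le_of_log_le (by norm_num : (0:ℝ) < 8) (by linarith : Real.log 8 ≤ e - t)
  have e3 := exp_neg_le_of_log_le (by positivity : 0 < 8 / r) (by linarith :
    Real.log (8 / r) ≤ T - t)
  rw [neg_sub, inv_div] at e3
  have k2 := hclose t (by linarith)
  have k3 := h1 (γ'.1 t) (γ.1 t)
  rw [dist_comm] at k3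
  change Φ (γ'.1 t) ≤ r
  nlinarith

/-! ### The general case -/

/-- The interior points of the triangle with a vertex at the origin of two synchronized geodesics. -/
theorem Synced.exists_onSegment_dist_le (hgeod : IsGeodesicSpace X) (hcat : IsCATNegOne X)
    {D : Set ℝ} {f g : ℝ → X} (h : Synced D f g) {τ τ' c t : ℝ}
    (hc : 2 * c = τ + τ' - dist (f τ) (g τ')) (hcD : c ∈ D)
    (hcg : Real.cosh (dist (f c) (g c)) ≤ 2) (hτ : c ≤ τ) (hτ' : c ≤ τ') (hct : c ≤ t)
    (ht : t ≤ τ) :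
    ∃ P, OnSegment (f τ) (g τ') P ∧ dist (f t) P ≤ 5 / 2 * Real.exp (-(t - c)) := by
  obtain ⟨k, k0, k1, hk⟩ := hgeod.exists_segment (f τ) (g τ')
  set N := dist (f τ) (g τ') with hN
  rcases eq_or_lt_of_le (dist_nonneg (x := f τ) (y := g τ')) with h0 | hpos
  · have : t = τ := by linarith
    refine ⟨f τ, by simp [OnSegment], ?_⟩
    rw [this, dist_self]; positivity
  rw [← hN] at hpos
  have hgf := h.geod_left c hcD τ
  have hgg := h.geod_right c hcD τ'
  have hα : 0 ≤ τ - c := by linarith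
  have hαN : τ - c ≤ N := by linarith
  have hP := hk.onSegment (u := τ - c) ⟨hα, hαN⟩
  have st := hcat.stewart (f c) _ _ _ hP
  have ef := hgf.dist_eq le_rfl hτ le_rfl
  have eg := hgg.dist_eq le_rfl hτ' le_rfl
  rw [k0, k1] at st
  have e1 := hk.dist_eq le_rfl hα hαN
  have e2 := hk.dist_eq hα hαN le_rfl
  rw [k0] at e1
  rw [k1] at e2
  rw [e1, e2, ef, ← hN, sub_zero] at st
  have hβ : N - (τ - c) = τ' - c := by linarith
  rw [hβ] at st
  have hd : dist (f c) (g τ') ≤ (τ' - c) + dist (f c) (g c) := by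
    have := dist_triangle (f c) (g c) (g τ')
    linarith
  have c1 := (Real.cosh_le_cosh_of_le dist_nonneg hd).trans (Real.cosh_add_le_exp_mul dist_nonneg)
  have c2 : Real.exp (dist (f c) (g c)) ≤ 4 := by
    have := Real.cosh_eq (dist (f c) (g c))
    have := Real.exp_pos (-dist (f c) (g c))
    linarith
  have sα : 0 ≤ Real.sinh (τ - c) := Real.sinh_nonneg_iff.2 hα
  have sβ : 0 ≤ Real.sinh (τ' - c) := Real.sinh_nonneg_iff.2 (by linarith)
  have cα := Real.cosh_pos (τ - c)
  have cβ := Real.cosh_pos (τ' - c)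
  have hsum : Real.sinh N = Real.sinh (τ' - c) * Real.cosh (τ - c) +
      Real.cosh (τ' - c) * Real.sinh (τ - c) := by
    rw [← Real.sinh_add]; congr 1; linarith
  -- The point `k (τ - c)` is where the inscribed circle of the triangle would touch the third side.
  -- Stewart with apex `f c` bounds its distance to `f c`: the factor `4` comes from `e^d ≤ 2 cosh d
  -- ≤ 4`.
  have c3 : Real.cosh (dist (f c) (k (τ - c))) ≤ 4 := by
    refine le_of_mul_le_mul_left ?_ (Real.sinh_pos_iff.2 hpos)
    have i1 := c1.trans (mul_le_mul_of_nonneg_right c2 cβ.le)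
    have i2 := mul_le_mul_of_nonneg_left i1 sα
    nlinarith [mul_nonneg sβ cα.le]
  have hf' := hgf.reverse τ
  rw [sub_self] at hf'
  have key := hcat.fan hf' (hk.mono le_rfl hαN) (t := τ - t) (by simp only [sub_zero]; rw [k0])
    (by linarith) (by linarith) (by linarith)
  simp only [sub_sub_cancel] at key
  refine ⟨k (τ - t), ?_, ?_⟩
  · have := hk.onSegment (u := τ - t) ⟨by linarith, by linarith⟩
    rwa [k0, k1] at this
  · have i1 := Real.sq_le_two_mul_cosh_sub_one (dist (f t) (k (τ - t)))
    refine le_of_sq_le_sq ?_ (by positivity)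
    have e : Real.exp (2 * (τ - t) - (τ - c) - (τ - c)) = Real.exp (-(t - c)) ^ 2 := by
      rw [← Real.exp_nat_mul]; congr 1; push_cast; ring
    rw [e] at key
    have i2 := mul_le_mul_of_nonneg_left (by linarith : Real.cosh (dist (f c) (k (τ - c))) - 1 ≤ 3)
      (sq_nonneg (Real.exp (-(t - c))))
    nlinarith [sq_nonneg (Real.exp (-(t - c)))]

/-- For geodesics issued from a point, `c` is a Gromov product based at this point, hence
nonnegative. -/
theorem IsNormalized.half_sub_mem {γ γ' : GeodesicsFrom ξ} (hγ : IsNormalized base γ)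
    (hγ' : IsNormalized base γ') {τ τ' c : ℝ} (hτ : τ ∈ startDomain ξ) (hτ' : τ' ∈ startDomain ξ)
    (hc : 2 * c = τ + τ' - dist (γ.1 τ) (γ'.1 τ')) : c ∈ startDomain ξ := by
  cases ξ with
  | inl x =>
    have h1 : IsRayFrom x 0 γ.1 := hγ
    have h2 : IsRayFrom x 0 γ'.1 := hγ'
    have e1 := h1.2 τ hτ 0 self_mem_Ici
    have e2 := h2.2 0 self_mem_Ici τ' hτ'
    have p1 : (0:ℝ) ≤ τ := hτ
    have p2 : (0:ℝ) ≤ τ' := hτ'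
    rw [h1.1 0 le_rfl, sub_zero, abs_of_nonneg p1] at e1
    rw [h2.1 0 le_rfl, zero_sub, abs_neg, abs_of_nonneg p2] at e2
    have := dist_triangle (γ.1 τ) x (γ'.1 τ')
    change (0:ℝ) ≤ c
    linarith
  | inr ζ => trivial

/-- Let `τ`, `τ'` be the midpoints of the guaranteed stays in `C` and let `c` be the Gromov product
of the corresponding points, the time at which the geodesics separate. They are close up to `c`;
shortly after `c` each one follows the segment joining two deep points, hence is in `C`, so both
entrance times are at most `c + log (4/r)`. -/
theorem IsThickConvex.hasCloseEntries (hgeod : IsGeodesicSpace X) (hcat : IsCATNegOne X)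
    {r : ℝ} (hr : 0 < r) (hr1 : r ≤ 1) {C : Set X} (hC : IsThickConvex r C) {H : ℝ} (hH : 6 ≤ H)
    (hH' : Real.log 8 + Real.log (8 / r) ≤ H) :
    HasCloseEntries ξ base H (Real.log 8 + Real.log (8 / r)) (Real.log (4 / r)) (3 / 2) C := by
  refine HasCloseEntries.of_le ?_
  intro γ γ' hγ hγ' s s' hss hs hs' hI hI' _
  have l8 := log_eight_ge_one
  have l8r := log_div_ge_log hr hr1 (by norm_num : (0:ℝ) < 8)
  have l4r : 0 ≤ Real.log (4 / r) :=
    (Real.log_nonneg (by norm_num)).trans (log_div_ge_log hr hr1 (by norm_num : (0:ℝ) < 4))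
  have hstab := hC.isPenetrationStable (ξ := ξ) (base := base) hr hr1 H
  obtain ⟨Φ, h1, rfl, h2, h3⟩ := hC
  -- As `H ≥ 6`, the midpoint is at distance at least `3` from both ends and `e^{-3} ≤ 1/16`, which
  -- gives the depth `4r/16 = r/4`.
  have hdeep : ∀ δ : GeodesicsFrom ξ, IsNormalized base δ → ∀ σ,
      Icc σ (σ + H) ⊆ timesIn δ {x | Φ x ≤ r} → Φ (δ.1 (σ + H / 2)) ≤ r / 4 := by
    intro δ hδ σ hσ
    have m1 := hδ.mem_timesIn.1 (hσ (show σ ∈ Icc σ (σ + H) from ⟨le_rfl, by linarith⟩))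
    have m2 := hδ.mem_timesIn.1 (hσ (show σ + H ∈ Icc σ (σ + H) from ⟨by linarith, le_rfl⟩))
    have g := hδ.geodOn m1.1 (σ + H)
    have d1 := g.dist_eq le_rfl (by linarith : σ ≤ σ + H / 2) (by linarith)
    have d2 := g.dist_eq (by linarith : σ ≤ σ + H / 2) (by linarith : σ + H / 2 ≤ σ + H) le_rfl
    have k := h3 _ _ _ (g.onSegment (u := σ + H / 2) ⟨by linarith, by linarith⟩) m1.2 m2.2
      (by rw [d1]; linarith) (by rw [d2]; linarith)
    have e1 : σ + H / 2 - σ = H / 2 := by ring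
    have e2 : σ + H - (σ + H / 2) = H / 2 := by ring
    rw [d1, d2, e1, e2] at k
    have : Real.exp (-(H / 2)) ≤ (16 : ℝ)⁻¹ := by
      rw [Real.exp_neg]
      refine inv_anti₀ (by norm_num) ?_
      have a1 : Real.exp 3 ≤ Real.exp (H / 2) := Real.exp_le_exp.2 (by linarith)
      have a2 : Real.exp 3 = Real.exp 1 ^ 3 := by rw [← Real.exp_nat_mul]; norm_num
      have a3 : (2.7 : ℝ) ^ 3 ≤ Real.exp 1 ^ 3 :=
        pow_le_pow_left₀ (by norm_num) (by linarith [Real.exp_one_gt_d9]) 3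
      norm_num at a3
      linarith
    nlinarith
  have sD : s ∈ startDomain ξ := (hγ.mem_timesIn.1 hs.1).1
  have sD' : s' ∈ startDomain ξ := (hγ'.mem_timesIn.1 hs'.1).1
  set τ := s + H / 2 with hτ
  set τ' := s' + H / 2 with hτ'
  have τD := startDomain_upper sD (by linarith : s ≤ τ)
  have τD' := startDomain_upper sD' (by linarith : s' ≤ τ')
  have dm := hdeep γ hγ s hI
  have dm' := hdeep γ' hγ' s' hI'
  set N := dist (γ.1 τ) (γ'.1 τ') with hN
  obtain ⟨c, hc⟩ : ∃ c, 2 * c = τ + τ' - N := ⟨(τ + τ' - N) / 2, by ring⟩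
  have hsync := hγ.synced hγ'
  have cD := hγ.half_sub_mem hγ' τD τD' hc
  have habs := hsync.abs_sub_le_dist sD (by linarith : s ≤ τ) (by linarith : s ≤ τ')
  rw [← hN, abs_le] at habs
  have cτ : c ≤ τ := by linarith [habs.2]
  have cτ' : c ≤ τ' := by linarith [habs.1]
  have hcosh : Real.cosh (dist (γ.1 c) (γ'.1 c)) ≤ 2 := by
    have k := hsync.cosh_le hcat cD cτ cτ'
    have e : 2 * c - τ - τ' = -N := by linarith
    rw [e, ← hN] at k
    have i1 : Real.exp (-N) * Real.cosh N ≤ 1 := by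
      have j1 : Real.exp (-N) * Real.exp N = 1 := by rw [← Real.exp_add]; simp
      have j2 : Real.exp (-N) ≤ Real.exp N := Real.exp_le_exp.2 (by linarith [habs.1, habs.2])
      rw [Real.cosh_eq]
      nlinarith [Real.exp_pos (-N)]
    have i2 := Real.cosh_pos (τ - τ')
    nlinarith [Real.exp_pos (-N), mul_pos (Real.exp_pos (-N)) i2]
  have hclose : CloseUpTo (3 / 2) γ.1 γ'.1 c :=
    hsync.closeUpTo hcat (by norm_num) (by norm_num; linarith)
  -- At time `c + log (4/r)` the geodesic is within `5/2 · r/4` of a segment on which `Φ ≤ r/4`, and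
  -- `5r/8 + r/4 ≤ r`.
  have hentry : ∀ δ δ' : GeodesicsFrom ξ, IsNormalized base δ → IsNormalized base δ' → ∀ σ τ τ',
      EntersAt δ {x | Φ x ≤ r} σ → σ ≤ τ → Φ (δ.1 τ) ≤ r / 4 → Φ (δ'.1 τ') ≤ r / 4 →
      2 * c = τ + τ' - dist (δ.1 τ) (δ'.1 τ') → Real.cosh (dist (δ.1 c) (δ'.1 c)) ≤ 2 →
      c ≤ τ → c ≤ τ' → σ ≤ c + Real.log (4 / r) := by
    intro δ δ' hδ hδ' σ τ τ' hσ hστ k1 k2 hcc kc kτ kτ'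
    by_contra! hlt
    obtain ⟨P, hP, hd⟩ := (hδ.synced hδ').exists_onSegment_dist_le hgeod hcat hcc cD kc kτ kτ'
      (t := c + Real.log (4 / r)) (by linarith) (by linarith)
    have e1 : c + Real.log (4 / r) - c = Real.log (4 / r) := by ring
    have e2 := exp_neg_le_of_log_le (by positivity : 0 < 4 / r) le_rfl
    rw [e1] at hd
    rw [inv_div] at e2
    have hmem : c + Real.log (4 / r) ∈ timesIn δ {x | Φ x ≤ r} := by
      rw [hδ.mem_timesIn]
      refine ⟨startDomain_upper cD (by linarith), ?_⟩
      have j1 := (h2 _ _ _ hP).trans (max_le k1 k2)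
      have j2 := h1 (δ.1 (c + Real.log (4 / r))) P
      change Φ _ ≤ r
      nlinarith
    have := hσ.2 hmem
    linarith
  have hent := hentry γ γ' hγ hγ' s τ τ' hs (by linarith) dm dm' hc hcosh cτ cτ'
  have hent' := hentry γ' γ hγ' hγ s' τ' τ hs' (by linarith) dm' dm
    (by rw [dist_comm, ← hN]; linarith) (by rwa [dist_comm]) cτ' cτ
  -- If the geodesics separate much later than `s`, the later geodesic `γ'` is already in `C` at
  -- time `s + log 8` by stability, so a smaller time can be used in place of `c`.
  by_cases hcase : c ≤ s + (Real.log 8 + Real.log (8 / r))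
  · exact ⟨c, hcase, hent', hclose⟩
  · push Not at hcase
    refine ⟨s + (Real.log 8 + Real.log (8 / r)), le_rfl, ?_, hclose.of_le (by norm_num) hcase.le⟩
    have := hstab γ γ' hγ hγ' s hs.1 (s + H) (hI ⟨by linarith, le_rfl⟩) (by linarith) c
      (hclose.mono (by norm_num)) (s + Real.log 8) le_rfl (by linarith) (by linarith)
    have := hs'.2 this
    linarith

/-! ### The case of horoballs -/

/-- Let `M` be the midpoint of `f p` and `g p`, and `G` the hyperbolic cosine of half their
distance. Relative to these points, `M` gains `log G` in distance towards the common origin and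
again `log G` in depth in the horoball. Hence `b` near the origin, at time `t`, is at most `s - t -
2 log G`. As `g` stays in the horoball for a time `H`, it is also at least `s - t - log (1 +
e^{-H})`. -/
theorem Synced.cosh_sq_le_of_horoFunction (hgeod : IsGeodesicSpace X) (hcat : IsCATNegOne X)
    {D : Set ℝ} {f g : ℝ → X} (h : Synced D f g) {b : X → ℝ} (hb : IsHoroFunction b)
    {p s H : ℝ} (hH : 0 < H) (hpD : p ∈ D) (hps : p ≤ s) (hfp : b (f p) ≤ 0) (hgs : b (g s) = 0)
    (hgH : b (g (s + H)) ≤ 0) :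
    Real.cosh (dist (f p) (g p) / 2) ^ 2 ≤ 1 + Real.exp (-H) := by
  by_contra! hG
  obtain ⟨M, hM, hMe⟩ := exists_midpoint_onSegment hgeod (f p) (g p)
  set N := dist (f p) (g p) with hN
  set G := Real.cosh (N / 2) with hGdef
  set ω := Real.exp (-H) with hω
  have hωpos : 0 < ω := Real.exp_pos _
  have hxM : dist (f p) M = N / 2 := by unfold OnSegment at hM; linarith
  obtain ⟨δ, hδ1, hδ2, hδ3⟩ : ∃ δ : ℝ, Real.exp (2 * δ) < 1 + ω ∧ (1 + ω) * Real.exp δ < G ^ 2 ∧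
      0 < δ := by
    have l1 : Tendsto (fun δ : ℝ => Real.exp (2 * δ)) (𝓝[>] 0) (𝓝 (Real.exp (2 * 0))) :=
      (Continuous.tendsto (by fun_prop) 0).mono_left nhdsWithin_le_nhds
    have l2 : Tendsto (fun δ : ℝ => (1 + ω) * Real.exp δ) (𝓝[>] 0) (𝓝 ((1 + ω) * Real.exp 0)) :=
      (Continuous.tendsto (by fun_prop) 0).mono_left nhdsWithin_le_nhds
    rw [mul_zero, Real.exp_zero] at l1
    rw [Real.exp_zero, mul_one] at l2
    exact ((l1.eventually (gt_mem_nhds (by linarith))).and ((l2.eventually (gt_mem_nhds hG)).and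
      self_mem_nhdsWithin)).exists
  obtain ⟨t, htD, htp, hft⟩ := h.approx p hpD δ hδ3
  have ef := (h.geod_left t htD p).dist_eq le_rfl htp le_rfl
  have gg := h.geod_right t htD (s + H)
  have eg := gg.dist_eq le_rfl htp (by linarith)
  have eox : dist (g t) (f p) ≤ (p - t) + δ := by
    have := dist_triangle (g t) (f t) (f p)
    rw [dist_comm (g t) (f t)] at this
    linarith
  set d := dist (g t) M with hd
  have hGpos : 0 < G := Real.cosh_pos _
  have hEpos := Real.exp_pos δ
  have hcd : G * Real.cosh d ≤ Real.exp δ * Real.cosh (p - t) := by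
    have k := hcat.stewart_midpoint (g t) hM hMe
    rw [hxM, eg] at k
    have k2 := (Real.cosh_le_cosh_of_le dist_nonneg eox).trans (Real.cosh_add_le_exp_mul hδ3.le)
    have k3 : 1 ≤ Real.exp δ := Real.one_le_exp hδ3.le
    nlinarith [Real.cosh_pos (p - t)]
  -- The choice of `δ` ensures `e^{2δ} < G²`; this is what lets the inequality for `cosh` pass to
  -- `sinh` after subtracting `1` from the squares.
  have hsd : G * Real.sinh d ≤ Real.exp δ * Real.sinh (p - t) := by
    have n1 : 0 ≤ Real.sinh (p - t) := Real.sinh_nonneg_iff.2 (by linarith)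
    refine le_of_sq_le_sq ?_ (by positivity)
    have e1 : Real.exp (2 * δ) = Real.exp δ ^ 2 := by rw [← Real.exp_nat_mul]; norm_num
    have c1 := Real.cosh_sq d
    have c2 := Real.cosh_sq (p - t)
    have c3 := pow_le_pow_left₀ (mul_nonneg hGpos.le (Real.cosh_pos d).le) hcd 2
    rw [mul_pow, mul_pow] at c3 ⊢
    rw [c1, c2] at c3
    nlinarith
  have hexp : G * Real.exp d ≤ Real.exp δ * Real.exp (p - t) := by
    rw [← Real.cosh_add_sinh d, ← Real.cosh_add_sinh (p - t)]
    linarith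
  have hNpos : 0 < N := by
    rcases eq_or_lt_of_le (dist_nonneg (x := f p) (y := g p)) with h0 | h0
    · exfalso
      have : G = 1 := by rw [hGdef, hN, ← h0]; simp
      rw [this] at hG
      linarith
    · exact h0
  have hbM : 2 * G * Real.exp (b M) ≤ Real.exp (b (f p)) + Real.exp (b (g p)) := by
    have k := hb.2 _ _ _ hM
    have e : N = 2 * (N / 2) := by ring
    rw [← hMe, hxM, ← hN, e, Real.sinh_two_mul, ← e] at k
    refine le_of_mul_le_mul_left ?_ (Real.sinh_pos_iff.2 (by linarith : 0 < N / 2))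
    linarith
  have hx1 : Real.exp (b (f p)) ≤ Real.exp (s - p) := Real.exp_le_exp.2 (by linarith)
  have hy1 : Real.exp (b (g p)) ≤ Real.exp (s - p) := by
    have k := hb.1 (g p) (g s)
    rw [gg.dist_eq htp hps (by linarith), hgs] at k
    exact Real.exp_le_exp.2 (by linarith)
  -- Convexity of `e^b` on `[t, s + H]`, with value `1` at `s` and at most `1` at `s + H`, forces
  -- `e^b` to be almost `e^{s - t}` at time `t`.
  have hlow : Real.exp (s - t) ≤ (1 + ω) * Real.exp (b (g t)) := by
    have k := hb.2 _ _ _ (gg.onSegment (u := s) ⟨by linarith, by linarith⟩)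
    rw [gg.dist_eq le_rfl (by linarith : t ≤ s) (by linarith),
      gg.dist_eq (by linarith : t ≤ s) (by linarith : s ≤ s + H) le_rfl,
      gg.dist_eq le_rfl (by linarith : t ≤ s + H) le_rfl, hgs, Real.exp_zero, mul_one,
      add_sub_cancel_left] at k
    have hsH : 0 < Real.sinh H := Real.sinh_pos_iff.2 hH
    have sst : 0 ≤ Real.sinh (s - t) := Real.sinh_nonneg_iff.2 (by linarith)
    have e1 := Real.exp_le_one_iff.2 hgH
    have k2 : Real.sinh (s + H - t) - Real.sinh (s - t) ≤ Real.sinh H * Real.exp (b (g t)) := by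
      nlinarith
    have k3 : Real.sinh H * Real.exp (s - t) ≤
        (1 + ω) * (Real.sinh (s + H - t) - Real.sinh (s - t)) := by
      have i1 : Real.exp H * ω = 1 := by rw [hω, ← Real.exp_add]; simp
      have i2 : Real.exp (s + H - t) = Real.exp H * Real.exp (s - t) := by
        rw [← Real.exp_add]; ring_nf
      have i3 : Real.exp (-(s + H - t)) = ω * Real.exp (-(s - t)) := by
        rw [hω, ← Real.exp_add]; ring_nf
      rw [Real.sinh_eq, Real.sinh_eq, Real.sinh_eq, i2, i3, ← hω]
      have i4 : ω ≤ 1 := Real.exp_le_one_iff.2 (by linarith)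
      have i5 := Real.exp_pos (-(s - t))
      have : (1 + ω) * ((Real.exp H * Real.exp (s - t) - ω * Real.exp (-(s - t))) / 2 -
          (Real.exp (s - t) - Real.exp (-(s - t))) / 2) - (Real.exp H - ω) / 2 * Real.exp (s - t)
          = (Real.exp H * ω - 1) * Real.exp (s - t) / 2 +
            (1 + ω) * (1 - ω) * Real.exp (-(s - t)) / 2 := by ring
      rw [i1, sub_self, zero_mul, zero_div, zero_add] at this
      have i6 : 0 ≤ (1 + ω) * (1 - ω) * Real.exp (-(s - t)) / 2 := by
        have : 0 ≤ 1 - ω := by linarith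
        positivity
      linarith
    refine le_of_mul_le_mul_left ?_ hsH
    have := mul_le_mul_of_nonneg_left k2 (by linarith : 0 ≤ 1 + ω)
    linarith
  have hLip : Real.exp (b (g t)) ≤ Real.exp (b M) * Real.exp d := by
    rw [← Real.exp_add]; exact Real.exp_le_exp.2 (hb.1 _ _)
  have hsplit : Real.exp (s - t) = Real.exp (s - p) * Real.exp (p - t) := by
    rw [← Real.exp_add]; ring_nf
  have hfinal : G ^ 2 * Real.exp (s - t) ≤ (1 + ω) * Real.exp δ * Real.exp (s - t) := by
    have j1 : G * Real.exp (s - t) ≤ (1 + ω) * (Real.exp (b M) * (Real.exp δ *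
        Real.exp (p - t))) := by
      have a1 := mul_le_mul_of_nonneg_left hlow hGpos.le
      have a2 := mul_le_mul_of_nonneg_left hLip (by positivity : 0 ≤ G * (1 + ω))
      have a3 := mul_le_mul_of_nonneg_left hexp (by positivity : 0 ≤ (1 + ω) * Real.exp (b M))
      linarith
    have j2 : G * Real.exp (b M) ≤ Real.exp (s - p) := by linarith
    have a4 := mul_le_mul_of_nonneg_left j1 hGpos.le
    have a5 := mul_le_mul_of_nonneg_left j2
      (by positivity : 0 ≤ (1 + ω) * (Real.exp δ * Real.exp (p - t)))
    rw [hsplit] at a4 ⊢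
    linarith
  have := le_of_mul_le_mul_right hfinal (Real.exp_pos _)
  linarith

/-- Both exponentials `P`, `R` are at most `e^{-1/6}` and their product is at most `e^{-4}`, so
their sum is largest at an end of the allowed interval, where it is at most `0.87`. This gives depth
`0.13`, exactly the allowed distance between the geodesics. -/
theorem IsHoroFunction.isPenetrationStable {b : X → ℝ} (hb : IsHoroFunction b) :
    IsPenetrationStable ξ base 4 (1 / 6) (1 / 6) (13 / 100) {x | b x ≤ 0} := by
  intro γ γ' hγ hγ' s hs e he hse T hclose t hst hte htT
  rw [hγ.mem_timesIn] at hs he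
  rw [hγ'.mem_timesIn]
  refine ⟨startDomain_upper hs.1 (by linarith), ?_⟩
  have g := hγ.geodOn hs.1 e
  have d1 := g.dist_eq le_rfl (by linarith : s ≤ t) (by linarith)
  have d2 := g.dist_eq (by linarith : s ≤ t) (by linarith : t ≤ e) le_rfl
  have d3 := g.dist_eq le_rfl (by linarith : s ≤ e) le_rfl
  have k := hb.exp_le (g.onSegment (u := t) ⟨by linarith, by linarith⟩) hs.2 he.2
    (by rw [d3]; linarith)
  rw [d1, d2] at k
  set P := Real.exp (-(t - s)) with hP
  set R := Real.exp (-(e - t)) with hR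
  set Q := Real.exp (-(1 / 6)) with hQ
  have hPQ : P ≤ Q := Real.exp_le_exp.2 (by linarith)
  have hRQ : R ≤ Q := Real.exp_le_exp.2 (by linarith)
  have hPR : P * R ≤ Real.exp (-4) := by
    rw [hP, hR, ← Real.exp_add]; exact Real.exp_le_exp.2 (by linarith)
  have h4 : Real.exp (-4) ≤ 1 / 53 := by
    rw [Real.exp_neg, ← one_div]
    refine one_div_le_one_div_of_le (by norm_num) ?_
    have a2 : Real.exp 4 = Real.exp 1 ^ 4 := by rw [← Real.exp_nat_mul]; norm_num
    have a3 : (2.7 : ℝ) ^ 4 ≤ Real.exp 1 ^ 4 :=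
      pow_le_pow_left₀ (by norm_num) (by linarith [Real.exp_one_gt_d9]) 4
    norm_num at a3
    linarith
  have hQ1 : Q ≤ 72 / 85 := by
    rw [hQ, Real.exp_neg]
    have := Real.quadratic_le_exp_of_nonneg (by norm_num : (0:ℝ) ≤ 1 / 6)
    refine (inv_anti₀ (by norm_num) this).trans ?_
    norm_num
  have hQ2 : 5 / 6 ≤ Q := by
    have := Real.add_one_le_exp (-(1 / 6) : ℝ)
    linarith
  have hsum : P + R ≤ 87 / 100 := by
    have h5 : (Q - P) * (Q - R) ≥ 0 := mul_nonneg (by linarith) (by linarith)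
    have h6 : (P + R) * Q ≤ Q ^ 2 + 1 / 53 := by nlinarith
    nlinarith
  have h13 : (87 / 100 : ℝ) ≤ Real.exp (-(13 / 100)) := by
    have := Real.add_one_le_exp (-(13 / 100) : ℝ)
    linarith
  have hbt : b (γ.1 t) ≤ -(13 / 100) := Real.exp_le_exp.1 (by linarith)
  have k2 := hclose t (by linarith)
  have k3 := hb.1 (γ'.1 t) (γ.1 t)
  rw [dist_comm] at k3
  have k4 : Real.exp (t - T) ≤ 1 := Real.exp_le_one_iff.2 (by linarith)
  change b (γ'.1 t) ≤ 0
  linarith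

theorem EntersAt.exists_sub_mem {γ : GeodesicsFrom ξ} (hγ : IsNormalized base γ) {C : Set X}
    {s : ℝ} (hs : EntersAt γ C s) (hξ : ξ ∉ withBoundary C) :
    ∃ η > 0, s - η ∈ startDomain ξ := by
  have hsm := hγ.mem_timesIn.1 hs.1
  cases ξ with
  | inl x =>
    have h1 : IsRayFrom x 0 γ.1 := hγ
    refine ⟨s, lt_of_le_of_ne hsm.1 ?_, by rw [sub_self]; exact self_mem_Ici⟩
    rintro rfl
    refine hξ (Or.inl ⟨x, ?_, rfl⟩)
    have := hsm.2
    rwa [h1.1 0 le_rfl] at this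
  | inr ζ => exact ⟨1, one_pos, trivial⟩

/-- At `p = min s' (s + H)` the midpoint estimate gives `4 sinh² (d/2) ≤ 4/285 ≤ (3/25)²`. Stability
puts `γ'` in the horoball at time `p - 1/6` if `p ≥ s + 1/3`, before it enters; so `p < s + 1/3`,
which forces `p = s'`. -/
theorem IsHoroFunction.hasCloseEntries (hgeod : IsGeodesicSpace X) (hcat : IsCATNegOne X)
    {b : X → ℝ} (hb : IsHoroFunction b) {H : ℝ} (hH : 57 / 10 ≤ H) :
    HasCloseEntries ξ base H (1 / 6 + 1 / 6) 0 (3 / 25) {x | b x ≤ 0} := by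
  refine HasCloseEntries.of_le ?_
  intro γ γ' hγ hγ' s s' hss hs hs' hI hI' hξ
  have hsync := hγ.synced hγ'
  have hsD := (hγ.mem_timesIn.1 hs.1).1
  have hsD' := hγ'.mem_timesIn.1 hs'.1
  have hbs : b (γ'.1 s') = 0 := by
    refine le_antisymm hsD'.2 ?_
    by_contra! hlt
    obtain ⟨η, hη, hηD⟩ := hs'.exists_sub_mem hγ' hξ
    set m := min η (-b (γ'.1 s')) with hm
    have hm0 : 0 < m := lt_min hη (by linarith)
    have hm1 : m ≤ η := min_le_left _ _
    have hm2 : m ≤ -b (γ'.1 s') := min_le_right _ _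
    have hmD : s' - m ∈ startDomain ξ := startDomain_upper hηD (by linarith)
    have hmem : s' - m ∈ timesIn γ' {x | b x ≤ 0} := by
      rw [hγ'.mem_timesIn]
      refine ⟨hmD, ?_⟩
      have k := hb.1 (γ'.1 (s' - m)) (γ'.1 s')
      rw [(hγ'.geodOn hmD s').dist_eq le_rfl (by linarith) le_rfl] at k
      change b (γ'.1 (s' - m)) ≤ 0
      linarith
    have := hs'.2 hmem
    linarith
  obtain ⟨p, hp⟩ : ∃ p, p = min s' (s + H) := ⟨_, rfl⟩
  have hp1 : p ≤ s' := by rw [hp]; exact min_le_left _ _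
  have hp2 : p ≤ s + H := by rw [hp]; exact min_le_right _ _
  have hp3 : s ≤ p := by rw [hp]; exact le_min hss (by linarith)
  have key := hsync.cosh_sq_le_of_horoFunction hgeod hcat hb (by linarith : 0 < H)
    (startDomain_upper hsD hp3) hp1 (hγ.mem_timesIn.1 (hI ⟨hp3, hp2⟩)).2 hbs
    (hγ'.mem_timesIn.1 (hI' ⟨by linarith, le_rfl⟩)).2
  have hclose : CloseUpTo (3 / 25) γ.1 γ'.1 p := by
    refine hsync.closeUpTo hcat (by norm_num) ?_
    rw [Real.cosh_sub_one]
    have c1 := Real.cosh_sq (dist (γ.1 p) (γ'.1 p) / 2)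
    have c2 : Real.exp (-H) ≤ 1 / 285 := by
      rw [Real.exp_neg, ← one_div]
      refine one_div_le_one_div_of_le (by norm_num) ?_
      have a1 : Real.exp (57 / 10) ≤ Real.exp H := Real.exp_le_exp.2 hH
      have a2 : Real.exp (57 / 10) = Real.exp 1 ^ 5 * Real.exp (7 / 10) := by
        rw [← Real.exp_nat_mul, ← Real.exp_add]; norm_num
      have a3 : (2.718 : ℝ) ^ 5 ≤ Real.exp 1 ^ 5 :=
        pow_le_pow_left₀ (by norm_num) (by linarith [Real.exp_one_gt_d9]) 5
      have a4 := Real.quadratic_le_exp_of_nonneg (by norm_num : (0:ℝ) ≤ 7 / 10)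
      have a5 := mul_le_mul a3 a4 (by norm_num) (by positivity)
      rw [← a2] at a5
      have a6 : (285 : ℝ) ≤ 2.718 ^ 5 * (1 + 7 / 10 + (7 / 10) ^ 2 / 2) := by norm_num
      linarith
    linarith
  have hps : p < s + (1 / 6 + 1 / 6) := by
    by_contra! hlt
    have := hb.isPenetrationStable (ξ := ξ) (base := base) γ γ' hγ hγ' s hs.1 (s + H)
      (hI ⟨by linarith, le_rfl⟩) (by linarith) p (hclose.mono (by norm_num)) (p - 1 / 6)
      (by linarith) (by linarith) (by linarith)
    have := hs'.2 this
    linarith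
  have hpe : p = s' := by
    rcases min_choice s' (s + H) with h | h
    · rw [hp, h]
    · rw [h] at hp; linarith
  exact ⟨p, hps.le, by linarith, hclose⟩

end

section
variable {X : Type*} [MetricSpace X] {ξ : X ⊕ BoundaryAtInfinity X} {base : ℝ → X}

/-! ### Limits of normalized geodesics -/

theorem IsNormalized.dist_le {γ : GeodesicsFrom ξ} (h : IsNormalized base γ) (s t : ℝ) :
    dist (γ.1 s) (γ.1 t) ≤ |s - t| := by
  cases ξ with
  | inl x =>
    have h1 : IsRayFrom x 0 γ.1 := h
    have hmax : ∀ u, γ.1 u = γ.1 (max u 0) := fun u => by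
      rcases le_total u 0 with hu | hu
      · rw [max_eq_right hu, h1.1 u hu, h1.1 0 le_rfl]
      · rw [max_eq_left hu]
    rw [hmax s, hmax t, h1.2 _ (le_max_right s 0) _ (le_max_right t 0)]
    exact abs_max_sub_max_le_abs s t 0
  | inr ζ => rw [γ.2.1.dist_eq, Real.dist_eq]

/-- At a fixed time the sequence is Cauchy with rate `B e^{t - T k}`. This rate is uniform on
compact sets, and for lines the comparison with one `γ j` preserves both the origin at infinity and
the normalization. -/
theorem exists_normalized_limit [CompleteSpace X] {γ : ℕ → GeodesicsFrom ξ} {T : ℕ → ℝ} {B : ℝ}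
    (hB : 0 ≤ B) (hγ : ∀ k, IsNormalized base (γ k)) (hT : Tendsto T atTop atTop)
    (hclose : ∀ j k, j ≤ k → CloseUpTo B (γ j).1 (γ k).1 (T j)) :
    ∃ γ' : GeodesicsFrom ξ, IsNormalized base γ' ∧ (∀ j, CloseUpTo B (γ j).1 γ'.1 (T j)) ∧
      Tendsto γ atTop (𝓝 γ') := by
  have hexp : ∀ t, Tendsto (fun k => B * Real.exp (t - T k)) atTop (𝓝 0) := fun t => by
    have : Tendsto (fun k => t - T k) atTop atBot :=
      tendsto_atBot_add_const_left _ _ (tendsto_neg_atTop_atBot.comp hT)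
    simpa using (Real.tendsto_exp_atBot.comp this).const_mul B
  have hcauchy : ∀ t, ∃ p, Tendsto (fun k => (γ k).1 t) atTop (𝓝 p) := fun t => by
    refine cauchySeq_tendsto_of_complete (Metric.cauchySeq_iff'.2 fun ε hε => ?_)
    obtain ⟨N, h1, h2⟩ := (((hexp t).eventually (gt_mem_nhds hε)).and
      (hT.eventually_ge_atTop t)).exists
    refine ⟨N, fun k hk => ?_⟩
    rw [dist_comm]
    exact (hclose N k hk t h2).trans_lt h1
  choose f hf using hcauchy
  have hfclose : ∀ j, CloseUpTo B (γ j).1 f (T j) := fun j t ht => by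
    refine le_of_tendsto (tendsto_const_nhds.dist (hf t)) ?_
    filter_upwards [eventually_ge_atTop j] with k hk using hclose j k hk t ht
  have hdist : ∀ s t, Tendsto (fun k => dist ((γ k).1 s) ((γ k).1 t)) atTop
      (𝓝 (dist (f s) (f t))) := fun s t => (hf s).dist (hf t)
  have hfcont : Continuous f := by
    have : LipschitzWith 1 f := LipschitzWith.of_dist_le_mul fun s t => by
      rw [NNReal.coe_one, one_mul]
      exact le_of_tendsto' (hdist s t) fun k => (hγ k).dist_le s t
    exact this.continuous
  have hfgeod : ∀ s ∈ startDomain ξ, ∀ t ∈ startDomain ξ, dist (f s) (f t) = |s - t| := by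
    intro s hs t ht
    refine tendsto_nhds_unique (hdist s t) (tendsto_const_nhds.congr fun k => ?_)
    rcases le_total s t with hst | hst
    · exact ((hγ k).geodOn hs t s ⟨le_rfl, hst⟩ t ⟨hst, le_rfl⟩).symm
    · exact ((hγ k).geodOn ht s s ⟨hst, le_rfl⟩ t ⟨le_rfl, hst⟩).symm
  have hstart : StartsFrom ξ f ∧ ∀ hs : StartsFrom ξ f,
      IsNormalized base (⟨⟨f, hfcont⟩, hs⟩ : GeodesicsFrom ξ) := by
    cases ξ with
    | inl x =>
      have : IsRayFrom x 0 f := by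
        refine ⟨fun t ht => ?_, hfgeod⟩
        refine tendsto_nhds_unique (hf t) (tendsto_const_nhds.congr fun k => ?_)
        have h1 : IsRayFrom x 0 (γ k).1 := hγ k
        exact (h1.1 t ht).symm
      exact ⟨⟨0, this⟩, fun _ => this⟩
    | inr ζ =>
      have hiso : Isometry f := Isometry.of_dist_eq fun s t => by
        rw [hfgeod s trivial t trivial, Real.dist_eq]
      refine ⟨⟨hiso, ⟨fun t : ℝ≥0 => f (-(t : ℝ)), ?_⟩, ?_, fun t => rfl⟩, fun _ => ?_⟩
      · refine Isometry.of_dist_eq fun u v => ?_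
        rw [hiso.dist_eq, Real.dist_eq, NNReal.dist_eq, abs_sub_comm]
        ring_nf
      · obtain ⟨h1, ρ, hρ, hρ2⟩ := (γ 0).2
        refine Eq.trans (Quotient.sound ⟨2 * |T 0| + B, fun t => ?_⟩) hρ
        rw [hρ2]
        change dist (f (-(t : ℝ))) _ ≤ _
        set v := -(t : ℝ) with hv
        have hv0 : v ≤ 0 := by rw [hv]; linarith [t.2]
        set w := min v (T 0) with hw
        have hw1 : w ≤ v := min_le_left _ _
        have hvw : |v - w| ≤ |T 0| := by
          rw [abs_of_nonneg (by linarith)]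
          rcases min_choice v (T 0) with h | h
          · rw [hw, h, sub_self]; exact abs_nonneg _
          · rw [hw, h]; linarith [neg_abs_le (T 0)]
        have c1 := hfclose 0 w (min_le_right _ _)
        have c2 : Real.exp (w - T 0) ≤ 1 :=
          Real.exp_le_one_iff.2 (by linarith [min_le_right v (T 0)])
        have c3 := (hiso.dist_eq v w).trans (Real.dist_eq v w)
        have c4 := (h1.dist_eq v w).trans (Real.dist_eq v w)
        have t1 := dist_triangle (f v) (f w) ((γ 0).1 v)
        have t2 := dist_triangle (f w) ((γ 0).1 w) ((γ 0).1 v)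
        rw [dist_comm (f w) ((γ 0).1 w), dist_comm ((γ 0).1 w) ((γ 0).1 v)] at t2
        nlinarith
      · change Tendsto (fun t => dist (f t) (base t)) atBot (𝓝 0)
        have h0 : Tendsto (fun t => dist ((γ 0).1 t) (base t)) atBot (𝓝 0) := hγ 0
        have h1 : Tendsto (fun t => B * Real.exp (t - T 0)) atBot (𝓝 (B * 0)) :=
          (Real.tendsto_exp_atBot.comp
            (tendsto_atBot_add_const_right _ _ tendsto_id)).const_mul B
        have h2 := h1.add h0
        rw [mul_zero, add_zero] at h2
        refine squeeze_zero' (Eventually.of_forall fun _ => dist_nonneg) ?_ h2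
        filter_upwards [eventually_le_atBot (T 0)] with t ht
        have c1 := hfclose 0 t ht
        have t1 := dist_triangle (f t) ((γ 0).1 t) (base t)
        rw [dist_comm (f t) ((γ 0).1 t)] at t1
        linarith
  refine ⟨⟨⟨f, hfcont⟩, hstart.1⟩, hstart.2 _, hfclose, ?_⟩
  rw [tendsto_subtype_rng, ContinuousMap.tendsto_iff_forall_isCompact_tendstoUniformlyOn]
  intro K hK
  rw [Metric.tendstoUniformlyOn_iff]
  intro ε hε
  obtain ⟨M, hM⟩ := hK.bddAbove
  filter_upwards [(hexp M).eventually (gt_mem_nhds hε), hT.eventually_ge_atTop M] with k h1 h2 t ht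
  have htM := hM ht
  rw [dist_comm]
  refine (hfclose k t (by linarith)).trans_lt (lt_of_le_of_lt ?_ h1)
  exact mul_le_mul_of_nonneg_left (Real.exp_le_exp.2 (by linarith)) hB

/-! ### The inductive construction -/

variable {C : ℕ → Set X} {f₀ : GeodesicsFrom ξ → ℝ≥0∞} {h h₀' δ₀ Λ a b u g B₀ B K : ℝ}

/-- The hypotheses on the family of convex subsets and on the constants used in the inductive
construction. -/
structure PrescriptionSetup (ξ : X ⊕ BoundaryAtInfinity X) (base : ℝ → X) (C : ℕ → Set X)
    (f₀ : GeodesicsFrom ξ → ℝ≥0∞) (h h₀' δ₀ Λ a b u g B₀ B K : ℝ) : Prop where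
  closed : ∀ n, IsClosed (C n)
  convex : ∀ n, IsGeodConvex (C n)
  stable : ∀ n, IsPenetrationStable ξ base Λ a b B (C n)
  entries : ∀ n, HasCloseEntries ξ base h₀' (a + b) u B₀ (C n)
  disj : AlmostDisjoint C δ₀
  pres : LocalPrescription C f₀ h h₀'
  shift : IsShiftInvariant f₀
  start : ξ ∉ withBoundary (C 0)
  length_zero : ∀ γ, f₀ γ = ENNReal.ofReal h → ENNReal.ofReal Λ ≤ penetrationLength (C 0) γ
  hδ₀ : 0 ≤ δ₀
  ha : 0 ≤ a
  hb : 0 ≤ b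
  hu : 0 ≤ u
  hg : 0 < g
  hB : B₀ + B * Real.exp (-g) ≤ B
  hB' : 0 ≤ B
  hΛ : Λ ≤ h₀'
  hgap : δ₀ + u + a + b + g ≤ Λ
  hΛ' : 2 * δ₀ + u + b < Λ
  hK : a + 2 * b + u + δ₀ ≤ K

/-- A normalized geodesic entering `C n` at time `t`, with prescribed penetrations. -/
structure IsState (base : ℝ → X) (C : ℕ → Set X) (f₀ : GeodesicsFrom ξ → ℝ≥0∞) (h h₀' Λ : ℝ)
    (γ : GeodesicsFrom ξ) (n : ℕ) (t : ℝ) : Prop where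
  norm : IsNormalized base γ
  val : f₀ γ = ENNReal.ofReal h
  enters : EntersAt γ (C n) t
  long : t + Λ ∈ timesIn γ (C n)
  first : ∃ σ ≤ t, EntersAt γ (C 0) σ
  length_eq : n ≠ 0 → penetrationLength (C n) γ = ENNReal.ofReal h₀'

/-- The geodesic `γ` enters `C m` at time `s > t`, and penetrates too much in it. -/
def IsCandidate (C : ℕ → Set X) (h₀' : ℝ) (γ : GeodesicsFrom ξ) (t : ℝ) (m : ℕ) (s : ℝ) : Prop :=
  EntersAt γ (C m) s ∧ t < s ∧ ENNReal.ofReal h₀' < penetrationLength (C m) γ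

/-- The geodesic `γ'` is obtained from `γ` by correcting its first excessive penetration after
time `t`. -/
def IsCorrection (C : ℕ → Set X) (h₀' a b u B₀ : ℝ) (γ : GeodesicsFrom ξ) (t : ℝ)
    (γ' : GeodesicsFrom ξ) (n' : ℕ) (t' T : ℝ) : Prop :=
  ∃ s, IsCandidate C h₀' γ t n' s ∧ (∀ m' s', IsCandidate C h₀' γ t m' s' → s ≤ s') ∧
    T ≤ s + (a + b) ∧ T ≤ t' + (a + b) ∧ s ≤ T + u ∧ t' ≤ T + u ∧ CloseUpTo B₀ γ.1 γ'.1 T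

/-! ### A single correction, and the penetration bound for the limit. -/

namespace PrescriptionSetup

/-- The common time interval is mapped isometrically into `C n ∩ C m`, whose diameter is at most
`δ₀`. -/
theorem overlap_le (P : PrescriptionSetup ξ base C f₀ h h₀' δ₀ Λ a b u g B₀ B K)
    {γ : GeodesicsFrom ξ} (hγ : IsNormalized base γ) {m n : ℕ} (hmn : m ≠ n)
    {v w v' w' : ℝ} (hv : v ∈ timesIn γ (C m)) (hw : w ∈ timesIn γ (C m))
    (hv' : v' ∈ timesIn γ (C n)) (hw' : w' ∈ timesIn γ (C n)) :
    min w w' ≤ max v v' + δ₀ := by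
  by_contra! hlt
  have hδ := P.hδ₀
  have hle : max v v' ≤ min w w' := by linarith
  have i1 : max v v' ∈ timesIn γ (C m) := (hγ.ordConnected (P.convex m)).out hv hw
    ⟨le_max_left _ _, hle.trans (min_le_left _ _)⟩
  have i2 : min w w' ∈ timesIn γ (C m) := (hγ.ordConnected (P.convex m)).out hv hw
    ⟨(le_max_left _ _).trans hle, min_le_left _ _⟩
  have i3 : max v v' ∈ timesIn γ (C n) := (hγ.ordConnected (P.convex n)).out hv' hw'
    ⟨le_max_right _ _, hle.trans (min_le_right _ _)⟩
  have i4 : min w w' ∈ timesIn γ (C n) := (hγ.ordConnected (P.convex n)).out hv' hw'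
    ⟨(le_max_right _ _).trans hle, min_le_right _ _⟩
  have k := (Metric.edist_le_ediam_of_mem (show γ.1 (max v v') ∈ C n ∩ C m from ⟨i3.2, i1.2⟩)
    (show γ.1 (min w w') ∈ C n ∩ C m from ⟨i4.2, i2.2⟩)).trans (P.disj m n hmn)
  rw [edist_dist] at k
  have k2 := (ENNReal.ofReal_le_ofReal_iff hδ).1 k
  rw [(hγ.geodOn (hγ.mem_timesIn.1 i1).1 _).dist_eq le_rfl hle le_rfl] at k2
  linarith

/-- Penetration longer than `h₀'` and overlaps at most `δ₀` separate the entrance times of distinct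
candidates by at least `h₀' - δ₀ > 0`, so their infimum is attained. -/
theorem exists_first_candidate (P : PrescriptionSetup ξ base C f₀ h h₀' δ₀ Λ a b u g B₀ B K)
    {γ : GeodesicsFrom ξ} (hγ : IsNormalized base γ) {t : ℝ}
    (hc : ∃ m s, IsCandidate C h₀' γ t m s) :
    ∃ m s, IsCandidate C h₀' γ t m s ∧ ∀ m' s', IsCandidate C h₀' γ t m' s' → s ≤ s' := by
  obtain ⟨m₀, s₀, h₀⟩ := hc
  set S : Set ℝ := {s | ∃ m, IsCandidate C h₀' γ t m s} with hS
  have hbdd : BddBelow S := ⟨t, fun s ⟨m, hm⟩ => hm.2.1.le⟩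
  have hne : S.Nonempty := ⟨s₀, m₀, h₀⟩
  have := P.hgap; have := P.hΛ; have := P.hδ₀; have := P.ha; have := P.hb; have := P.hu
  have := P.hg
  obtain ⟨s, ⟨m, hm⟩, hs⟩ := exists_lt_of_csInf_lt hne (show sInf S < sInf S + (h₀' - δ₀) by
    linarith)
  refine ⟨m, s, hm, fun m' s' hm' => ?_⟩
  by_contra! hlt
  have hinf := csInf_le hbdd ⟨m', hm'⟩
  have hmm : m ≠ m' := fun he => by
    subst he
    have := hm.1.2 hm'.1.1
    linarith
  obtain ⟨e, he, hse⟩ := exists_mem_gt_of_lt_volume hm.1 hm.2.2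
  obtain ⟨e', he', hse'⟩ := exists_mem_gt_of_lt_volume hm'.1 hm'.2.2
  have k := P.overlap_le hγ hmm hm.1.1 he hm'.1.1 he'
  rw [max_eq_left hlt.le] at k
  rcases min_choice e e' with h | h <;> rw [h] at k <;> linarith

theorem exists_correction (P : PrescriptionSetup ξ base C f₀ h h₀' δ₀ Λ a b u g B₀ B K)
    (hgeod : IsGeodesicSpace X) (hcat : IsCATNegOne X)
    {γ₀ : GeodesicsFrom ξ} (hbase : base = γ₀.1) {γ : GeodesicsFrom ξ} {n : ℕ} {t : ℝ}
    (hst : IsState base C f₀ h h₀' Λ γ n t) (hc : ∃ m s, IsCandidate C h₀' γ t m s) :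
    ∃ γ' n' t' T, IsState base C f₀ h h₀' Λ γ' n' t' ∧
      IsCorrection C h₀' a b u B₀ γ t γ' n' t' T := by
  obtain ⟨m, s, hm, hmin⟩ := P.exists_first_candidate hst.norm hc
  obtain ⟨σ, hσt, hσ⟩ := hst.first
  have := P.hgap; have hΛ := P.hΛ; have := P.hδ₀; have := P.ha; have := P.hb; have := P.hu
  have := P.hg
  have htD := (hst.norm.mem_timesIn.1 hst.enters.1).1
  -- Otherwise the geodesic would be in `C m` already at time `t`, before its entrance time.
  have hξ : ξ ∉ withBoundary (C m) := fun hξ => by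
    have := hm.1.2 (hst.norm.mem_of_withBoundary hgeod hcat (P.closed m) (P.convex m) hξ hm.1.1
      hm.2.1.le htD)
    linarith [hm.2.1]
  have hm0 : m ≠ 0 := by
    rintro rfl
    have := hm.1.2 hσ.1
    linarith [hm.2.1]
  obtain ⟨α, ⟨σ', τ, hα1, hα2, hα3⟩, hαh, hαl⟩ := P.pres m hm0 hξ
    ⟨γ, ⟨σ, s, hσ, hm.1, hσt.trans_lt hm.2.1⟩, hst.val, hm.2.2.le⟩
  obtain ⟨γ', c, hγ', hγα⟩ := exists_normalized_shift hgeod hcat γ₀ α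
  rw [← hbase] at hγ'
  have hl := penetrationLength_shift hγα (C m)
  rw [hαl] at hl
  have henter := entersAt_shift hγα hα2
  have hI' : Icc (τ - c) (τ - c + h₀') ⊆ timesIn γ' (C m) :=
    Icc_subset_of_le_volume (hγ'.ordConnected (P.convex m)) (hγ'.isClosed_timesIn (P.closed m))
      henter hl.ge
  have hI : Icc s (s + h₀') ⊆ timesIn γ (C m) :=
    Icc_subset_of_le_volume (hst.norm.ordConnected (P.convex m))
      (hst.norm.isClosed_timesIn (P.closed m)) hm.1 hm.2.2.le
  obtain ⟨T, hT⟩ := P.entries m γ γ' hst.norm hγ' s (τ - c) hm.1 henter hI hI' hξ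
  refine ⟨γ', m, τ - c, T, ⟨hγ', ?_, henter, hI' ⟨by linarith, by linarith⟩, ⟨σ' - c, by linarith,
    entersAt_shift hγα hα1⟩, fun _ => hl⟩, s, hm, hmin, hT⟩
  rw [P.shift α γ' c hγα, hαh]

/-- The geodesic is in `C n` during `[t, t + Λ]`, so a new long penetration can overlap only the
last `δ₀` of this interval. -/
theorem add_le_of_isCandidate (P : PrescriptionSetup ξ base C f₀ h h₀' δ₀ Λ a b u g B₀ B K)
    {γ : GeodesicsFrom ξ} {n : ℕ} {t : ℝ}
    (hst : IsState base C f₀ h h₀' Λ γ n t) {m : ℕ} {s : ℝ} (hm : IsCandidate C h₀' γ t m s) :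
    t + Λ ≤ s + δ₀ := by
  have := P.hgap; have hΛ := P.hΛ; have := P.hδ₀; have := P.ha; have := P.hb; have := P.hu
  have := P.hg
  have hmn : n ≠ m := fun he => by
    subst he
    have := hm.1.2 hst.enters.1
    linarith [hm.2.1]
  obtain ⟨e, he, hse⟩ := exists_mem_gt_of_lt_volume hm.1 hm.2.2
  have k := P.overlap_le hst.norm hmn hst.enters.1 hst.long hm.1.1 he
  rw [max_eq_right hm.2.1.le] at k
  rcases min_choice (t + Λ) e with h | h <;> rw [h] at k <;> linarith

theorem le_of_isCorrection (P : PrescriptionSetup ξ base C f₀ h h₀' δ₀ Λ a b u g B₀ B K)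
    {γ : GeodesicsFrom ξ} {n : ℕ} {t : ℝ}
    (hst : IsState base C f₀ h h₀' Λ γ n t) {γ' : GeodesicsFrom ξ} {n' : ℕ} {t' T : ℝ}
    (hm : IsCorrection C h₀' a b u B₀ γ t γ' n' t' T) : t + Λ - δ₀ - u ≤ T := by
  obtain ⟨s, h1, -, -, -, h2, -⟩ := hm
  have := P.add_le_of_isCandidate hst h1
  linarith

/-- The set is not the current `C n`, where the penetration is exactly `h₀'`; and it is not entered
before `t`, as it would then overlap the stay of length `Λ` in `C n` for longer than `δ₀`. -/
theorem exists_isCandidate (P : PrescriptionSetup ξ base C f₀ h h₀' δ₀ Λ a b u g B₀ B K)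
    {γ : GeodesicsFrom ξ} {n : ℕ} {t : ℝ}
    (hst : IsState base C f₀ h h₀' Λ γ n t) {m : ℕ} (hm : m ≠ 0) {v w : ℝ}
    (hv : v ∈ timesIn γ (C m)) (hw : w ∈ timesIn γ (C m)) (htv : t ≤ v) (hvw : h₀' < w - v) :
    ∃ s ≤ v, IsCandidate C h₀' γ t m s := by
  have := P.hgap; have hΛ := P.hΛ; have := P.hδ₀; have := P.ha; have := P.hb; have := P.hu
  have := P.hg
  have hlen : ∀ s ∈ timesIn γ (C m), s ≤ v → ENNReal.ofReal h₀' < penetrationLength (C m) γ := by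
    intro s hs hsv
    refine lt_of_lt_of_le ?_ (ofReal_sub_le_volume (hst.norm.ordConnected (P.convex m)) hs hw)
    rw [ENNReal.ofReal_lt_ofReal_iff (by linarith)]
    linarith
  have hmn : n ≠ m := by
    rintro rfl
    exact (hlen v hv le_rfl).ne (hst.length_eq hm).symm
  have hbelow : ∀ x ∈ timesIn γ (C m), t < x := fun x hx => by
    by_contra! hxt
    have k := P.overlap_le hst.norm hmn hst.enters.1 hst.long hx hw
    rw [max_eq_left hxt] at k
    rcases min_choice (t + Λ) w with h | h <;> rw [h] at k <;> linarith
  have hleast := (hst.norm.isClosed_timesIn (P.closed m)).isLeast_csInf ⟨v, hv⟩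
    ⟨t, fun x hx => (hbelow x hx).le⟩
  exact ⟨_, hleast.2 hv, hleast, hbelow _ hleast.1, hlen _ hleast.1 (hleast.2 hv)⟩

/-- The main estimate: the limit geodesic does not penetrate too much in any of the subsets. -/
theorem sub_le_of_mem (P : PrescriptionSetup ξ base C f₀ h h₀' δ₀ Λ a b u g B₀ B K)
    {γ : ℕ → GeodesicsFrom ξ} {n : ℕ → ℕ} {t T : ℕ → ℝ} {γ' : GeodesicsFrom ξ}
    (hγ' : IsNormalized base γ') (hst : ∀ k, IsState base C f₀ h h₀' Λ (γ k) (n k) (t k))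
    (hn0 : n 0 = 0)
    (hstep : ∀ k, (IsCorrection C h₀' a b u B₀ (γ k) (t k) (γ (k + 1)) (n (k + 1)) (t (k + 1)) (T k)
        ∧ CloseUpTo B (γ k).1 γ'.1 (T k)) ∨
      ((¬ ∃ m s, IsCandidate C h₀' (γ k) (t k) m s) ∧ γ k = γ'))
    {σ : ℝ} (hσ : EntersAt γ' (C 0) σ) (hσΛ : σ + Λ ∈ timesIn γ' (C 0)) {m : ℕ} (hm : m ≠ 0)
    {s e : ℝ} (hs : s ∈ timesIn γ' (C m)) (he : e ∈ timesIn γ' (C m)) (hσs : σ ≤ s) :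
    e - s ≤ h₀' + K := by
  by_contra! hlt
  have := P.hgap; have hΛ := P.hΛ; have := P.hδ₀; have ha := P.ha; have hb := P.hb; have := P.hu
  have := P.hg; have hK := P.hK; have hΛ' := P.hΛ'
  have hcl : ∀ k, ∃ T', t k + Λ - δ₀ - u ≤ T' ∧ CloseUpTo B (γ k).1 γ'.1 T' := fun k => by
    rcases hstep k with ⟨h1, h2⟩ | ⟨-, h2⟩
    · exact ⟨T k, P.le_of_isCorrection (hst k) h1, h2⟩
    · refine ⟨_, le_rfl, fun x hx => ?_⟩
      rw [h2, dist_self]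
      exact mul_nonneg P.hB' (Real.exp_pos _).le
  have hse : Λ ≤ e - s := by linarith
  -- The limit enters `C 0` at `σ ≤ s`; by stability `γ 0` is in `C 0` at time `σ + a`, unless the
  -- two geodesics stop being close before that, in which case `t 0` is smaller still.
  have h0 : t 0 ≤ s + a := by
    obtain ⟨T', h1, h2⟩ := hcl 0
    by_cases hc : σ + a + b ≤ T'
    · have k := P.stable 0 γ' (γ 0) hγ' (hst 0).norm σ hσ.1 _ hσΛ (by linarith) T' h2.symm (σ + a)
        le_rfl (by linarith) hc
      have k2 := (hst 0).enters
      rw [hn0] at k2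
      linarith [k2.2 k]
    · push Not at hc
      linarith
  have hind : ∀ k, t k ≤ s + a → (IsCorrection C h₀' a b u B₀ (γ k) (t k) (γ (k + 1)) (n (k + 1))
      (t (k + 1)) (T k)) ∧ t (k + 1) ≤ s + a := by
    intro k hk
    rcases hstep k with ⟨hcor, hclose⟩ | ⟨hno, heq⟩
    · refine ⟨hcor, ?_⟩
      by_contra! hafter
      obtain ⟨T', h1, h2⟩ := hcl (k + 1)
      have hst' := hst (k + 1)
      have m1 := P.stable m γ' _ hγ' hst'.norm s hs e he hse T' h2.symm (s + a)
        le_rfl (by linarith) (by linarith)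
      have hmn : m ≠ n (k + 1) := by
        rintro rfl
        linarith [hst'.enters.2 m1]
      -- The geodesic `γ (k + 1)` follows the limit inside `C m`, but from `t (k + 1)` on it is in
      -- another set for a time `Λ`; so the stay in `C m` must end soon after `t (k + 1)`.
      have heb : e ≤ t (k + 1) + δ₀ + b := by
        have m2 := P.stable m γ' _ hγ' hst'.norm s hs e he hse T' h2.symm (min e T' - b)
          (by
            have : s + a + b ≤ min e T' := le_min (by linarith) (by linarith)
            linarith) (by linarith [min_le_left e T']) (by linarith [min_le_right e T'])
        have k1 := P.overlap_le hst'.norm hmn m1 m2 hst'.enters.1 hst'.long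
        rw [max_eq_right hafter.le] at k1
        rcases min_choice (min e T' - b) (t (k + 1) + Λ) with h | h <;> rw [h] at k1
        · rcases min_choice e T' with h' | h' <;> rw [h'] at k1 <;> linarith
        · linarith
      -- Hence `γ k` is close to the limit nearly until `e`, and the choice of `K` leaves it more
      -- than `h₀'` in `C m`. So `C m` is a candidate for `γ k`, entered by time `s + a`, whereas
      -- the candidate chosen as first is entered within `a + b` of `T k`, near `e`.
      obtain ⟨s', hs', hmin, q1, q2, q3, q4, -⟩ := hcor
      have hTe : e - u - δ₀ - b ≤ min e (T k) := le_min (by linarith) (by linarith)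
      have m3 := P.stable m γ' _ hγ' (hst k).norm s hs e he hse (T k) hclose.symm (s + a)
        le_rfl (by linarith) (by linarith [min_le_right e (T k)])
      have m4 := P.stable m γ' _ hγ' (hst k).norm s hs e he hse (T k) hclose.symm
        (min e (T k) - b) (by linarith) (by linarith [min_le_left e (T k)])
        (by linarith [min_le_right e (T k)])
      obtain ⟨s'', hs'', hcand⟩ := P.exists_isCandidate (hst k) hm m3 m4 hk (by linarith)
      have hss := hmin _ _ hcand
      obtain ⟨e', he', hse'⟩ := exists_mem_gt_of_lt_volume hs'.1 hs'.2.2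
      have k2 := P.overlap_le (hst k).norm hmn hcand.1.1 m4 hs'.1.1 he'
      rw [max_eq_left hss] at k2
      rcases min_choice (min e (T k) - b) e' with h | h <;> rw [h] at k2 <;> linarith
    · exfalso
      have m1 : s + a ∈ timesIn (γ k) (C m) := by
        rw [heq]
        exact (hγ'.ordConnected (P.convex m)).out hs he ⟨by linarith, by linarith⟩
      obtain ⟨s', -, hs'⟩ := P.exists_isCandidate (hst k) hm m1 (by rwa [heq]) hk
        (by linarith : h₀' < e - (s + a))
      exact hno ⟨m, s', hs'⟩
  have hall : ∀ k, t k ≤ s + a := fun k => by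
    induction k with
    | zero => exact h0
    | succ k ih => exact (hind k ih).2
  -- All steps are corrections, so the times `t k` grow linearly although they are bounded by `s +
  -- a`.
  have hgrow : ∀ k : ℕ, t 1 + k * g ≤ t (k + 1) + (a + b) := fun k => by
    induction k with
    | zero => simp; linarith
    | succ k ih =>
      have c1 := P.le_of_isCorrection (hst (k + 1)) (hind (k + 1) (hall _)).1
      obtain ⟨s', -, -, -, q2, -⟩ := (hind (k + 1) (hall _)).1
      push_cast
      linarith
  obtain ⟨k, hk⟩ := exists_nat_gt ((s + a + (a + b) - t 1) / g)
  rw [div_lt_iff₀ P.hg] at hk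
  have := hgrow k
  have := hall (k + 1)
  linarith

end PrescriptionSetup

end

/-! ### Convergence of the corrections and conclusion for an abstract family. -/

section
variable {X : Type*} [MetricSpace X] {ξ : X ⊕ BoundaryAtInfinity X} {base : ℝ → X}
  {C : ℕ → Set X} {f₀ : GeodesicsFrom ξ → ℝ≥0∞} {h h₀' δ₀ Λ a b u g B₀ B K : ℝ}

/-- Successive exponentially close geodesics remain exponentially close. -/
theorem closeUpTo_of_chain {f : ℕ → ℝ → X} {T : ℕ → ℝ} {N : ℕ∞} (hB' : 0 ≤ B)
    (hB : B₀ + B * Real.exp (-g) ≤ B) (hg : 0 < g)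
    (hstep : ∀ i : ℕ, (i : ℕ∞) < N → CloseUpTo B₀ (f i) (f (i + 1)) (T i))
    (hT : ∀ i : ℕ, ((i + 1 : ℕ) : ℕ∞) < N → T i + g ≤ T (i + 1)) (m j : ℕ)
    (hjm : ((j + m : ℕ) : ℕ∞) ≤ N) : CloseUpTo B (f j) (f (j + m)) (T j) := by
  have hle : B₀ ≤ B := by
    have := mul_nonneg hB' (Real.exp_pos (-g)).le
    linarith
  induction m generalizing j with
  | zero => exact fun t _ => by rw [add_zero, dist_self]; positivity
  | succ m ih =>
    have hj : (j : ℕ∞) < N := lt_of_lt_of_le (by exact_mod_cast (by omega : j < j + (m + 1))) hjm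
    rcases Nat.eq_zero_or_pos m with rfl | hm
    · exact (hstep j hj).mono hle
    · intro t ht
      have hj' : ((j + 1 : ℕ) : ℕ∞) < N :=
        lt_of_lt_of_le (by exact_mod_cast (by omega : j + 1 < j + (m + 1))) hjm
      have hTj := hT j hj'
      have k1 := hstep j hj t ht
      have k2 := ih (j + 1) (by rwa [show j + 1 + m = j + (m + 1) by omega]) t (by linarith)
      rw [show j + 1 + m = j + (m + 1) by omega] at k2
      have k3 := dist_triangle (f j t) (f (j + 1) t) (f (j + (m + 1)) t)
      -- The tail is smaller by the factor `e^{-g}`, and `B₀ + B e^{-g} ≤ B` sums the geometric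
      -- series.
      have k4 : Real.exp (t - T (j + 1)) ≤ Real.exp (t - T j) * Real.exp (-g) := by
        rw [← Real.exp_add]; exact Real.exp_le_exp.2 (by linarith)
      have k5 := mul_le_mul_of_nonneg_left k4 hB'
      have k6 := mul_le_mul_of_nonneg_right hB (Real.exp_pos (t - T j)).le
      linarith

theorem PrescriptionSetup.exists_limit [CompleteSpace X] (hgeod : IsGeodesicSpace X)
    (hcat : IsCATNegOne X) (P : PrescriptionSetup ξ base C f₀ h h₀' δ₀ Λ a b u g B₀ B K)
    (hf₀ : Continuous f₀) {γ₀ : GeodesicsFrom ξ} (hbase : base = γ₀.1) {γ₁ : GeodesicsFrom ξ}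
    {t₁ : ℝ} (h₁ : IsState base C f₀ h h₀' Λ γ₁ 0 t₁) :
    ∃ (γ' : GeodesicsFrom ξ) (γ : ℕ → GeodesicsFrom ξ) (n : ℕ → ℕ) (t T : ℕ → ℝ),
      IsNormalized base γ' ∧ f₀ γ' = ENNReal.ofReal h ∧
      (∀ k, IsState base C f₀ h h₀' Λ (γ k) (n k) (t k)) ∧ n 0 = 0 ∧
      ∀ k, (IsCorrection C h₀' a b u B₀ (γ k) (t k) (γ (k + 1)) (n (k + 1)) (t (k + 1)) (T k)
        ∧ CloseUpTo B (γ k).1 γ'.1 (T k)) ∨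
      ((¬ ∃ m s, IsCandidate C h₀' (γ k) (t k) m s) ∧ γ k = γ') := by
  classical
  let St := {p : GeodesicsFrom ξ × ℕ × ℝ // IsState base C f₀ h h₀' Λ p.1 p.2.1 p.2.2}
  have hnext : ∀ p : St, ∃ q : St × ℝ,
      ((∃ m s, IsCandidate C h₀' p.1.1 p.1.2.2 m s) →
        IsCorrection C h₀' a b u B₀ p.1.1 p.1.2.2 q.1.1.1 q.1.1.2.1 q.1.1.2.2 q.2) ∧
      ((¬ ∃ m s, IsCandidate C h₀' p.1.1 p.1.2.2 m s) → q.1 = p) := fun p => by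
    by_cases hc : ∃ m s, IsCandidate C h₀' p.1.1 p.1.2.2 m s
    · obtain ⟨γ', n', t', T, hs, hcor⟩ := P.exists_correction hgeod hcat hbase p.2 hc
      exact ⟨(⟨(γ', n', t'), hs⟩, T), fun _ => hcor, fun h => (h hc).elim⟩
    · exact ⟨(p, 0), fun h => (hc h).elim, fun _ => rfl⟩
  choose F hF1 hF2 using hnext
  let S : ℕ → St := fun k => Nat.rec ⟨(γ₁, 0, t₁), h₁⟩ (fun _ p => (F p).1) k
  have hS : ∀ k, S (k + 1) = (F (S k)).1 := fun k => rfl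
  let T : ℕ → ℝ := fun k => (F (S k)).2
  have hcor : ∀ k, (∃ m s, IsCandidate C h₀' (S k).1.1 (S k).1.2.2 m s) →
      IsCorrection C h₀' a b u B₀ (S k).1.1 (S k).1.2.2 (S (k + 1)).1.1 (S (k + 1)).1.2.1
        (S (k + 1)).1.2.2 (T k) := fun k hk => hF1 (S k) hk
  have hfix : ∀ k, (¬ ∃ m s, IsCandidate C h₀' (S k).1.1 (S k).1.2.2 m s) →
      S (k + 1) = S k := fun k hk => hF2 (S k) hk
  have hgap : ∀ k, IsCorrection C h₀' a b u B₀ (S k).1.1 (S k).1.2.2 (S (k + 1)).1.1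
      (S (k + 1)).1.2.1 (S (k + 1)).1.2.2 (T k) →
      IsCorrection C h₀' a b u B₀ (S (k + 1)).1.1 (S (k + 1)).1.2.2 (S (k + 1 + 1)).1.1
        (S (k + 1 + 1)).1.2.1 (S (k + 1 + 1)).1.2.2 (T (k + 1)) → T k + g ≤ T (k + 1) := by
    intro k h1 h2
    have c1 := P.le_of_isCorrection (S (k + 1)).2 h2
    obtain ⟨s, -, -, -, q2, -⟩ := h1
    have := P.hgap
    linarith
  have hclose : ∀ k, IsCorrection C h₀' a b u B₀ (S k).1.1 (S k).1.2.2 (S (k + 1)).1.1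
      (S (k + 1)).1.2.1 (S (k + 1)).1.2.2 (T k) →
      CloseUpTo B₀ (S k).1.1.1 (S (k + 1)).1.1.1 (T k) := fun k ⟨_, _, _, _, _, _, _, hc⟩ => hc
  -- Either corrections go on forever and the `T k` tend to infinity, or the sequence is constant
  -- from the first geodesic `S N` without candidate, which then serves as the limit.
  by_cases hall : ∀ k, ∃ m s, IsCandidate C h₀' (S k).1.1 (S k).1.2.2 m s
  · have hgrow : ∀ k : ℕ, T 0 + k * g ≤ T k := fun k => by
      induction k with
      | zero => simp
      | succ k ih =>
        have := hgap k (hcor k (hall k)) (hcor (k + 1) (hall (k + 1)))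
        push_cast
        linarith
    have hT : Tendsto T atTop atTop :=
      tendsto_atTop_mono hgrow (tendsto_atTop_add_const_left _ _
        (tendsto_natCast_atTop_atTop.atTop_mul_const P.hg))
    obtain ⟨γ', hn, hcl, hlim⟩ := exists_normalized_limit (γ := fun k => (S k).1.1) (T := T) P.hB'
      (fun k => (S k).2.norm) hT (fun j k hjk => by
        obtain ⟨m, rfl⟩ := Nat.exists_eq_add_of_le hjk
        exact closeUpTo_of_chain (N := ⊤) (f := fun k => (S k).1.1.1) P.hB' P.hB P.hg
          (fun i _ => hclose i (hcor i (hall i)))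
          (fun i _ => hgap i (hcor i (hall i)) (hcor (i + 1) (hall (i + 1)))) m j le_top)
    refine ⟨γ', fun k => (S k).1.1, fun k => (S k).1.2.1, fun k => (S k).1.2.2, T, hn, ?_,
      fun k => (S k).2, rfl, fun k => Or.inl ⟨hcor k (hall k), hcl k⟩⟩
    refine tendsto_nhds_unique ((hf₀.tendsto γ').comp hlim) (tendsto_const_nhds.congr fun k => ?_)
    exact (S k).2.val.symm
  · push Not at hall
    have hex : ∃ k, ¬ ∃ m s, IsCandidate C h₀' (S k).1.1 (S k).1.2.2 m s := by
      obtain ⟨k, hk⟩ := hall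
      exact ⟨k, fun ⟨m, s, hms⟩ => hk m s hms⟩
    set N := Nat.find hex with hN
    have hNno := Nat.find_spec hex
    rw [← hN] at hNno
    have hlt : ∀ k < N, ∃ m s, IsCandidate C h₀' (S k).1.1 (S k).1.2.2 m s := fun k hk =>
      not_not.1 (Nat.find_min hex hk)
    have hconst : ∀ m, S (N + m) = S N := fun m => by
      induction m with
      | zero => rfl
      | succ m ih =>
        have := hfix (N + m) (by rw [ih]; exact hNno)
        rw [← ih, ← this]; rfl
    refine ⟨(S N).1.1, fun k => (S k).1.1, fun k => (S k).1.2.1, fun k => (S k).1.2.2, T,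
      (S N).2.norm, (S N).2.val, fun k => (S k).2, rfl, fun k => ?_⟩
    rcases lt_or_ge k N with hk | hk
    · refine Or.inl ⟨hcor k (hlt k hk), ?_⟩
      obtain ⟨m, hm⟩ := Nat.exists_eq_add_of_le hk.le
      have := closeUpTo_of_chain (N := (N : ℕ∞)) (f := fun k => (S k).1.1.1) P.hB' P.hB P.hg
        (T := T) (fun i hi => hclose i (hcor i (hlt i (by exact_mod_cast hi))))
        (fun i hi => by
          have hi' : i + 1 < N := by exact_mod_cast hi
          exact hgap i (hcor i (hlt i (by omega))) (hcor (i + 1) (hlt (i + 1) hi'))) m k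
        (by exact_mod_cast hm.ge)
      rw [← hm] at this
      exact this
    · obtain ⟨m, rfl⟩ := Nat.exists_eq_add_of_le hk
      refine Or.inr ⟨?_, ?_⟩
      · simp only [hconst m]; exact hNno
      · simp only [hconst m]

/-- The conclusion of the inductive construction. -/
theorem PrescriptionSetup.exists_geodesic [CompleteSpace X] (hgeod : IsGeodesicSpace X)
    (hcat : IsCATNegOne X) {γ₀ : GeodesicsFrom ξ}
    (P : PrescriptionSetup ξ γ₀.1 C f₀ h h₀' δ₀ Λ a b u g B₀ B K)
    (hf₀ : Continuous f₀) (hγ₀ : f₀ γ₀ = ENNReal.ofReal h) :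
    ∃ γ : GeodesicsFrom ξ, EntersAt γ (C 0) 0 ∧ f₀ γ = ENNReal.ofReal h ∧
      ∀ n, n ≠ 0 → (∃ t, δ₀ < t ∧ γ.1 t ∈ C n) →
        ξ ∉ withBoundary (C n) ∧ penetrationLength (C n) γ ≤ ENNReal.ofReal (h₀' + K) := by
  have := P.hgap; have hΛ := P.hΛ; have hδ := P.hδ₀; have ha := P.ha; have hb := P.hb
  have := P.hu; have := P.hg; have hK := P.hK; have hΛ' := P.hΛ'
  have henter : ∀ γ : GeodesicsFrom ξ, IsNormalized γ₀.1 γ → f₀ γ = ENNReal.ofReal h →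
      ∃ σ, EntersAt γ (C 0) σ ∧ Icc σ (σ + Λ) ⊆ timesIn γ (C 0) := fun γ hγ hfγ => by
    have hl := P.length_zero γ hfγ
    have hne : (timesIn γ (C 0)).Nonempty := by
      rw [nonempty_iff_ne_empty]
      intro he
      have : penetrationLength (C 0) γ = 0 := by unfold penetrationLength; rw [he, measure_empty]
      rw [this, nonpos_iff_eq_zero, ENNReal.ofReal_eq_zero] at hl
      linarith
    obtain ⟨σ, hσ⟩ := hγ.exists_entersAt (P.closed 0) (P.convex 0) P.start hne
    exact ⟨σ, hσ, Icc_subset_of_le_volume (hγ.ordConnected (P.convex 0))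
      (hγ.isClosed_timesIn (P.closed 0)) hσ hl⟩
  obtain ⟨γ₁, c, hγ₁, hshift⟩ := exists_normalized_shift hgeod hcat γ₀ γ₀
  have hval₁ : f₀ γ₁ = ENNReal.ofReal h := by rw [P.shift γ₀ γ₁ c hshift, hγ₀]
  obtain ⟨t₁, ht₁, hI₁⟩ := henter γ₁ hγ₁ hval₁
  have hst₁ : IsState γ₀.1 C f₀ h h₀' Λ γ₁ 0 t₁ :=
    ⟨hγ₁, hval₁, ht₁, hI₁ ⟨by linarith, le_rfl⟩, ⟨t₁, le_rfl, ht₁⟩, fun h => (h rfl).elim⟩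
  obtain ⟨γ', γ, n, t, T, hγ', hval, hst, hn0, hstep⟩ := P.exists_limit hgeod hcat hf₀ rfl hst₁
  obtain ⟨σ, hσ, hI⟩ := henter γ' hγ' hval
  have hσΛ : σ + Λ ∈ timesIn γ' (C 0) := hI ⟨by linarith, le_rfl⟩
  obtain ⟨γ'', hγ''⟩ := exists_shift γ' σ
  refine ⟨γ'', ?_, by rw [P.shift γ' γ'' σ hγ'', hval], fun m hm ⟨v, hv, hvC⟩ => ?_⟩
  · have := entersAt_shift hγ'' hσ
    rwa [sub_self] at this
  have hσD := (hγ'.mem_timesIn.1 hσ.1).1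
  have hvm : v + σ ∈ timesIn γ' (C m) := by
    rw [hγ'.mem_timesIn]
    refine ⟨startDomain_upper hσD (by linarith), ?_⟩
    rwa [hγ''] at hvC
  -- The assumption `v > δ₀` is what matters here: if `C m` were met before `σ`, it would overlap `C
  -- 0` on an interval of length greater than `δ₀` starting at `σ`.
  have hpos : ∀ s ∈ timesIn γ' (C m), σ < s := fun s hs => by
    by_contra! hsσ
    have k := P.overlap_le hγ' hm hs hvm hσ.1 hσΛ
    rw [max_eq_right hsσ] at k
    rcases min_choice (v + σ) (σ + Λ) with h | h <;> rw [h] at k <;> linarith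
  have hξm : ξ ∉ withBoundary (C m) := fun hξm =>
    (hpos σ (hγ'.mem_of_withBoundary hgeod hcat (P.closed m) (P.convex m) hξm hvm
      (by linarith) hσD)).false
  refine ⟨hξm, ?_⟩
  rw [penetrationLength_shift hγ'']
  by_contra! hlt
  obtain ⟨s, hs⟩ := hγ'.exists_entersAt (P.closed m) (P.convex m) hξm ⟨_, hvm⟩
  obtain ⟨e, he, hse⟩ := exists_mem_gt_of_lt_volume hs hlt
  have := P.sub_le_of_mem hγ' hst hn0 hstep hσ hσΛ hm hs.1 he (hpos s hs.1).le
  linarith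

end

section

/-! ### Estimates of the constants -/

/-- For `k ≥ 1` one has `sinh (2 arsinh k) = 2k√(1 + k²) ≥ 14/5` and `cosh (2 arsinh k) = 1 + 2k² ≥
3`. -/
theorem le_sinh_two_mul_arsinh_add {k δ : ℝ} (hk : 1 ≤ k) (hδ : 0 ≤ δ) :
    14 / 5 + 3 * δ ≤ Real.sinh (2 * Real.arsinh k + δ) := by
  rw [Real.sinh_add, Real.sinh_two_mul, Real.cosh_two_mul, Real.sinh_arsinh, Real.cosh_sq,
    Real.sinh_arsinh]
  have hc : 7 / 5 ≤ Real.cosh (Real.arsinh k) := by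
    rw [Real.cosh_arsinh]
    exact Real.le_sqrt_of_sq_le (by nlinarith)
  have h1 := Real.one_le_cosh δ
  have h2 : δ ≤ Real.sinh δ := Real.self_le_sinh_iff.2 hδ
  have h3 : 14 / 5 ≤ 2 * k * Real.cosh (Real.arsinh k) := by nlinarith
  have h4 : 3 ≤ k ^ 2 + 1 + k ^ 2 := by nlinarith
  nlinarith [mul_le_mul h3 h1 zero_le_one (by linarith), mul_le_mul h4 h2 hδ (by linarith)]

theorem log_two_le_arsinh {k : ℝ} (hk : 1 ≤ k) : Real.log 2 ≤ Real.arsinh k := by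
  rw [Real.arsinh]
  refine Real.log_le_log two_pos ?_
  have : 1 ≤ √(1 + k ^ 2) := Real.one_le_sqrt.2 (by nlinarith)
  linarith

theorem one_le_cosh_div_sinh {x : ℝ} (hx : 0 < x) : 1 ≤ Real.cosh x / Real.sinh x :=
  (one_le_div (Real.sinh_pos_iff.2 hx)).2 (Real.sinh_lt_cosh x).le

/-- Finite and infinite `ε` are treated together: `k = coth ε` or `k = 1`, since `arsinh 1 = log (1
+ √2)`. -/
theorem exists_pconst1'_eq {ε : ℝ≥0∞} (hε : 0 < ε) :
    ∃ k, 1 ≤ k ∧ pconst1' ε = 2 * Real.arsinh k := by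
  unfold pconst1'
  split_ifs with h
  · exact ⟨1, le_rfl, by rw [Real.arsinh]; norm_num⟩
  · exact ⟨_, one_le_cosh_div_sinh (ENNReal.toReal_pos hε.ne' h), rfl⟩

theorem two_mul_log_two_le_pconst1' {ε : ℝ≥0∞} (hε : 0 < ε) : 2 * Real.log 2 ≤ pconst1' ε := by
  obtain ⟨k, hk, h⟩ := exists_pconst1'_eq hε
  have := log_two_le_arsinh hk
  linarith

theorem le_sinh_pconst1' {ε : ℝ≥0∞} (hε : 0 < ε) {δ : ℝ} (hδ : 0 ≤ δ) :
    14 / 5 + 3 * δ ≤ Real.sinh (pconst1' ε + δ) := by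
  obtain ⟨k, hk, h⟩ := exists_pconst1'_eq hε
  exact h ▸ le_sinh_two_mul_arsinh_add hk hδ

theorem four_mul_log_two_le_pconst0 {ε : ℝ≥0∞} (hε : 0 < ε) : 4 * Real.log 2 ≤ pconst0 ε := by
  unfold pconst0
  split_ifs with h
  · linarith [Real.log_two_lt_d9]
  · have h0 := ENNReal.toReal_pos hε.ne' h
    have h1 : 4 ≤ 2 * (1 + Real.exp (ε.toReal / 2)) * Real.sinh ε.toReal / ε.toReal := by
      rw [le_div_iff₀ h0]
      have h2 : 1 ≤ Real.exp (ε.toReal / 2) := Real.one_le_exp (by positivity)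
      have h3 := Real.self_le_sinh_iff.2 h0.le
      nlinarith
    have h4 := Real.log_le_log (by norm_num) h1
    rw [show (4 : ℝ) = 2 ^ 2 by norm_num, Real.log_pow] at h4
    push_cast at h4
    linarith

theorem log_two_bounds : 0.6931 < Real.log 2 ∧ Real.log 2 < 0.6932 :=
  ⟨by linarith [Real.log_two_gt_d9], by linarith [Real.log_two_lt_d9]⟩

theorem pconst5_top (δ c₁ : ℝ) : pconst5 ⊤ δ c₁ = 5 * Real.sinh (c₁ + δ) := by
  rw [pconst5, pconst2', pconst3', if_pos rfl, if_pos rfl, max_self]; ring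

theorem le_pconst5 {ε : ℝ≥0∞} (hε : 0 < ε) (hε' : ε ≠ ⊤) {δ : ℝ} (hδ : 0 ≤ δ) :
    (6 + 5 / ε.toReal) * (14 / 5 + 3 * δ) ≤ pconst5 ε δ (pconst1' ε) := by
  have h0 := ENNReal.toReal_pos hε.ne' hε'
  have h1 := le_sinh_pconst1' hε hδ
  have h2 := two_mul_log_two_le_pconst1' hε
  have h3 : 6 + 5 / ε.toReal ≤ 2 * max (pconst2' ε) (pconst3' ε) := by
    have : 3 + 5 / 2 / ε.toReal ≤ pconst3' ε := by
      rw [pconst3', if_neg hε']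
      gcongr
      linarith [log_two_bounds.1]
    have := this.trans (le_max_right (pconst2' ε) _)
    have e : 5 / ε.toReal = 2 * (5 / 2 / ε.toReal) := by ring
    linarith
  rw [pconst5]
  exact mul_le_mul h3 h1 (by positivity) (le_trans (by positivity) h3)

/-! ### Thickness of `ε`-convex subsets compared with the prescribed constants. -/

/-- The thickness constant of the `ε`-convex subsets. -/
noncomputable def thickness (ε : ℝ≥0∞) : ℝ := if ε = ⊤ then 1 else min ε.toReal 1

theorem thickness_pos {ε : ℝ≥0∞} (hε : 0 < ε) : 0 < thickness ε := by
  unfold thickness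
  split_ifs with h
  · exact one_pos
  · exact lt_min (ENNReal.toReal_pos hε.ne' h) one_pos

theorem thickness_le_one (ε : ℝ≥0∞) : thickness ε ≤ 1 := by
  unfold thickness
  split_ifs
  · exact le_rfl
  · exact min_le_right _ _

theorem IsEpsConvex.isThickConvex {X : Type*} [MetricSpace X] [ProperSpace X]
    (hgeod : IsGeodesicSpace X)
    (hcat : IsCATNegOne X) {ε : ℝ≥0∞} (hε : 0 < ε) {C : Set X} (hC : IsEpsConvex ε C) :
    IsThickConvex (thickness ε) C := by
  rcases hC with ⟨hε', K, hK, rfl⟩ | ⟨rfl, hC⟩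
  · refine isThickConvex_cthickening hgeod hcat hK (thickness_pos hε) (thickness_le_one ε) ?_
    rw [thickness, if_neg hε']
    exact min_le_left _ _
  · obtain ⟨b, hb, rfl⟩ := hC.exists_isHoroFunction hcat
    rw [thickness, if_pos rfl]
    exact hb.isThickConvex

theorem neg_log_thickness_nonneg {ε : ℝ≥0∞} (hε : 0 < ε) : 0 ≤ -Real.log (thickness ε) :=
  neg_nonneg.2 (Real.log_nonpos (thickness_pos hε).le (thickness_le_one ε))

/-- The left-hand side is the `Λ` of the general case. The term `-2 log (ε/2)` of `hprime` pays for
thin neighbourhoods; for `ε ≥ 1` the terms `pconst1'` and `pconst0` suffice. -/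
theorem le_hprime {ε : ℝ≥0∞} (hε : 0 < ε) {δ : ℝ} (hδ : 0 ≤ δ) :
    2 * δ + 61 / 10 - 2 * Real.log (thickness ε) ≤
      hprime ε (Real.sinh (δ + pconst1' ε)) := by
  have h1 := le_sinh_pconst1' hε hδ
  have h2 := two_mul_log_two_le_pconst1' hε
  have h3 := four_mul_log_two_le_pconst0 hε
  have h4 := log_two_bounds.1
  rw [add_comm] at h1
  rw [add_comm δ]
  unfold hprime thickness
  split_ifs with h
  · rw [Real.log_one]; linarith
  · rcases le_total ε.toReal 1 with h5 | h5
    · refine le_trans ?_ (le_max_left _ _)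
      rw [min_eq_left h5]
      have h6 := le_max_right 0 (-2 * Real.log (ε.toReal / 2))
      rw [Real.log_div (ENNReal.toReal_pos hε.ne' h).ne' two_ne_zero] at h6 ⊢
      linarith
    · refine le_trans ?_ (le_max_right _ _)
      rw [min_eq_right h5, Real.log_one]
      linarith

/-- This pays for the total loss `a + 2b + u + δ₀ = 11 log 2 - 3 log r + δ₀`, as `11 log 2 < 8`. -/
theorem le_two_mul_pconst5 {ε : ℝ≥0∞} (hε : 0 < ε) {δ : ℝ} (hδ : 0 ≤ δ) :
    2 * δ + 8 - 3 * Real.log (thickness ε) ≤ 2 * pconst5 ε δ (pconst1' ε) := by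
  by_cases h : ε = ⊤
  · subst h
    rw [pconst5_top, thickness, if_pos rfl, Real.log_one]
    linarith [le_sinh_pconst1' hε hδ]
  · have h0 := ENNReal.toReal_pos hε.ne' h
    have h1 := le_pconst5 hε h hδ
    have h2 : 0 < 5 / ε.toReal := by positivity
    have h3 : -Real.log (thickness ε) ≤ 5 / ε.toReal := by
      rw [thickness, if_neg h]
      rcases le_total ε.toReal 1 with h5 | h5
      · rw [min_eq_left h5, ← Real.log_inv]
        have := Real.log_le_sub_one_of_pos (inv_pos.2 h0)
        have e : 5 / ε.toReal = 5 * ε.toReal⁻¹ := by ring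
        have := inv_pos.2 h0
        linarith
      · rw [min_eq_right h5, Real.log_one]; linarith
    nlinarith [mul_nonneg h2.le hδ]

theorem ofReal_le_penetrationLength {X : Type*} [MetricSpace X] {ξ : X ⊕ BoundaryAtInfinity X}
    {κ h Λ : ℝ} {C : Set X} {f : GeodesicsFrom ξ → ℝ≥0∞} (hκ : 0 ≤ κ)
    (hf : IsPenetrationMap κ C f) {γ : GeodesicsFrom ξ} (hγ : f γ = ENNReal.ofReal h)
    (hΛ : Λ ≤ h - κ) : ENNReal.ofReal Λ ≤ penetrationLength C γ := by
  have := (hf γ).1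
  rw [hγ, ← tsub_le_iff_right, ← ENNReal.ofReal_sub _ hκ] at this
  exact (ENNReal.ofReal_le_ofReal hΛ).trans this

theorem exp_neg_half_le : Real.exp (-(1 / 2)) ≤ 5 / 8 := by
  rw [Real.exp_neg, inv_le_comm₀ (Real.exp_pos _) (by norm_num)]
  have := Real.quadratic_le_exp_of_nonneg (x := 1 / 2) (by norm_num)
  linarith

theorem exp_neg_three_le : Real.exp (-3) ≤ 1 / 13 := by
  rw [Real.exp_neg, inv_le_comm₀ (Real.exp_pos _) (by norm_num)]
  have := Real.sum_le_exp_of_nonneg (x := 3) (by norm_num) 5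
  norm_num [Finset.sum_range_succ, Nat.factorial] at this
  norm_num
  linarith

end

/-! ### Choice of the constants and proof of the proposition. -/

theorem proposition4p10 {X : Type*} [MetricSpace X] [ProperSpace X]
    (hgeod : IsGeodesicSpace X) (hcat : IsCATNegOne X)
    (ε₀ : ℝ≥0∞) (hε₀ : 0 < ε₀) (δ₀ κ₀ : ℝ) (hδ₀ : 0 ≤ δ₀) (hκ₀ : 0 ≤ κ₀)
    (ξ₀ : X ⊕ BoundaryAtInfinity X)
    (C : ℕ → Set X) (hC : ∀ n, IsEpsConvex ε₀ (C n)) (hξ₀ : ξ₀ ∉ withBoundary (C 0))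
    (f₀ : GeodesicsFrom ξ₀ → ℝ≥0∞) (hf₀cont : Continuous f₀)
    (hf₀ : IsPenetrationMap κ₀ (C 0) f₀) (hf₀shift : IsShiftInvariant f₀)
    (h₀' h : ℝ)
    (hh₀' : hconst0 ε₀ δ₀ κ₀ (pconst1 ε₀ δ₀ (C 0) f₀) ≤ h₀')
    (hh : hconst1' ε₀ δ₀ h₀' (pconst1 ε₀ δ₀ (C 0) f₀) ≤ h)
    (hdisj : AlmostDisjoint C δ₀)
    (hpres : LocalPrescription C f₀ h h₀')
    (hγ₀ : ∃ γ₀ : GeodesicsFrom ξ₀, f₀ γ₀ = ENNReal.ofReal h) :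
    ∃ γ : GeodesicsFrom ξ₀, EntersAt γ (C 0) 0 ∧ f₀ γ = ENNReal.ofReal h ∧
      ∀ n, n ≠ 0 → (∃ t, δ₀ < t ∧ γ.1 t ∈ C n) →
        ξ₀ ∉ withBoundary (C n) ∧
        penetrationLength (C n) γ ≤
          ENNReal.ofReal (hconst1' ε₀ δ₀ h₀' (pconst1 ε₀ δ₀ (C 0) f₀)) := by
  obtain ⟨γ₀, hγ₀⟩ := hγ₀
  have hthick := fun n => (hC n).isThickConvex hgeod hcat hε₀
  obtain ⟨-, hκ', hη⟩ : δ₀ + κ₀ ≤ h₀' ∧ pconst0 ε₀ + κ₀ ≤ h₀' ∧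
      hprime ε₀ (Real.sinh (δ₀ + pconst1 ε₀ δ₀ (C 0) f₀)) ≤ h₀' := by
    simpa only [hconst0, max_le_iff] using hh₀'
  have hc₀ := four_mul_log_two_le_pconst0 hε₀
  obtain ⟨l1, l2⟩ := log_two_bounds
  unfold hconst1' at hh ⊢
  unfold pconst1 at *
  split_ifs at * with hcase
  · obtain ⟨rfl, rfl, -⟩ := hcase
    have hhoro : ∀ n, ∃ b, IsHoroFunction b ∧ C n = {x | b x ≤ 0} := fun n => by
      rcases hC n with ⟨h, -⟩ | ⟨-, hn⟩
      · exact (h rfl).elim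
      · exact hn.exists_isHoroFunction hcat
    have hs : (1 : ℝ) / 19 ≤ Real.sinh (1 / 19) := Real.self_le_sinh_iff.2 (by norm_num)
    have hp := two_mul_log_two_le_pconst1' hε₀
    rw [pconst5_top, add_zero] at hh ⊢
    rw [zero_add, hprime, if_pos rfl] at hη
    -- Numerically `3/19 + 4.056 + 2 · 3/4 > 5.7`.
    have h57 : 57 / 10 ≤ h₀' := by
      rw [pconst0, if_pos rfl] at hη hc₀
      rw [pconst1', if_pos rfl] at hη
      have h75 : 3 / 4 ≤ Real.log (1 + √2) := by
        have h14 : (7 : ℝ) / 5 ≤ √2 := Real.le_sqrt_of_sq_le (by norm_num)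
        have h24 := Real.log_le_log (by norm_num) (by linarith : (2 : ℝ) * (6 / 5) ≤ 1 + √2)
        rw [Real.log_mul (by norm_num) (by norm_num)] at h24
        have h12 := Real.one_sub_inv_le_log_of_pos (x := 6 / 5) (by norm_num)
        norm_num at h12
        linarith
      linarith
    -- The loss `a + 2b = 1/2` is below `10 sinh (1/19) ≥ 10/19`, which is where `1/19` is used most
    -- tightly. The gap `3` gives `3/25 + 0.13/13 = 0.13` for the geometric series.
    exact PrescriptionSetup.exists_geodesic (Λ := 4) (a := 1 / 6) (b := 1 / 6) (u := 0) (g := 3)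
      (B₀ := 3 / 25) (B := 13 / 100) hgeod hcat
      { closed := fun n => (hthick n).isClosed
        convex := fun n => (hthick n).isGeodConvex
        stable := fun n => by
          obtain ⟨b, hb, h⟩ := hhoro n
          exact h ▸ hb.isPenetrationStable
        entries := fun n => by
          obtain ⟨b, hb, h⟩ := hhoro n
          exact h ▸ hb.hasCloseEntries hgeod hcat h57
        disj := hdisj
        pres := hpres
        shift := hf₀shift
        start := hξ₀
        length_zero := fun γ hγ => ofReal_le_penetrationLength hκ₀ hf₀ hγ (by
          rw [pconst0, if_pos rfl] at hκ'
          linarith)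
        hδ₀ := le_rfl
        ha := by norm_num
        hb := by norm_num
        hu := le_rfl
        hg := by norm_num
        hB := by linarith [exp_neg_three_le]
        hB' := by norm_num
        hΛ := by linarith
        hgap := by norm_num
        hΛ' := by norm_num
        hK := by linarith } hf₀cont hγ₀
  · have hr := thickness_pos hε₀
    have hL := neg_log_thickness_nonneg hε₀
    have hΛ := (le_hprime hε₀ hδ₀).trans hη
    have hK := le_two_mul_pconst5 hε₀ hδ₀
    have e8 : Real.log 8 = 3 * Real.log 2 := by
      rw [show (8 : ℝ) = 2 ^ 3 by norm_num, Real.log_pow]; norm_num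
    have e8r : Real.log (8 / thickness ε₀) = 3 * Real.log 2 - Real.log (thickness ε₀) := by
      rw [Real.log_div (by norm_num) hr.ne', e8]
    have e4r : Real.log (4 / thickness ε₀) = 2 * Real.log 2 - Real.log (thickness ε₀) := by
      rw [Real.log_div (by norm_num) hr.ne', show (4 : ℝ) = 2 ^ 2 by norm_num, Real.log_pow]
      norm_num
    -- The gap `1/2` gives `3/2 + 4 · 5/8 = 4`. The main condition on `Λ` is `u + a + b + g = 8 log
    -- 2 - 2 log r + 1/2`, which is below `6.1 - 2 log r`.
    exact PrescriptionSetup.exists_geodesic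
      (Λ := 2 * δ₀ + 61 / 10 - 2 * Real.log (thickness ε₀)) (a := Real.log 8)
      (b := Real.log (8 / thickness ε₀)) (u := Real.log (4 / thickness ε₀)) (g := 1 / 2)
      (B₀ := 3 / 2) (B := 4) hgeod hcat
      { closed := fun n => (hthick n).isClosed
        convex := fun n => (hthick n).isGeodConvex
        stable := fun n =>
          IsThickConvex.isPenetrationStable hr (thickness_le_one ε₀) (hthick n) _
        entries := fun n => IsThickConvex.hasCloseEntries hgeod hcat hr (thickness_le_one ε₀)
          (hthick n) (by linarith) (by linarith)
        disj := hdisj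
        pres := hpres
        shift := hf₀shift
        start := hξ₀
        length_zero := fun γ hγ => ofReal_le_penetrationLength hκ₀ hf₀ hγ (by linarith)
        hδ₀ := hδ₀
        ha := by linarith
        hb := by linarith
        hu := by linarith
        hg := by norm_num
        hB := by linarith [exp_neg_half_le]
        hB' := by norm_num
        hΛ := hΛ
        hgap := by linarith
        hΛ' := by linarith
        hK := by linarith } hf₀cont hγ₀
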